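/- A *rational polyhedral complex* in $\mathbb{R}^n$ is a locally finite (for example, finite) collection $\Sigma$ of non-empty polyhedra, each cut out by finitely many inequalities with rational normal vectors, that is closed under taking non-empty faces and in which any two cells are disjoint or meet in a common face. Its support $|\Sigma|$ is the union of its cells. The star $\mathrm{Star}_w(\Sigma)$ at $w\in|\Sigma|$ is the set of all $v\in\mathbb{R}^n$ with $w+tv\in|\Sigma|$ for all sufficiently small $t\ge 0$. The *Bergman fan* $B(M)\subset\mathbb{R}^m$ of a matroid $M$ on $\{1,\dots,m\}$ is the set of points at which the minimum of the coordinates over each circuit of $M$ is attained at least twice. If $M$ has no loops, $B(M)$ has dimension $\operatorname{rk}M$ and its image in $\mathbb{R}^m/\mathbb{R}(1,\dots,1)$ has dimension $\operatorname{rk}M-1$ (when $m\geq 1$); either of the two is called a Bergman fan of $M$, with respect to the lattice $\mathbb{Z}^m$ or its image. A *$d$-dimensional tropical manifold* is a rational polyhedral complex $\Sigma$ in $\mathbb{R}^n$ such that for every $w\in|\Sigma|$ the set $\mathrm{Star}_w(\Sigma)$ is linearly isomorphic over $\mathbb{Z}$ to a $d$-dimensional Bergman fan $B$ of some matroid; that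 is, there is a linear isomorphism between the linear spans of $\mathrm{Star}_w(\Sigma)$ and $B$ that identifies the lattice points of these spans and maps $\mathrm{Star}_w(\Sigma)$ onto $B$. A *$k$-th Minkowski weight* of a rational polyhedral complex $\Sigma$ is a function $m$ from its set of $k$-dimensional cells to $\mathbb{Q}$ that is balanced: for every $(k-1)$-dimensional cell $\tau$, with parallel linear space $L$, one has $\sum_{\sigma\supset\tau}m(\sigma)v_\sigma\in L$, where $\sigma$ runs over the $k$-dimensional cells containing $\tau$ and $v_\sigma\in\mathbb{Z}^n$ represents the first lattice point on the ray $(\sigma+L)/L$ with respect to the lattice $\mathbb{Z}^n/(L\cap\mathbb{Z}^n)$ (here $\sigma$ and $\tau$ are translated so that $\tau$ contains $0$). A *tropical variety of dimension $d$* is (the support of) a non-empty rational polyhedral complex, pure of dimension $d$, that admits a $d$-th Minkowski weight with no value equal to $0$. **Theorem.** Let $\Sigma$ be a $d$-dimensional tropical manifold in $\mathbb{R}^n$ whose support is non-empty and connected. Then the space of $d$-th Minkowski weights of $\Sigma$ is a $1$-dimensional $\mathbb{Q}$-vector space, spanned by the constant weight $1$. Consequently $\Sigma$ has no proper tropical subvariety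 of the same dimension: every tropical variety $\Sigma'$ of dimension $d$ in $\mathbb{R}^n$ with $|\Sigma'|\subseteq|\Sigma|$ satisfies $|\Sigma'|=|\Sigma|$. This applies to tropical linear spaces. Let $p$ be a valuated matroid of rank $d$ on $\{1,\dots,n\}$, i.e. a function from the $d$-element subsets to $\mathbb{R}\cup\{\infty\}$, not identically $\infty$, such that for all $B_1,B_2$ and $b_1\in B_1\setminus B_2$ there is $b_2\in B_2\setminus B_1$ with $p(B_1)+p(B_2)\ge p(B_1\setminus b_1\cup b_2)+p(B_2\setminus b_2\cup b_1)$. Its tropical linear space is the set of $x\in\mathbb{R}^n$ such that for each $(d+1)$-element set $T$ the minimum over $i\in T$ of $p(T\setminus i)+x_i$ is attained at least twice (this includes the case where all these values are $\infty$). If this set is non-empty, then every rational polyhedral complex supported on it is a connected $d$-dimensional tropical manifold. -/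

import Mathlib

open Module

/-- A rational polyhedron in `ℝⁿ`: finitely many affine inequalities with rational normal vectors
and arbitrary real right-hand sides. -/
def IsRationalPolyhedron {n : ℕ} (P : Set (Fin n → ℝ)) : Prop :=
  ∃ (m : ℕ) (A : Fin m → Fin n → ℚ) (b : Fin m → ℝ),
    P = {x | ∀ j, ∑ i, (A j i : ℝ) * x i ≤ b j}

/-- The dimension of a non-empty polyhedron: that of its affine span. -/
noncomputable def polyDim {n : ℕ} (P : Set (Fin n → ℝ)) : ℕ :=
  finrank ℝ (vectorSpan ℝ P)

/-- A rational polyhedral complex in `ℝⁿ`: a locally finite collection of non-empty rational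
polyhedra, closed under passing to non-empty faces, such that the intersection of any two members
is empty or a face of both. (`IsExposed ℝ P F` says that `F` is empty or is the set of points of
`P` at which some linear functional is maximal on `P`, i.e. a face of `P`.) -/
structure RationalPolyhedralComplex (n : ℕ) where
  cells : Set (Set (Fin n → ℝ))
  rational : ∀ P ∈ cells, IsRationalPolyhedron P
  nonempty : ∀ P ∈ cells, P.Nonempty
  face_mem : ∀ P ∈ cells, ∀ F : Set (Fin n → ℝ), F.Nonempty → IsExposed ℝ P F → F ∈ cells
  inter_face : ∀ P ∈ cells, ∀ Q ∈ cells, IsExposed ℝ P (P ∩ Q) ∧ IsExposed ℝ Q (P ∩ Q)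
  locallyFinite : LocallyFinite (fun P : cells => (P : Set (Fin n → ℝ)))

/-- The lattice `ℤⁿ` in `ℝⁿ`. -/
def integerLattice (n : ℕ) : AddSubgroup (Fin n → ℝ) :=
  ((Int.castAddHom ℝ).compLeft (Fin n)).range

/-- For a `k`-dimensional rational polyhedron `σ` with a facet `τ`: the vector `v` represents the
first lattice point on the ray `(σ + L) / L`, where `L` is the linear space parallel to `τ`. That
is, `v` is a lattice vector pointing from `τ` into `σ`, and its class generates the group
`(ℤⁿ ∩ L_σ) / (ℤⁿ ∩ L)`, where `L_σ` is the linear space parallel to `σ`. Such a `v` exists and is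
unique modulo `ℤⁿ ∩ L`. -/
def IsPrimitiveNormal {n : ℕ} (τ σ : Set (Fin n → ℝ)) (v : Fin n → ℝ) : Prop :=
  v ∈ integerLattice n ∧
  (∃ c : ℝ, 0 ≤ c ∧ ∃ x ∈ σ, ∃ y ∈ τ, v = c • (x - y)) ∧
  v ∈ vectorSpan ℝ σ ∧
  ∀ u ∈ integerLattice n, u ∈ vectorSpan ℝ σ → ∃ k : ℤ, u - k • v ∈ vectorSpan ℝ τ

namespace RationalPolyhedralComplex

variable {n : ℕ} (X : RationalPolyhedralComplex n)

/-- The support `|X|`. -/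
def support : Set (Fin n → ℝ) := ⋃₀ X.cells

/-- The `k`-dimensional cells. -/
def Cell (k : ℕ) : Type := {P : Set (Fin n → ℝ) // P ∈ X.cells ∧ polyDim P = k}

/-- Every cell lies in a cell of dimension `d`, and no cell has dimension larger than `d`. -/
def IsPure (d : ℕ) : Prop :=
  ∀ P ∈ X.cells, polyDim P ≤ d ∧ ∃ Q ∈ X.cells, P ⊆ Q ∧ polyDim Q = d

/-- The support of the star fan of `X` at `w`: all directions `v` such that a short segment from
`w` in direction `v` stays in `|X|`. For `w ∈ |X|` this is the union, over the cells `P` containing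
`w`, of the cones generated by `P - w`. -/
def star (w : Fin n → ℝ) : Set (Fin n → ℝ) :=
  {v | ∃ ε : ℝ, 0 < ε ∧ ∀ t : ℝ, 0 ≤ t → t ≤ ε → w + t • v ∈ X.support}

variable {X} in
/-- By local finiteness only finitely many cells contain a given cell. -/
theorem finite_cells_above {j : ℕ} (k : ℕ) (τ : X.Cell j) :
    Finite {σ : X.Cell k // τ.1 ⊆ σ.1} := by
  obtain ⟨x, hx⟩ := X.nonempty τ.1 τ.2.1
  have h := X.locallyFinite.point_finite x
  have hf : Finite {P : X.cells | x ∈ (P : Set (Fin n → ℝ))} := h.to_subtype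
  refine Finite.of_injective
    (fun σ : {σ : X.Cell k // τ.1 ⊆ σ.1} =>
      (⟨⟨σ.1.1, σ.1.2.1⟩, σ.2 hx⟩ : {P : X.cells | x ∈ (P : Set (Fin n → ℝ))})) ?_
  intro σ ρ h
  have h' : σ.1.1 = ρ.1.1 := congrArg (fun P => P.1.1) h
  exact Subtype.ext (Subtype.ext h')

/-- The `ℚ`-vector space of `k`-th Minkowski weights: rational weights `m` on the `k`-cells for
which the `k`-skeleton is balanced at each of its `(k-1)`-cells `τ`, that is,
`∑ m(σ) v_σ = 0` modulo the linear space parallel to `τ`, where `σ` runs over the `k`-cells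
containing `τ` and `v_σ` represents the primitive normal vector of `σ` relative to `τ`. -/
noncomputable def minkowskiWeights (k : ℕ) : Submodule ℚ (X.Cell k → ℚ) where
  carrier := {m | ∀ (j : ℕ), j + 1 = k → ∀ (τ : X.Cell j) (v : X.Cell k → Fin n → ℝ),
    (∀ σ : X.Cell k, τ.1 ⊆ σ.1 → IsPrimitiveNormal τ.1 σ.1 (v σ)) →
    ∑ᶠ σ : {σ : X.Cell k // τ.1 ⊆ σ.1}, (m σ.1 : ℝ) • v σ.1 ∈ vectorSpan ℝ τ.1}
  zero_mem' := by
    intro j _ τ v _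
    simp
  add_mem' := by
    intro a b ha hb j hj τ v hv
    have hfin := finite_cells_above k τ
    have h := Submodule.add_mem _ (ha j hj τ v hv) (hb j hj τ v hv)
    rw [← finsum_add_distrib (Set.toFinite _) (Set.toFinite _)] at h
    simpa [add_smul] using h
  smul_mem' := by
    intro c a ha j hj τ v hv
    have hfin := finite_cells_above k τ
    have h := Submodule.smul_mem _ (c : ℝ) (ha j hj τ v hv)
    rw [smul_finsum' _ (Set.toFinite _)] at h
    simpa [mul_smul] using h

/-- `X` carries the structure of a tropical variety of dimension `d`: it is non-empty, pure of
dimension `d`, and balanced for some nowhere vanishing rational weights on its `d`-cells. -/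
def IsTropicalVariety (d : ℕ) : Prop :=
  X.cells.Nonempty ∧ X.IsPure d ∧ ∃ m ∈ X.minkowskiWeights d, ∀ σ, m σ ≠ 0

end RationalPolyhedralComplex

/-- The Bergman fan of a matroid on `{1, …, m}`: the points at which the minimum of the
coordinates over each circuit is attained at least twice. -/
def bergmanFan {m : ℕ} (M : Matroid (Fin m)) : Set (Fin m → ℝ) :=
  {x | ∀ C, M.IsCircuit C → ∃ i ∈ C, ∃ j ∈ C, i ≠ j ∧ ∀ k ∈ C, x i ≤ x k ∧ x j ≤ x k}

/-- The line `ℝ·(1, …, 1)` in `ℝᵐ`. -/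
def onesLine (m : ℕ) : Submodule ℝ (Fin m → ℝ) := Submodule.span ℝ {fun _ => 1}

/-- The projective Bergman fan, the image of the Bergman fan in `ℝᵐ / ℝ·(1, …, 1)`. -/
def projBergmanFan {m : ℕ} (M : Matroid (Fin m)) : Set ((Fin m → ℝ) ⧸ onesLine m) :=
  (onesLine m).mkQ '' bergmanFan M

/-- The image of `ℤᵐ` in `ℝᵐ / ℝ·(1, …, 1)`. -/
def projIntegerLattice (m : ℕ) : AddSubgroup ((Fin m → ℝ) ⧸ onesLine m) :=
  (integerLattice m).map (onesLine m).mkQ.toAddMonoidHom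

/-- `S` and `T`, subsets of real vector spaces with lattices `Λ` and `Γ`, are linearly isomorphic
over the integers: a linear isomorphism of their linear spans matches the lattice points of the
spans and carries `S` onto `T`. -/
def IntegrallyIsomorphic {V W : Type*} [AddCommGroup V] [Module ℝ V] [AddCommGroup W] [Module ℝ W]
    (Λ : AddSubgroup V) (S : Set V) (Γ : AddSubgroup W) (T : Set W) : Prop :=
  ∃ e : Submodule.span ℝ S ≃ₗ[ℝ] Submodule.span ℝ T,
    (∀ v : Submodule.span ℝ S, (v : V) ∈ Λ ↔ (e v : W) ∈ Γ) ∧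
    (∀ v : Submodule.span ℝ S, (v : V) ∈ S ↔ (e v : W) ∈ T)

/-- `X` is a `d`-dimensional tropical manifold: at every point of `|X|` its star is linearly
isomorphic, over the integers, to a `d`-dimensional Bergman fan of a matroid. Both forms of the
Bergman fan are admitted: that in `ℝᵐ`, whose dimension is the rank of the matroid, and that in
`ℝᵐ / ℝ·(1, …, 1)`, whose dimension is the rank minus one. (The fan is empty if the matroid has
loops.) -/
def RationalPolyhedralComplex.IsTropicalManifold {n : ℕ} (X : RationalPolyhedralComplex n)
    (d : ℕ) : Prop :=
  ∀ w ∈ X.support, ∃ (m : ℕ) (M : Matroid (Fin m)), M.E = Set.univ ∧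
    ((M.eRank = (d : ℕ∞) ∧
        IntegrallyIsomorphic (integerLattice n) (X.star w) (integerLattice m) (bergmanFan M)) ∨
      (M.eRank = ((d + 1 : ℕ) : ℕ∞) ∧
        IntegrallyIsomorphic (integerLattice n) (X.star w)
          (projIntegerLattice m) (projBergmanFan M)))

/-- A valuated matroid of rank `r` on `{1, …, n}`, given by a Plücker vector: a function on the
`r`-element subsets with values in `ℝ ∪ {∞}`, not identically `∞`, with the valuated exchange
axiom. (The value on sets of another size is fixed to be `∞`.) -/
structure ValuatedMatroid (n r : ℕ) where
  val : Finset (Fin n) → WithTop ℝ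
  eq_top : ∀ B, B.card ≠ r → val B = ⊤
  exists_basis : ∃ B, val B ≠ ⊤
  exchange : ∀ B₁ B₂ : Finset (Fin n), B₁.card = r → B₂.card = r → ∀ b₁ ∈ B₁ \ B₂,
    ∃ b₂ ∈ B₂ \ B₁,
      val (insert b₂ (B₁.erase b₁)) + val (insert b₁ (B₂.erase b₂)) ≤ val B₁ + val B₂

/-- The tropical linear space of a valuated matroid of rank `r`, in `ℝⁿ`: the common zero set of
the linear forms given by the valuated circuits, that is, the points `x` such that for every
`(r+1)`-element set `T` the minimum of `p(T ∖ i) + xᵢ` over `i ∈ T` is attained at least twice. -/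
def ValuatedMatroid.tropicalLinearSpace {n r : ℕ} (p : ValuatedMatroid n r) :
    Set (Fin n → ℝ) :=
  {x | ∀ T : Finset (Fin n), T.card = r + 1 → ∃ i ∈ T, ∃ j ∈ T, i ≠ j ∧ ∀ k ∈ T,
    p.val (T.erase i) + (x i : WithTop ℝ) ≤ p.val (T.erase k) + (x k : WithTop ℝ) ∧
    p.val (T.erase j) + (x j : WithTop ℝ) ≤ p.val (T.erase k) + (x k : WithTop ℝ)}

/-! The heart is a rigidity statement. Let `m` be a balanced weight on the `d`-cells of a complex
`Y`, and let `Z` be the union of the cells of non-zero weight. If `Z` is non-empty and contained in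
`|X|`, then `Z = |X|` (`sUnion_weightCells_eq`). With `Y = X` this is applied to `m - m(σ₀)·1`,
which vanishes on a `d`-cell `σ₀` and so must be zero. For a tropical variety with nowhere vanishing
weights, purity gives `Z = |Y|`, hence `|Y| = |X|`. Since `Z` is closed and `|X|` is connected, it
suffices that at every point of `Z` the star of `X` is contained in the star of `Z` (`star_subset`).

In codimension at most one this is linear algebra. There the star of `X` is a linear space or,
modulo its lineality space, a fan of rays whose primitive generators have only one relation, that
their sum is zero (`bergmanFan_of_lineality`, `star_codim_one`). So the constant weight is balanced,
and conversely a balanced weight takes the same value on all rays: if it is non-zero on one, it is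
non-zero on all (`balance`, `star_subset_of_codim_one`).

At an arbitrary point the star is a Bergman fan. For each basis `B` of the matroid, the projection
of the fan to `ℝ^B` has a piecewise linear section, and the images of these sections cover the fan
(`bergmanSection`, `exists_bergmanSection_eq`). In the chart `ℝ^B`, near the origin, the preimage of
`Z` is closed, and by the previous case it is open away from finitely many sets of codimension two,
which cannot disconnect a ball. So a chart with a non-empty open part in `Z` lies in `Z` entirely
(`star_subset_of_isOpen`). The section of an adjacent basis maps an open cone into the image of the
first one (`bergmanSection_exchange`), and any two bases are joined by exchanges, so `Z` spreads
from one chart to all.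

For a tropical linear space, the star at `w` is the Bergman fan of the initial matroid, whose bases
minimize the valuation tilted by `w`. Connectedness follows from closure under coordinatewise
minimum and under adding constants. -/

open Filter Topology

/-! ### Rational polyhedra, relative interiors and lattices in rational subspaces -/

section Polyhedra

variable {n : ℕ}

/-- The linear form on `ℝⁿ` with rational coefficient vector `a`. -/
noncomputable def rationalForm (a : Fin n → ℚ) : (Fin n → ℝ) →L[ℝ] ℝ :=
  ∑ i, (a i : ℝ) • ContinuousLinearMap.proj (R := ℝ) (φ := fun _ : Fin n => ℝ) i

theorem rationalForm_apply (a : Fin n → ℚ) (x : Fin n → ℝ) :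
    rationalForm a x = ∑ i, (a i : ℝ) * x i := by
  simp [rationalForm]

/-- The set of directions in which a short segment from `w` stays in `A`. -/
def dirStar (A : Set (Fin n → ℝ)) (w : Fin n → ℝ) : Set (Fin n → ℝ) :=
  {v | ∃ ε : ℝ, 0 < ε ∧ ∀ t : ℝ, 0 ≤ t → t ≤ ε → w + t • v ∈ A}

theorem dirStar_mono {A B : Set (Fin n → ℝ)} (h : A ⊆ B) (w : Fin n → ℝ) :
    dirStar A w ⊆ dirStar B w :=
  fun _ ⟨ε, hε, hv⟩ => ⟨ε, hε, fun t h0 h1 => h (hv t h0 h1)⟩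

theorem smul_mem_dirStar {A : Set (Fin n → ℝ)} {w v : Fin n → ℝ} (hv : v ∈ dirStar A w)
    {c : ℝ} (hc : 0 ≤ c) : c • v ∈ dirStar A w := by
  obtain ⟨ε, hε, h⟩ := hv
  rcases hc.eq_or_lt with rfl | hc
  · exact ⟨1, one_pos, fun t _ _ => by simpa using h 0 le_rfl hε.le⟩
  · refine ⟨ε / c, by positivity, fun t h0 h1 => ?_⟩
    rw [smul_smul]
    refine h _ (by positivity) ?_
    rwa [le_div_iff₀ hc] at h1

/-- `z` is a relative interior point of `P`. -/
def RelInt (P : Set (Fin n → ℝ)) (z : Fin n → ℝ) : Prop :=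
  z ∈ P ∧ ∃ δ : ℝ, 0 < δ ∧ ∀ v ∈ vectorSpan ℝ P, ‖v‖ < δ → z + v ∈ P

/-- A linear subspace of `ℝⁿ` cut out by rational linear forms. -/
def RationalSubspace (W : Submodule ℝ (Fin n → ℝ)) : Prop :=
  ∃ A : Set (Fin n → ℚ), ∀ v, v ∈ W ↔ ∀ a ∈ A, rationalForm a v = 0

theorem sub_mem_vectorSpan {P : Set (Fin n → ℝ)} {x y : Fin n → ℝ} (hx : x ∈ P) (hy : y ∈ P) :
    x - y ∈ vectorSpan ℝ P :=
  vsub_mem_vectorSpan ℝ hx hy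

theorem vectorSpan_le_of_forall {P : Set (Fin n → ℝ)} {W : Submodule ℝ (Fin n → ℝ)}
    (h : ∀ x ∈ P, ∀ y ∈ P, x - y ∈ W) : vectorSpan ℝ P ≤ W := by
  rw [vectorSpan_def, Submodule.span_le]
  rintro _ ⟨x, hx, y, hy, rfl⟩
  exact h x hx y hy

theorem isRationalPolyhedron_exists_forms {P : Set (Fin n → ℝ)} (hP : IsRationalPolyhedron P) :
    ∃ (m : ℕ) (a : Fin m → Fin n → ℚ) (b : Fin m → ℝ),
      ∀ x, x ∈ P ↔ ∀ j, rationalForm (a j) x ≤ b j := by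
  obtain ⟨m, A, b, rfl⟩ := hP
  exact ⟨m, A, b, fun x => by simp [rationalForm_apply]⟩

theorem IsRationalPolyhedron.isClosed {P : Set (Fin n → ℝ)} (hP : IsRationalPolyhedron P) :
    IsClosed P := by
  obtain ⟨m, a, b, h⟩ := isRationalPolyhedron_exists_forms hP
  have : P = ⋂ j, {x | rationalForm (a j) x ≤ b j} := by ext x; simp [h]
  rw [this]
  exact isClosed_iInter fun j => isClosed_le (rationalForm (a j)).continuous continuous_const

theorem IsRationalPolyhedron.convex {P : Set (Fin n → ℝ)} (hP : IsRationalPolyhedron P) :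
    Convex ℝ P := by
  obtain ⟨m, a, b, h⟩ := isRationalPolyhedron_exists_forms hP
  have : P = ⋂ j, {x | rationalForm (a j) x ≤ b j} := by ext x; simp [h]
  rw [this]
  exact convex_iInter fun j => convex_halfSpace_le (rationalForm (a j)).isLinear (b j)

/-- Near a point of a polyhedron, membership is decided by the inequalities active there. -/
theorem exists_ball_active {m : ℕ} (a : Fin m → Fin n → ℚ) (b : Fin m → ℝ) {z : Fin n → ℝ}
    (hz : ∀ j, rationalForm (a j) z ≤ b j) :
    ∃ δ : ℝ, 0 < δ ∧ ∀ u : Fin n → ℝ, ‖u‖ < δ →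
      (∀ j, rationalForm (a j) z = b j → rationalForm (a j) u ≤ 0) →
      ∀ j, rationalForm (a j) (z + u) ≤ b j := by
  have h : ∀ᶠ u : Fin n → ℝ in 𝓝 0, ∀ j, rationalForm (a j) z < b j →
      rationalForm (a j) (z + u) < b j := by
    rw [eventually_all]
    intro j
    by_cases hj : rationalForm (a j) z < b j
    · have hc : Continuous fun u : Fin n → ℝ => rationalForm (a j) (z + u) := by fun_prop
      have := hc.continuousAt (x := 0) |>.eventually_lt_const (u := b j) (by simpa using hj)
      filter_upwards [this] with u hu _ using hu
    · exact Eventually.of_forall fun u h => absurd h hj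
  obtain ⟨δ, hδ, hb⟩ := Metric.eventually_nhds_iff.1 h
  refine ⟨δ, hδ, fun u hu hact j => ?_⟩
  rcases (hz j).lt_or_eq with hj | hj
  · exact (hb (by simpa using hu) j hj).le
  · rw [map_add, hj]
    linarith [hact j hj]

/-- Inequalities not active at `z` have slack nearby, so small steps in the common kernel of the
active forms stay in `P`; rescaling such steps shows that this kernel is the whole direction space.
-/
theorem relInt_of_active {P : Set (Fin n → ℝ)} {m : ℕ} {a : Fin m → Fin n → ℚ} {b : Fin m → ℝ}
    (hP : ∀ x, x ∈ P ↔ ∀ j, rationalForm (a j) x ≤ b j) {z : Fin n → ℝ} (hz : z ∈ P)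
    (hact : ∀ j, rationalForm (a j) z = b j → ∀ x ∈ P, rationalForm (a j) x = b j) :
    RelInt P z ∧ ∀ v, v ∈ vectorSpan ℝ P ↔
      ∀ j, rationalForm (a j) z = b j → rationalForm (a j) v = 0 := by
  obtain ⟨δ, hδ, hb⟩ := exists_ball_active a b ((hP z).1 hz)
  have h1 : ∀ v ∈ vectorSpan ℝ P, ∀ j, rationalForm (a j) z = b j → rationalForm (a j) v = 0 := by
    intro v hv j hj
    have : vectorSpan ℝ P ≤ LinearMap.ker (rationalForm (a j)).toLinearMap :=
      vectorSpan_le_of_forall fun x hx y hy => by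
        simp [hact j hj x hx, hact j hj y hy]
    exact this hv
  have h2 : ∀ v : Fin n → ℝ, (∀ j, rationalForm (a j) z = b j → rationalForm (a j) v = 0) →
      ‖v‖ < δ → z + v ∈ P := fun v hv hδ' =>
    (hP _).2 (hb v hδ' fun j hj => (hv j hj).le)
  refine ⟨⟨hz, δ, hδ, fun v hv => h2 v (h1 v hv)⟩, fun v => ⟨h1 v, fun hv => ?_⟩⟩
  obtain ⟨t, ht, htv⟩ : ∃ t : ℝ, 0 < t ∧ ‖t • v‖ < δ := by
    refine ⟨δ / (‖v‖ + 1), by positivity, ?_⟩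
    rw [norm_smul, Real.norm_of_nonneg (by positivity), div_mul_eq_mul_div,
      div_lt_iff₀ (by positivity)]
    nlinarith [norm_nonneg v]
  have := sub_mem_vectorSpan (h2 (t • v) (fun j hj => by simp [hv j hj]) htv) hz
  rw [add_sub_cancel_left] at this
  exact (Submodule.smul_mem_iff _ ht.ne').1 this

/-- A point with the fewest active inequalities is relatively interior: if one of them were strict
at some `x ∈ P`, the midpoint with `x` would have fewer. The active forms at that point cut out the
direction space, which is therefore rational. -/
theorem exists_relInt {P : Set (Fin n → ℝ)} (hP : IsRationalPolyhedron P) (hne : P.Nonempty) :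
    (∃ z, RelInt P z) ∧ RationalSubspace (vectorSpan ℝ P) := by
  obtain ⟨m, a, b, h⟩ := isRationalPolyhedron_exists_forms hP
  let f : (Fin n → ℝ) → ℕ := fun x => Nat.card {j // rationalForm (a j) x = b j}
  obtain ⟨z, hz, hmin⟩ := (measure f).wf.has_min P hne
  have hact : ∀ j, rationalForm (a j) z = b j → ∀ x ∈ P, rationalForm (a j) x = b j := by
    intro j hj x hx
    by_contra hne
    have hlt : rationalForm (a j) x < b j := lt_of_le_of_ne ((h x).1 hx j) hne
    have hy : (1 / 2 : ℝ) • z + (1 / 2 : ℝ) • x ∈ P :=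
      hP.convex hz hx (by norm_num) (by norm_num) (by norm_num)
    refine hmin _ hy ?_
    change Nat.card _ < Nat.card _
    have hsub : {i | rationalForm (a i) ((1 / 2 : ℝ) • z + (1 / 2 : ℝ) • x) = b i} ⊂
        {i | rationalForm (a i) z = b i} := by
      refine ⟨fun i hi => ?_, fun hsub => ?_⟩
      · have h1 := (h z).1 hz i
        have h2 := (h x).1 hx i
        simp only [Set.mem_ofPred_eq, map_add, map_smul, smul_eq_mul] at hi ⊢
        linarith
      · have := hsub (a := j) hj
        simp only [Set.mem_ofPred_eq, map_add, map_smul, smul_eq_mul] at this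
        linarith
    exact Set.ncard_lt_ncard hsub (Set.toFinite _)
  have := relInt_of_active h hz hact
  refine ⟨⟨z, this.1⟩, {c | ∃ j, rationalForm (a j) z = b j ∧ c = a j}, fun v => ?_⟩
  rw [this.2]
  exact ⟨by rintro h _ ⟨j, hj, rfl⟩; exact h j hj, fun h j hj => h _ ⟨j, hj, rfl⟩⟩

/-- Membership in the integer lattice is coordinatewise. -/
theorem mem_integerLattice {x : Fin n → ℝ} :
    x ∈ integerLattice n ↔ ∀ i, ∃ k : ℤ, x i = k := by
  constructor
  · rintro ⟨k, rfl⟩ i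
    exact ⟨k i, rfl⟩
  · intro h
    choose k hk using h
    exact ⟨k, funext fun i => (hk i).symm⟩

/-- A common positive denominator. -/
theorem exists_common_denominator (q : Fin n → ℚ) :
    ∃ N : ℕ, 0 < N ∧ ∀ i, ∃ k : ℤ, (N : ℚ) * q i = k := by
  refine ⟨∏ i, (q i).den, Finset.prod_pos fun i _ => (q i).pos, fun i => ?_⟩
  obtain ⟨c, hc⟩ := Finset.dvd_prod_of_mem (fun i => (q i).den) (Finset.mem_univ i)
  refine ⟨c * (q i).num, ?_⟩
  rw [hc]
  push_cast
  rw [mul_comm ((q i).den : ℚ), mul_assoc, mul_comm ((q i).den : ℚ), Rat.mul_den_eq_num]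

/-- Expanding the coordinates of `v ∈ W` in a `ℚ`-basis of `ℝ` writes `v` as a real combination of
rational vectors. A rational equation satisfied by `v` holds for each of them separately, so they
lie in `W`, and clearing denominators makes them lattice points. -/
theorem RationalSubspace.le_span {W : Submodule ℝ (Fin n → ℝ)} (hW : RationalSubspace W) :
    W ≤ Submodule.span ℝ {u | u ∈ integerLattice n ∧ u ∈ W} := by
  obtain ⟨A, hA⟩ := hW
  intro v hv
  let β := Basis.ofVectorSpace ℚ ℝ
  let s : Finset _ := Finset.univ.biUnion fun i => (β.repr (v i)).support
  let q : Basis.ofVectorSpaceIndex ℚ ℝ → Fin n → ℚ := fun j i => β.repr (v i) j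
  have hv' : v = ∑ j ∈ s, (β j) • fun i => (q j i : ℝ) := by
    funext i
    simp only [Finset.sum_apply, Pi.smul_apply, smul_eq_mul, q]
    conv_lhs => rw [← β.linearCombination_repr (v i)]
    rw [Finsupp.linearCombination_apply, Finsupp.sum_of_support_subset (s := s)]
    · refine Finset.sum_congr rfl fun j _ => ?_
      rw [Rat.smul_def, mul_comm]
    · exact Finset.subset_biUnion_of_mem (fun i => (β.repr (v i)).support) (Finset.mem_univ i)
    · simp
  rw [hv']
  refine Submodule.sum_mem _ fun j hj => Submodule.smul_mem _ _ ?_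
  obtain ⟨N, hN, hk⟩ := exists_common_denominator (q j)
  have hN' : (N : ℝ) ≠ 0 := by positivity
  rw [← Submodule.smul_mem_iff _ hN']
  refine Submodule.subset_span ⟨?_, ?_⟩
  · rw [mem_integerLattice]
    intro i
    obtain ⟨k, hk⟩ := hk i
    exact ⟨k, by simpa using congrArg (Rat.cast (K := ℝ)) hk⟩
  · rw [hA]
    intro a ha
    have h0 := (hA v).1 hv a ha
    rw [rationalForm_apply] at h0
    have h1 : β.repr (∑ i, (a i) • v i) = 0 := by
      have h3 : ∑ i, (a i) • v i = 0 := by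
        rw [← h0]
        exact Finset.sum_congr rfl fun i _ => Rat.smul_def _ _
      rw [h3, map_zero]
    have h2 : ∑ i, a i * q j i = 0 := by
      have := DFunLike.congr_fun h1 j
      simpa [q, Finsupp.finsetSum_apply] using this
    rw [map_smul, rationalForm_apply]
    have := congrArg (Rat.cast (K := ℝ)) h2
    push_cast at this
    rw [this, smul_zero]

/-- The lattice points of a rational subspace modulo those of a rational hyperplane of it form an
infinite cyclic group. -/
theorem exists_lattice_generator {W W' : Submodule ℝ (Fin n → ℝ)} (hW : RationalSubspace W)
    (hW' : RationalSubspace W') (hle : W ≤ W') (hdim : finrank ℝ W + 1 = finrank ℝ W') :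
    ∃ v ∈ integerLattice n, v ∈ W' ∧ v ∉ W ∧
      ∀ u ∈ integerLattice n, u ∈ W' → ∃ k : ℤ, u - k • v ∈ W := by
  obtain ⟨w, hw, hwW⟩ : ∃ w ∈ W', w ∉ W := by
    by_contra! h
    have : W = W' := le_antisymm hle h
    rw [this] at hdim
    omega
  obtain ⟨A, hA⟩ := hW
  -- A defining form of `W` not vanishing on `W'` cuts out exactly `W` inside `W'`. Cleared of
  -- denominators it is integral on the lattice, so its values on lattice points of `W'` form a
  -- cyclic group; `v` is a point attaining a generator.
  obtain ⟨a, ha, haw⟩ : ∃ a ∈ A, rationalForm a w ≠ 0 := by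
    by_contra! h
    exact hwW ((hA w).2 h)
  obtain ⟨N, hN, hk⟩ := exists_common_denominator a
  choose k hk using hk
  have hint : ∀ u ∈ integerLattice n, ∃ c : ℤ, (N : ℝ) * rationalForm a u = c := by
    intro u hu
    obtain ⟨c, rfl⟩ := hu
    refine ⟨∑ i, k i * c i, ?_⟩
    rw [rationalForm_apply, Finset.mul_sum]
    push_cast
    refine Finset.sum_congr rfl fun i _ => ?_
    have := congrArg (Rat.cast (K := ℝ)) (hk i)
    push_cast at this
    rw [← this, mul_assoc]
    rfl
  let ℓ : (Fin n → ℝ) →ₗ[ℝ] ℝ := (rationalForm a).toLinearMap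
  have hℓ : ∀ x, ℓ x = rationalForm a x := fun _ => rfl
  have hker : ∀ x ∈ W', ℓ x = 0 → x ∈ W := by
    have hlt : W' ⊓ LinearMap.ker ℓ < W' := by
      refine lt_of_le_of_ne inf_le_left fun h => haw ?_
      have : w ∈ W' ⊓ LinearMap.ker ℓ := by rw [h]; exact hw
      exact this.2
    have h1 := Submodule.finrank_lt_finrank_of_lt hlt
    have h2 : W ≤ W' ⊓ LinearMap.ker ℓ := le_inf hle fun x hx => (hA x).1 hx a ha
    have h3 := Submodule.eq_of_le_of_finrank_le h2 (by omega)
    intro x hx hx0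
    rw [h3]
    exact ⟨hx, hx0⟩
  let H : AddSubgroup ℤ :=
    { carrier := {c | ∃ u ∈ integerLattice n, u ∈ W' ∧ (N : ℝ) * ℓ u = c}
      zero_mem' := ⟨0, zero_mem _, zero_mem _, by simp⟩
      add_mem' := by
        rintro c c' ⟨u, hu, hu', h⟩ ⟨v, hv, hv', h'⟩
        exact ⟨u + v, add_mem hu hv, add_mem hu' hv', by rw [map_add, mul_add, h, h']; simp⟩
      neg_mem' := by
        rintro c ⟨u, hu, hu', h⟩
        exact ⟨-u, neg_mem hu, neg_mem hu', by rw [map_neg, mul_neg, h]; simp⟩ }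
  obtain ⟨c, hc⟩ := Int.subgroup_cyclic H
  have hcH : c ∈ H := by rw [hc]; exact AddSubgroup.subset_closure rfl
  obtain ⟨v, hv, hv', hvc⟩ := hcH
  have hgen : ∀ u ∈ integerLattice n, u ∈ W' → ∃ k : ℤ, u - k • v ∈ W := by
    intro u hu hu'
    obtain ⟨e, he⟩ := hint u hu
    have heH : e ∈ H := ⟨u, hu, hu', he⟩
    rw [hc, AddSubgroup.mem_closure_singleton] at heH
    obtain ⟨k, hk⟩ := heH
    refine ⟨k, hker _ (sub_mem hu' (zsmul_mem hv' k)) ?_⟩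
    have hN' : (N : ℝ) ≠ 0 := by positivity
    have : (N : ℝ) * ℓ (u - k • v) = 0 := by
      rw [map_sub, map_zsmul, mul_sub, mul_smul_comm, hvc, hℓ, he, ← hk]
      simp
    exact (mul_eq_zero.1 this).resolve_left hN'
  -- Otherwise all lattice points of `W'` would lie in `W`, although they span `W'`.
  refine ⟨v, hv, hv', fun hvW => hwW ?_, hgen⟩
  have : Submodule.span ℝ {u | u ∈ integerLattice n ∧ u ∈ W'} ≤ W := by
    rw [Submodule.span_le]
    rintro u ⟨hu, hu'⟩
    obtain ⟨k, hk⟩ := hgen u hu hu'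
    have := add_mem hk (zsmul_mem hvW k)
    simpa using this
  exact this (hW'.le_span hw)

end Polyhedra

/-! ### Local structure of polyhedral complexes: stars, faces and primitive normals -/

section Complexes

variable {n : ℕ}

theorem RelInt.exists_segment {P : Set (Fin n → ℝ)} {z v : Fin n → ℝ} (hz : RelInt P z)
    (hv : v ∈ vectorSpan ℝ P) : ∃ ε : ℝ, 0 < ε ∧ ∀ t : ℝ, |t| ≤ ε → z + t • v ∈ P := by
  obtain ⟨-, δ, hδ, h⟩ := hz
  refine ⟨δ / (‖v‖ + 1), by positivity, fun t ht => h _ (Submodule.smul_mem _ _ hv) ?_⟩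
  rw [norm_smul, Real.norm_eq_abs]
  rw [le_div_iff₀ (by positivity)] at ht
  by_cases h0 : t = 0
  · simpa [h0] using hδ
  · nlinarith [norm_nonneg v, abs_pos.2 h0]

/-- The homothety with centre `z` and ratio `t` carries a relative ball around `y` in `P` to one
inside `P`, by convexity. -/
theorem RelInt.lineMap {P : Set (Fin n → ℝ)} (hP : Convex ℝ P) {y z : Fin n → ℝ}
    (hy : RelInt P y) (hz : z ∈ P) {t : ℝ} (h0 : 0 < t) (h1 : t ≤ 1) :
    RelInt P (z + t • (y - z)) := by
  obtain ⟨hyP, δ, hδ, h⟩ := hy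
  have key : ∀ v : Fin n → ℝ, y + v ∈ P → z + t • (y - z) + t • v ∈ P := by
    intro v hv
    have := hP hz hv (sub_nonneg.2 h1) h0.le (by ring)
    convert this using 1
    module
  refine ⟨by simpa using key 0 (by simpa using hyP), t * δ, by positivity, fun v hv hvδ => ?_⟩
  have := key (t⁻¹ • v) (h _ (Submodule.smul_mem _ _ hv) ?_)
  · rwa [smul_inv_smul₀ h0.ne'] at this
  · rw [norm_smul, norm_inv, Real.norm_of_nonneg h0.le, inv_mul_lt_iff₀ h0]
    exact hvδ

/-- A face meeting the relative interior is everything. -/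
theorem RelInt.eq_of_isExposed {P F : Set (Fin n → ℝ)} {z : Fin n → ℝ} (hz : RelInt P z)
    (hF : IsExposed ℝ P F) (hzF : z ∈ F) : F = P := by
  obtain ⟨l, hl⟩ := hF ⟨z, hzF⟩
  have hle : F ⊆ P := by rw [hl]; exact fun x hx => hx.1
  refine hle.antisymm fun x hx => ?_
  rw [hl] at hzF ⊢
  obtain ⟨ε, hε, h⟩ := hz.exists_segment (sub_mem_vectorSpan hz.1 hx)
  have h1 := hzF.2 _ (h ε (abs_of_pos hε).le)
  have h2 : l z - l x ≤ 0 := by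
    rw [map_add, map_smul, map_sub, smul_eq_mul] at h1
    by_contra! h3
    nlinarith [mul_pos hε h3]
  exact ⟨hx, fun y hy => (hzF.2 y hy).trans (by linarith)⟩

/-- A face of the same dimension is everything. -/
theorem eq_of_isExposed_of_polyDim {P F : Set (Fin n → ℝ)} (hne : F.Nonempty)
    (hF : IsExposed ℝ P F) (hdim : polyDim P ≤ polyDim F) : F = P := by
  obtain ⟨l, hl⟩ := hF hne
  obtain ⟨z, hz⟩ := hne
  have hle : F ⊆ P := by rw [hl]; exact fun x hx => hx.1
  have h1 : vectorSpan ℝ F = vectorSpan ℝ P :=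
    Submodule.eq_of_le_of_finrank_le (vectorSpan_mono ℝ hle) hdim
  have h2 : vectorSpan ℝ F ≤ LinearMap.ker l.toLinearMap := by
    refine vectorSpan_le_of_forall fun x hx y hy => ?_
    rw [hl] at hx hy
    have h1 := hx.2 y hy.1
    have h2 := hy.2 x hx.1
    simp only [LinearMap.mem_ker, map_sub, ContinuousLinearMap.coe_coe]
    linarith
  refine hle.antisymm fun x hx => ?_
  have h3 : l (x - z) = 0 := h2 (h1 ▸ sub_mem_vectorSpan hx (hle hz))
  rw [map_sub, sub_eq_zero] at h3
  rw [hl] at hz ⊢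
  exact ⟨hx, by rw [h3]; exact hz.2⟩

namespace RationalPolyhedralComplex

variable (X : RationalPolyhedralComplex n)

-- `τ ∩ P` is a face of `τ` that meets its relative interior, so it is `τ`.
variable {X} in
theorem subset_of_relInt {τ P : Set (Fin n → ℝ)} (hτ : τ ∈ X.cells) (hP : P ∈ X.cells)
    {z : Fin n → ℝ} (hz : RelInt τ z) (hzP : z ∈ P) : τ ⊆ P := by
  have := hz.eq_of_isExposed (X.inter_face τ hτ P hP).1 ⟨hz.1, hzP⟩
  exact Set.inter_eq_left.1 this

variable {X} in
theorem eq_of_subset_of_polyDim {σ P : Set (Fin n → ℝ)} (hσ : σ ∈ X.cells) (hP : P ∈ X.cells)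
    (h : σ ⊆ P) (hdim : polyDim P ≤ polyDim σ) : σ = P := by
  have h1 := (X.inter_face σ hσ P hP).2
  rw [Set.inter_eq_left.2 h] at h1
  exact eq_of_isExposed_of_polyDim (X.nonempty σ hσ) h1 hdim

/-- Every point of a cell is a relative interior point of one of its faces. -/
theorem exists_relInt_cell {P : Set (Fin n → ℝ)} (hP : P ∈ X.cells) {z : Fin n → ℝ}
    (hz : z ∈ P) : ∃ τ ∈ X.cells, τ ⊆ P ∧ RelInt τ z := by
  classical
  obtain ⟨m, a, b, h⟩ := isRationalPolyhedron_exists_forms (X.rational P hP)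
  let F : Set (Fin n → ℝ) :=
    {x ∈ P | ∀ j, rationalForm (a j) z = b j → rationalForm (a j) x = b j}
  have hzF : z ∈ F := ⟨hz, fun j hj => hj⟩
  -- On `P` the sum of the forms active at `z` is maximal exactly where all these inequalities are
  -- equalities, so it exposes `F`.
  let l : StrongDual ℝ (Fin n → ℝ) :=
    ∑ j, if rationalForm (a j) z = b j then rationalForm (a j) else 0
  have hl : ∀ x, l x = ∑ j, if rationalForm (a j) z = b j then rationalForm (a j) x else 0 := by
    intro x
    simp only [l, sum_apply]
    exact Finset.sum_congr rfl fun j _ => by split_ifs <;> rfl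
  have hFe : IsExposed ℝ P F := by
    refine fun _ => ⟨l, ?_⟩
    have hterm : ∀ x ∈ P, ∀ j, (if rationalForm (a j) z = b j then rationalForm (a j) x else 0) ≤
        if rationalForm (a j) z = b j then rationalForm (a j) z else 0 := by
      intro x hx j
      split_ifs with hj
      · rw [hj]; exact (h x).1 hx j
      · exact le_rfl
    ext x
    constructor
    · rintro ⟨hx, hxj⟩
      refine ⟨hx, fun y hy => ?_⟩
      have : l x = l z := by
        rw [hl, hl]
        exact Finset.sum_congr rfl fun j _ => by
          split_ifs with hj
          · rw [hxj j hj, hj]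
          · rfl
      rw [this, hl, hl]
      exact Finset.sum_le_sum fun j _ => hterm y hy j
    · rintro ⟨hx, hmax⟩
      refine ⟨hx, fun j hj => ?_⟩
      have heq : l x = l z := le_antisymm
        (by rw [hl, hl]; exact Finset.sum_le_sum fun j _ => hterm x hx j) (hmax z hz)
      rw [hl, hl] at heq
      have := (Finset.sum_eq_sum_iff_of_le fun j _ => hterm x hx j).1 heq j (Finset.mem_univ j)
      simpa [hj] using this
  refine ⟨F, X.face_mem P hP F ⟨z, hzF⟩ hFe, fun x hx => hx.1, hzF, ?_⟩
  obtain ⟨δ, hδ, hb⟩ := exists_ball_active a b ((h z).1 hz)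
  refine ⟨δ, hδ, fun v hv hvδ => ?_⟩
  have hv0 : ∀ j, rationalForm (a j) z = b j → rationalForm (a j) v = 0 := by
    intro j hj
    have : vectorSpan ℝ F ≤ LinearMap.ker (rationalForm (a j)).toLinearMap :=
      vectorSpan_le_of_forall fun x hx y hy => by
        simp [hx.2 j hj, hy.2 j hj]
    exact this hv
  refine ⟨(h _).2 (hb v hvδ fun j hj => (hv0 j hj).le), fun j hj => ?_⟩
  rw [map_add, hv0 j hj, hj, add_zero]

/-- Near any point the cells through it are conical and there are no other cells. -/
theorem exists_local_cone (w : Fin n → ℝ) : ∃ δ : ℝ, 0 < δ ∧ ∀ P ∈ X.cells, ∀ u : Fin n → ℝ,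
    ‖u‖ < δ → w + u ∈ P → w ∈ P ∧ ∀ t : ℝ, 0 ≤ t → ‖t • u‖ < δ → w + t • u ∈ P := by
  obtain ⟨N, hN, hfin⟩ := X.locallyFinite w
  have key : ∀ P : X.cells, ∀ᶠ δ in 𝓝[>] (0 : ℝ), ∀ u : Fin n → ℝ,
      ‖u‖ < δ → w + u ∈ (P : Set (Fin n → ℝ)) →
        w ∈ (P : Set (Fin n → ℝ)) ∧ ∀ t : ℝ, 0 ≤ t → ‖t • u‖ < δ →
          w + t • u ∈ (P : Set (Fin n → ℝ)) := by
    rintro ⟨P, hP⟩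
    by_cases hw : w ∈ P
    · obtain ⟨m, a, b, h⟩ := isRationalPolyhedron_exists_forms (X.rational P hP)
      obtain ⟨δ, hδ, hb⟩ := exists_ball_active a b ((h w).1 hw)
      filter_upwards [Ioo_mem_nhdsGT hδ] with δ' hδ' u hu hwu
      refine ⟨hw, fun t ht htu => (h _).2 (hb _ (htu.trans hδ'.2) fun j hj => ?_)⟩
      have := (h _).1 hwu j
      rw [map_add, hj] at this
      rw [map_smul, smul_eq_mul]
      exact mul_nonpos_of_nonneg_of_nonpos ht (by linarith)
    · have hc := (X.rational P hP).isClosed.isOpen_compl.mem_nhds hw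
      obtain ⟨δ, hδ, hb⟩ := Metric.mem_nhds_iff.1 hc
      filter_upwards [Ioo_mem_nhdsGT hδ] with δ' hδ' u hu hwu
      exact absurd hwu (hb (by simpa using hu.trans hδ'.2))
  obtain ⟨δ₀, hδ₀, hN'⟩ := Metric.mem_nhds_iff.1 hN
  -- A common radius is needed only for the finitely many cells that meet the neighbourhood `N`; a
  -- smaller radius keeps `w + u` inside `N`.
  have hall := (eventually_all_finite hfin).2 fun P _ => key P
  obtain ⟨δ, hδ, hδ0⟩ := (hall.and (Ioo_mem_nhdsGT hδ₀)).exists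
  refine ⟨δ, hδ0.1, fun P hP u hu hwu => hδ ⟨P, hP⟩ ⟨w + u, hwu, hN' ?_⟩ u hu hwu⟩
  simpa using hu.trans hδ0.2

-- Inside this radius every cell through `w` is a cone with apex `w`, so membership of `w + u` in
-- the union is unchanged by shrinking `u`. The radius does not depend on `C`.
variable {X} in
theorem mem_dirStar_iff_of_local_cone {C : Set (Set (Fin n → ℝ))} (hC : C ⊆ X.cells)
    {w : Fin n → ℝ} {δ : ℝ} (hδ : ∀ P ∈ X.cells, ∀ u : Fin n → ℝ,
      ‖u‖ < δ → w + u ∈ P → w ∈ P ∧ ∀ t : ℝ, 0 ≤ t → ‖t • u‖ < δ → w + t • u ∈ P)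
    {u : Fin n → ℝ} (hu : ‖u‖ < δ) : w + u ∈ ⋃₀ C ↔ u ∈ dirStar (⋃₀ C) w := by
  constructor
  · rintro ⟨P, hP, hwu⟩
    refine ⟨1, one_pos, fun t h0 h1 => ⟨P, hP, (hδ P (hC hP) u hu hwu).2 t h0 ?_⟩⟩
    rw [norm_smul, Real.norm_of_nonneg h0]
    nlinarith [norm_nonneg u]
  · rintro ⟨ε, hε, h⟩
    obtain ⟨P, hP, hP'⟩ := h (min ε 1) (by positivity) (min_le_left _ _)
    have hpos : 0 < min ε 1 := by positivity
    have hsm : ‖min ε 1 • u‖ < δ := by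
      rw [norm_smul, Real.norm_of_nonneg hpos.le]
      nlinarith [norm_nonneg u, min_le_right ε 1]
    have := (hδ P (hC hP) _ hsm hP').2 (min ε 1)⁻¹ (by positivity)
    rw [inv_smul_smul₀ hpos.ne'] at this
    exact ⟨P, hP, this hu⟩

theorem exists_mem_dirStar_iff {C : Set (Set (Fin n → ℝ))} (hC : C ⊆ X.cells)
    (w : Fin n → ℝ) : ∃ δ : ℝ, 0 < δ ∧ ∀ u : Fin n → ℝ, ‖u‖ < δ →
      (w + u ∈ ⋃₀ C ↔ u ∈ dirStar (⋃₀ C) w) := by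
  obtain ⟨δ, hδ, h⟩ := X.exists_local_cone w
  exact ⟨δ, hδ, fun u hu => mem_dirStar_iff_of_local_cone hC h hu⟩

theorem exists_norm_smul_lt (u : Fin n → ℝ) {δ : ℝ} (hδ : 0 < δ) :
    ∃ t : ℝ, 0 < t ∧ t ≤ 1 ∧ ‖t • u‖ < δ := by
  refine ⟨min 1 (δ / (‖u‖ + 1)), by positivity, min_le_left _ _, ?_⟩
  rw [norm_smul, Real.norm_of_nonneg (by positivity)]
  calc _ ≤ δ / (‖u‖ + 1) * ‖u‖ := by gcongr; exact min_le_right _ _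
    _ < δ := by
      rw [div_mul_eq_mul_div, div_lt_iff₀ (by positivity)]
      nlinarith [norm_nonneg u]

/-- A direction of the star of a union of cells points into one of the cells. -/
theorem exists_cell_of_mem_dirStar {C : Set (Set (Fin n → ℝ))} (hC : C ⊆ X.cells)
    {w u : Fin n → ℝ} (hu : u ∈ dirStar (⋃₀ C) w) :
    ∃ P ∈ C, w ∈ P ∧ ∃ ε : ℝ, 0 < ε ∧ w + ε • u ∈ P := by
  obtain ⟨δ, hδ, h⟩ := X.exists_local_cone w
  obtain ⟨t, ht, -, htu⟩ := exists_norm_smul_lt u hδ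
  obtain ⟨P, hP, hP'⟩ := (mem_dirStar_iff_of_local_cone hC h htu).2 (smul_mem_dirStar hu ht.le)
  exact ⟨P, hP, (h P (hC hP) _ htu hP').1, t, ht, hP'⟩

theorem mem_dirStar_of_mem_cell {C : Set (Set (Fin n → ℝ))} (hC : C ⊆ X.cells)
    {P : Set (Fin n → ℝ)} (hP : P ∈ C) {w u : Fin n → ℝ} (hw : w ∈ P) {ε : ℝ} (hε : 0 < ε)
    (hu : w + ε • u ∈ P) : u ∈ dirStar (⋃₀ C) w := by
  refine ⟨ε, hε, fun t h0 h1 => ⟨P, hP, ?_⟩⟩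
  have := (X.rational P (hC hP)).convex hw hu (a := 1 - t / ε) (b := t / ε)
    (sub_nonneg.2 ((div_le_one hε).2 h1)) (by positivity) (by ring)
  convert this using 1
  rw [smul_add, smul_smul, div_mul_cancel₀ _ hε.ne']
  module

/-- The star of a union of cells at a relative interior point `z` of a cell `τ` is invariant
under translation by the linear space parallel to `τ`. -/
theorem add_mem_dirStar {C : Set (Set (Fin n → ℝ))} (hC : C ⊆ X.cells)
    {τ : Set (Fin n → ℝ)} (hτ : τ ∈ X.cells) {z : Fin n → ℝ} (hz : RelInt τ z)
    {u v : Fin n → ℝ} (hu : u ∈ dirStar (⋃₀ C) z) (hv : v ∈ vectorSpan ℝ τ) :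
    u + v ∈ dirStar (⋃₀ C) z := by
  obtain ⟨P, hP, hzP, ε, hε, hP'⟩ := X.exists_cell_of_mem_dirStar hC hu
  obtain ⟨ε', hε', h⟩ := hz.exists_segment hv
  have hτP := subset_of_relInt hτ (hC hP) hz hzP
  have hconv := (X.rational P (hC hP)).convex
  set t := min ε ε'
  have ht : 0 < t := lt_min hε hε'
  have h1 : z + t • u ∈ P := by
    have := hconv hzP hP' (a := 1 - t / ε) (b := t / ε)
      (sub_nonneg.2 ((div_le_one hε).2 (min_le_left _ _))) (by positivity) (by ring)
    convert this using 1
    rw [smul_add, smul_smul, div_mul_cancel₀ _ hε.ne']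
    module
  have h2 : z + t • v ∈ P := hτP (h t (by rw [abs_of_pos ht]; exact min_le_right _ _))
  -- The midpoint of `z + t • u` and `z + t • v` is `z + (t / 2) • (u + v)`, and both lie in the
  -- convex set `P`, which contains `τ`.
  refine X.mem_dirStar_of_mem_cell hC hP hzP (ε := t / 2) (by positivity) ?_
  have := hconv h1 h2 (a := 1 / 2) (b := 1 / 2) (by norm_num) (by norm_num) (by norm_num)
  convert this using 1
  module

theorem zero_mem_dirStar {A : Set (Fin n → ℝ)} {z : Fin n → ℝ} (hz : z ∈ A) :
    (0 : Fin n → ℝ) ∈ dirStar A z :=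
  ⟨1, one_pos, fun t _ _ => by simpa using hz⟩

theorem vectorSpan_subset_dirStar {C : Set (Set (Fin n → ℝ))} (hC : C ⊆ X.cells)
    {τ : Set (Fin n → ℝ)} (hτ : τ ∈ X.cells) {z : Fin n → ℝ} (hz : RelInt τ z)
    (hzC : z ∈ ⋃₀ C) : (vectorSpan ℝ τ : Set (Fin n → ℝ)) ⊆ dirStar (⋃₀ C) z := by
  intro v hv
  simpa using X.add_mem_dirStar hC hτ hz (zero_mem_dirStar hzC) hv

theorem isClosed_sUnion {C : Set (Set (Fin n → ℝ))} (hC : C ⊆ X.cells) : IsClosed (⋃₀ C) := by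
  have hlf : LocallyFinite (fun P : C => (P : Set (Fin n → ℝ))) :=
    X.locallyFinite.comp_injective (g := Set.inclusion hC) (Set.inclusion_injective hC)
  rw [Set.sUnion_eq_iUnion]
  exact hlf.isClosed_iUnion fun P => (X.rational P (hC P.2)).isClosed

theorem finite_cells_at (z : Fin n → ℝ) : {P | P ∈ X.cells ∧ z ∈ P}.Finite := by
  refine ((X.locallyFinite.point_finite z).image Subtype.val).subset ?_
  rintro P ⟨hP, hz⟩
  exact ⟨⟨P, hP⟩, hz, rfl⟩

variable {X}

/-- If `v` were parallel to `τ`, so would be every lattice vector parallel to `σ`; these span the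
direction space of `σ`, which is larger. -/
theorem IsPrimitiveNormal.notMem {τ σ : Set (Fin n → ℝ)} {v : Fin n → ℝ}
    (hσ : σ ∈ X.cells) (hdim : polyDim τ < polyDim σ) (hv : IsPrimitiveNormal τ σ v) :
    v ∉ vectorSpan ℝ τ := by
  intro hvτ
  obtain ⟨-, -, -, hgen⟩ := hv
  have hrat := (exists_relInt (X.rational σ hσ) (X.nonempty σ hσ)).2
  have hle : vectorSpan ℝ σ ≤ vectorSpan ℝ τ := by
    refine hrat.le_span.trans (Submodule.span_le.2 ?_)
    rintro u ⟨hu, hu'⟩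
    obtain ⟨k, hk⟩ := hgen u hu hu'
    have := add_mem hk (zsmul_mem hvτ k)
    simpa using this
  have := Submodule.finrank_mono hle
  unfold polyDim at hdim
  omega

theorem exists_sub_smul_mem {W W' : Submodule ℝ (Fin n → ℝ)} (hle : W ≤ W')
    (hdim : finrank ℝ W + 1 = finrank ℝ W') {v : Fin n → ℝ} (hv : v ∈ W') (hvW : v ∉ W)
    {u : Fin n → ℝ} (hu : u ∈ W') : ∃ c : ℝ, u - c • v ∈ W := by
  have hlt : W < W ⊔ Submodule.span ℝ {v} := by
    refine lt_of_le_of_ne le_sup_left fun h => hvW ?_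
    rw [h]
    exact Submodule.mem_sup_right (Submodule.mem_span_singleton_self v)
  have h1 := Submodule.finrank_lt_finrank_of_lt hlt
  have h2 : W ⊔ Submodule.span ℝ {v} = W' := by
    refine Submodule.eq_of_le_of_finrank_le (sup_le hle ?_) (by omega)
    rwa [Submodule.span_singleton_le_iff_mem]
  rw [← h2] at hu
  obtain ⟨x, hx, y, hy, rfl⟩ := Submodule.mem_sup.1 hu
  obtain ⟨c, rfl⟩ := Submodule.mem_span_singleton.1 hy
  exact ⟨c, by simpa using hx⟩

/-- A linear functional exposing the cell `τ` as a face of the cell `σ`. -/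
theorem exists_facet_functional {τ σ : Set (Fin n → ℝ)} (hτ : τ ∈ X.cells) (hσ : σ ∈ X.cells)
    (hτσ : τ ⊆ σ) : ∃ l : StrongDual ℝ (Fin n → ℝ), (∀ v ∈ vectorSpan ℝ τ, l v = 0) ∧
      ∀ x ∈ σ, ∀ z ∈ τ, l x ≤ l z ∧ (l x = l z → x ∈ τ) := by
  obtain ⟨l, hl⟩ := (X.inter_face τ hτ σ hσ).2
    (by rw [Set.inter_eq_left.2 hτσ]; exact X.nonempty τ hτ)
  rw [Set.inter_eq_left.2 hτσ] at hl
  have hker : vectorSpan ℝ τ ≤ LinearMap.ker l.toLinearMap := by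
    refine vectorSpan_le_of_forall fun x hx y hy => ?_
    rw [hl] at hx hy
    have h1 := hx.2 y hy.1
    have h2 := hy.2 x hx.1
    simp only [LinearMap.mem_ker, map_sub, ContinuousLinearMap.coe_coe]
    linarith
  refine ⟨l, fun v hv => hker hv, fun x hx z hz => ?_⟩
  rw [hl] at hz ⊢
  exact ⟨hz.2 x hx, fun h => ⟨hx, fun y hy => h ▸ hz.2 y hy⟩⟩

/-- The primitive normal vector of a cell relative to a facet exists. -/
theorem exists_isPrimitiveNormal {τ σ : Set (Fin n → ℝ)} (hτ : τ ∈ X.cells) (hσ : σ ∈ X.cells)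
    (hτσ : τ ⊆ σ) (hdim : polyDim τ + 1 = polyDim σ) : ∃ v, IsPrimitiveNormal τ σ v := by
  obtain ⟨⟨z, hz⟩, hWτ⟩ := exists_relInt (X.rational τ hτ) (X.nonempty τ hτ)
  obtain ⟨⟨y, hy⟩, hWσ⟩ := exists_relInt (X.rational σ hσ) (X.nonempty σ hσ)
  have hle := vectorSpan_mono ℝ hτσ
  obtain ⟨v, hv, hv', hvτ, hgen⟩ := exists_lattice_generator hWτ hWσ hle hdim
  obtain ⟨c, hc⟩ := exists_sub_smul_mem hle hdim hv' hvτ (sub_mem_vectorSpan hy.1 (hτσ hz.1))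
  -- If `y - z` is a positive multiple of `v'` modulo the direction space of `τ`, then `v'` points
  -- into `σ`: compare a short step from `z` towards `y` with the step along `τ` given by the
  -- remainder.
  have key : ∀ v' : Fin n → ℝ, ∀ c' : ℝ, 0 < c' → y - z - c' • v' ∈ vectorSpan ℝ τ →
      ∃ e : ℝ, 0 ≤ e ∧ ∃ x ∈ σ, ∃ y ∈ τ, v' = e • (x - y) := by
    intro v' c' hc' hl
    obtain ⟨ε, hε, hseg⟩ := hz.exists_segment hl
    set t := min ε 1
    have ht : 0 < t := by positivity
    refine ⟨1 / (c' * t), by positivity, z + t • (y - z), ?_, z + t • (y - z - c' • v'),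
      hseg t (by rw [abs_of_pos ht]; exact min_le_left _ _), ?_⟩
    · exact (hy.lineMap (X.rational σ hσ).convex (hτσ hz.1) ht (min_le_right _ _)).1
    · have : z + t • (y - z) - (z + t • (y - z - c' • v')) = (c' * t) • v' := by module
      rw [this, smul_smul, one_div_mul_cancel (by positivity), one_smul]
  -- For `c = 0` the functional exposing `τ` would put the relative interior point `y` of `σ` into
  -- `τ`. The sign of `c` then decides between `v` and `-v`.
  have hc0 : c ≠ 0 := by
    rintro rfl
    rw [zero_smul, sub_zero] at hc
    obtain ⟨l, hl0, hl⟩ := exists_facet_functional hτ hσ hτσ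
    have h0 := hl0 _ hc
    rw [map_sub, sub_eq_zero] at h0
    have hyτ := (hl y hy.1 z hz.1).2 h0
    have := subset_of_relInt hσ hτ hy hyτ
    rw [hτσ.antisymm this] at hdim
    omega
  rcases lt_or_gt_of_ne hc0 with h | h
  · refine ⟨-v, neg_mem hv, key (-v) (-c) (by linarith) (by simpa using hc), neg_mem hv', ?_⟩
    intro u hu hu'
    obtain ⟨k, hk⟩ := hgen u hu hu'
    exact ⟨-k, by simpa using hk⟩
  · exact ⟨v, hv, key v c h hc, hv', hgen⟩

/-- A primitive normal vector of `σ` relative to `τ` points from `τ` into `σ`. -/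
theorem IsPrimitiveNormal.exists_mem {τ σ : Set (Fin n → ℝ)} {v z l : Fin n → ℝ}
    (hσ : σ ∈ X.cells) (hτσ : τ ⊆ σ) (hz : RelInt τ z) (hv : IsPrimitiveNormal τ σ v)
    (hl : l ∈ vectorSpan ℝ τ) {a : ℝ} (ha : 0 ≤ a) :
    ∃ ε : ℝ, 0 < ε ∧ ∀ t : ℝ, 0 ≤ t → t ≤ ε → z + t • (l + a • v) ∈ σ := by
  obtain ⟨-, ⟨c, hc, x, hx, y, hy, rfl⟩, -, -⟩ := hv
  have h2 : l - (a * c) • (y - z) ∈ vectorSpan ℝ τ :=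
    sub_mem hl (Submodule.smul_mem _ _ (sub_mem_vectorSpan hy hz.1))
  obtain ⟨ε, hε, hseg⟩ := hz.exists_segment h2
  have hac : 0 ≤ a * c := mul_nonneg ha hc
  -- With `v = c • (x - y)`, the target is the midpoint of `z + 2t(l - ac(y - z))` in `τ` and `z +
  -- 2tac(x - z)` in `σ`; the bounds on `t` keep both inside.
  refine ⟨min (ε / 2) (1 / (2 * (a * c) + 1)), by positivity, fun t h0 h1 => ?_⟩
  have h3 := hτσ (hseg (2 * t) (by
    rw [abs_of_nonneg (by positivity)]
    have := h1.trans (min_le_left _ _)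
    linarith))
  have hz' := hτσ hz.1
  have h4 : 2 * t * (a * c) ≤ 1 := by
    have := h1.trans (min_le_right _ _)
    rw [le_div_iff₀ (by positivity)] at this
    nlinarith
  have hconv := (X.rational σ hσ).convex
  have h5 := hconv hz' hx (a := 1 - 2 * t * (a * c)) (b := 2 * t * (a * c)) (by linarith)
    (by positivity) (by ring)
  have := hconv h3 h5 (a := 1 / 2) (b := 1 / 2) (by norm_num) (by norm_num) (by norm_num)
  convert this using 1
  module

end RationalPolyhedralComplex

end Complexes

/-! ### Bergman fans and their piecewise linear sections over bases -/

section Bergman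

variable {m : ℕ} {M : Matroid (Fin m)}

/-- The points of the Bergman fan are those whose superlevel sets are flats. -/
theorem mem_bergmanFan_iff {x : Fin m → ℝ} :
    x ∈ bergmanFan M ↔ ∀ (c : ℝ) (j : Fin m), j ∈ M.closure {i | c ≤ x i} → c ≤ x j := by
  constructor
  · intro hx c j hj
    by_contra! hlt
    have hjF : j ∉ {i | c ≤ x i} := by simpa using hlt
    obtain ⟨C, hCs, hC, hjC⟩ := Matroid.exists_isCircuit_of_mem_closure hj hjF
    obtain ⟨i, hi, i', hi', hne, h⟩ := hx C hC
    have key : ∀ k ∈ C, k ≠ j → x k ≤ x j → False := by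
      intro k hk hkj hle
      have : c ≤ x k := (hCs hk).resolve_left hkj
      linarith
    by_cases hij : i = j
    · exact key i' hi' (fun h' => hne (hij.trans h'.symm)) (h j hjC).2
    · exact key i hi hij (h j hjC).1
  · intro h C hC
    obtain ⟨j, hjC, hjmin⟩ := (Set.toFinite C).exists_minimalFor x C hC.nonempty
    have hmin : ∀ k ∈ C, x j ≤ x k := fun k hk =>
      (le_total (x j) (x k)).elim id fun h => hjmin hk h
    by_contra! hcon
    have hlt : ∀ k ∈ C \ {j}, x j < x k := by
      intro k hk
      obtain ⟨l, hl, hl'⟩ := hcon j hjC k hk.1 (fun h => hk.2 h.symm)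
      exact (hmin l hl).trans_lt (hl' (hmin l hl))
    -- A level separating a unique minimum at `j` from the rest of the circuit: its superlevel set
    -- spans `j` but omits it. If `C = {j}` is a loop, any level above `x j` will do.
    obtain ⟨c, hjc, hc⟩ : ∃ c, x j < c ∧ ∀ k ∈ C \ {j}, c ≤ x k := by
      rcases (C \ {j}).eq_empty_or_nonempty with he | hne
      · exact ⟨x j + 1, by linarith, by simp [he]⟩
      · obtain ⟨k, hk, hkmin⟩ := (Set.toFinite (C \ {j})).exists_minimalFor x _ hne
        exact ⟨x k, hlt k hk, fun l hl => (le_total (x k) (x l)).elim id fun h => hkmin hl h⟩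
    have := h c j (M.closure_subset_closure hc (hC.mem_closure_sdiff_singleton_of_mem hjC))
    linarith

theorem zero_mem_bergmanFan (hne : (bergmanFan M).Nonempty) :
    (0 : Fin m → ℝ) ∈ bergmanFan M := by
  obtain ⟨x, hx⟩ := hne
  intro C hC
  obtain ⟨i, hi, j, hj, hij, -⟩ := hx C hC
  exact ⟨i, hi, j, hj, hij, by simp⟩

/-- A matroid with a non-empty Bergman fan has no loops. -/
theorem closure_empty_of_bergmanFan_nonempty
    (hne : (bergmanFan M).Nonempty) : M.closure ∅ = ∅ := by
  rw [Set.eq_empty_iff_forall_notMem]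
  intro j hj
  have := mem_bergmanFan_iff.1 (zero_mem_bergmanFan hne) 1 j
    (M.closure_subset_closure (Set.empty_subset _) hj)
  norm_num at this

theorem smul_mem_bergmanFan {x : Fin m → ℝ} (hx : x ∈ bergmanFan M) {c : ℝ} (hc : 0 ≤ c) :
    c • x ∈ bergmanFan M := by
  intro C hC
  obtain ⟨i, hi, j, hj, hij, h⟩ := hx C hC
  exact ⟨i, hi, j, hj, hij, fun k hk => ⟨mul_le_mul_of_nonneg_left (h k hk).1 hc,
    mul_le_mul_of_nonneg_left (h k hk).2 hc⟩⟩

theorem add_const_mem_bergmanFan {x : Fin m → ℝ} (hx : x ∈ bergmanFan M) (c : ℝ) :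
    (x + fun _ => c) ∈ bergmanFan M := by
  intro C hC
  obtain ⟨i, hi, j, hj, hij, h⟩ := hx C hC
  exact ⟨i, hi, j, hj, hij, fun k hk => by simpa using h k hk⟩

/-- The indicator function of a flat lies in the Bergman fan. -/
theorem indicator_mem_bergmanFan (hne : (bergmanFan M).Nonempty)
    {F : Set (Fin m)} (hF : M.IsFlat F) : F.indicator (fun _ => (1 : ℝ)) ∈ bergmanFan M := by
  classical
  rw [mem_bergmanFan_iff]
  intro c j hj
  simp only [Set.indicator_apply] at hj ⊢
  rcases le_or_gt c 0 with hc | hc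
  · split_ifs <;> linarith
  · rcases le_or_gt c 1 with hc1 | hc1
    · have h1 : {i | c ≤ if i ∈ F then (1 : ℝ) else 0} ⊆ F := by
        intro i hi
        by_contra hiF
        simp only [Set.mem_ofPred_eq, hiF, if_false] at hi
        linarith
      have := M.closure_subset_closure h1 hj
      rw [hF.closure] at this
      simpa [this] using hc1
    · have h1 : {i | c ≤ if i ∈ F then (1 : ℝ) else 0} = ∅ := by
        rw [Set.eq_empty_iff_forall_notMem]
        intro i hi
        simp only [Set.mem_ofPred_eq] at hi
        split_ifs at hi <;> linarith
      rw [h1, closure_empty_of_bergmanFan_nonempty hne] at hj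
      exact absurd hj (Set.notMem_empty j)

/-- The smallest subset of the basis `B` whose closure contains `j`. -/
def basisSupport (M : Matroid (Fin m)) (B : Set (Fin m)) (j : Fin m) : Set (Fin m) :=
  ⋂₀ {J | J ⊆ B ∧ j ∈ M.closure J}

/-- For subsets of an independent set, the closure of an intersection is the intersection of the
closures. Hence the intersection defining the support still spans `j`, and a smallest spanning
subset of `B` exists. -/
theorem basisSupport_subset_iff (hE : M.E = Set.univ) {B : Set (Fin m)} (hB : M.IsBase B)
    {j : Fin m} {A : Set (Fin m)} (hA : A ⊆ B) :
    basisSupport M B j ⊆ A ↔ j ∈ M.closure A := by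
  have hBmem : B ∈ {J | J ⊆ B ∧ j ∈ M.closure J} :=
    ⟨Set.Subset.rfl, by rw [hB.closure_eq, hE]; trivial⟩
  constructor
  · intro h
    refine M.closure_subset_closure h ?_
    rw [basisSupport, hB.indep.closure_sInter_eq_biInter_closure_of_forall_subset
      ⟨B, hBmem⟩ (fun J hJ => hJ.1)]
    exact Set.mem_iInter₂.2 fun J hJ => hJ.2
  · intro h
    exact Set.sInter_subset_of_mem ⟨hA, h⟩

theorem basisSupport_subset (hE : M.E = Set.univ) {B : Set (Fin m)} (hB : M.IsBase B)
    (j : Fin m) : basisSupport M B j ⊆ B :=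
  (basisSupport_subset_iff hE hB Set.Subset.rfl).2 (by rw [hB.closure_eq, hE]; trivial)

theorem mem_closure_basisSupport (hE : M.E = Set.univ) {B : Set (Fin m)} (hB : M.IsBase B)
    (j : Fin m) : j ∈ M.closure (basisSupport M B j) :=
  (basisSupport_subset_iff hE hB (basisSupport_subset hE hB j)).1 Set.Subset.rfl

theorem basisSupport_nonempty (hE : M.E = Set.univ) (hne : (bergmanFan M).Nonempty)
    {B : Set (Fin m)} (hB : M.IsBase B) (j : Fin m) : (basisSupport M B j).Nonempty := by
  by_contra h
  have := mem_closure_basisSupport hE hB j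
  rw [Set.not_nonempty_iff_eq_empty.1 h, closure_empty_of_bergmanFan_nonempty hne] at this
  exact this

/-- The elements of `B` that support `j`. -/
noncomputable def supportFinset (M : Matroid (Fin m)) (B : Set (Fin m)) (j : Fin m) : Finset B :=
  (Set.toFinite {i : B | (i : Fin m) ∈ basisSupport M B j}).toFinset

theorem mem_supportFinset {B : Set (Fin m)} {j : Fin m} {i : B} :
    i ∈ supportFinset M B j ↔ (i : Fin m) ∈ basisSupport M B j := by
  simp [supportFinset]

/-- The piecewise linear section over `ℝ^B` of the projection of the Bergman fan to the
coordinates in a basis `B`. -/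
noncomputable def bergmanSection (M : Matroid (Fin m)) (B : Set (Fin m)) (x : B → ℝ) :
    Fin m → ℝ := by
  classical
  -- The default value `0` never occurs for a basis of a loopless matroid, where all supports are
  -- non-empty.
  exact fun j => if h : (supportFinset M B j).Nonempty then (supportFinset M B j).inf' h x else 0

/-- The projection to the coordinates in `B`. -/
def coordProj (B : Set (Fin m)) : (Fin m → ℝ) →ₗ[ℝ] (B → ℝ) :=
  LinearMap.funLeft ℝ ℝ Subtype.val

@[simp] theorem coordProj_apply (B : Set (Fin m)) (x : Fin m → ℝ) (i : B) :
    coordProj B x i = x i := rfl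

variable (hE : M.E = Set.univ) (hne : (bergmanFan M).Nonempty) {B : Set (Fin m)}
  (hB : M.IsBase B)

include hE hne hB

theorem supportFinset_nonempty (j : Fin m) : (supportFinset M B j).Nonempty := by
  obtain ⟨i, hi⟩ := basisSupport_nonempty hE hne hB j
  exact ⟨⟨i, basisSupport_subset hE hB j hi⟩, mem_supportFinset.2 hi⟩

/-- Superlevel sets of the section are spanned by superlevel sets in the basis. -/
theorem le_bergmanSection_iff (x : B → ℝ) (c : ℝ) (j : Fin m) :
    c ≤ bergmanSection M B x j ↔ j ∈ M.closure (Subtype.val '' {i : B | c ≤ x i}) := by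
  classical
  have hsub : Subtype.val '' {i : B | c ≤ x i} ⊆ B := by rintro _ ⟨i, -, rfl⟩; exact i.2
  rw [← basisSupport_subset_iff hE hB hsub]
  rw [bergmanSection, dif_pos (supportFinset_nonempty hE hne hB j), Finset.le_inf'_iff]
  constructor
  · intro h i hi
    exact ⟨⟨i, basisSupport_subset hE hB j hi⟩, h _ (mem_supportFinset.2 hi), rfl⟩
  · intro h i hi
    obtain ⟨i', hi', h'⟩ := h (mem_supportFinset.1 hi)
    rwa [Subtype.ext h'] at hi'

theorem bergmanSection_eq_of_forall {x : B → ℝ} {z : Fin m → ℝ}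
    (h : ∀ c j, c ≤ z j ↔ j ∈ M.closure (Subtype.val '' {i : B | c ≤ x i})) :
    bergmanSection M B x = z := by
  funext j
  refine le_antisymm ?_ ?_
  · rw [h, ← le_bergmanSection_iff hE hne hB]
  · rw [le_bergmanSection_iff hE hne hB, ← h]

/-- The closure of a subset of a basis meets the basis in that subset only, so superlevel sets
acquire no new basis elements. -/
theorem coordProj_bergmanSection (x : B → ℝ) : coordProj B (bergmanSection M B x) = x := by
  funext j
  refine eq_of_forall_le_iff fun c => ?_
  rw [coordProj_apply, le_bergmanSection_iff hE hne hB]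
  constructor
  · intro h
    have hsub : Subtype.val '' {i : B | c ≤ x i} ⊆ B := by rintro _ ⟨i, -, rfl⟩; exact i.2
    have := (hB.indep.closure_inter_eq_self_of_subset hsub).subset ⟨h, j.2⟩
    obtain ⟨i, hi, hij⟩ := this
    rwa [Subtype.ext hij] at hi
  · intro h
    exact M.mem_closure_of_mem ⟨j, h, rfl⟩ (by rw [hE]; exact Set.subset_univ _)

/-- The superlevel sets of the section are closures, hence flats. -/
theorem bergmanSection_mem (x : B → ℝ) : bergmanSection M B x ∈ bergmanFan M := by
  rw [mem_bergmanFan_iff]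
  intro c j hj
  have : {i | c ≤ bergmanSection M B x i} = M.closure (Subtype.val '' {i : B | c ≤ x i}) := by
    ext i
    exact le_bergmanSection_iff hE hne hB x c i
  rw [this, M.closure_closure, ← le_bergmanSection_iff hE hne hB] at hj
  exact hj

theorem bergmanSection_zero : bergmanSection M B 0 = 0 := by
  classical
  funext j
  rw [bergmanSection, dif_pos (supportFinset_nonempty hE hne hB j)]
  exact Finset.inf'_const _ (0 : ℝ)

theorem bergmanSection_smul (x : B → ℝ) {c : ℝ} (hc : 0 < c) :
    bergmanSection M B (c • x) = c • bergmanSection M B x := by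
  refine bergmanSection_eq_of_forall hE hne hB fun a j => ?_
  have h1 : ∀ y : ℝ, a ≤ c * y ↔ a / c ≤ y := fun y => by rw [div_le_iff₀ hc, mul_comm]
  simp only [Pi.smul_apply, smul_eq_mul, h1]
  exact le_bergmanSection_iff hE hne hB x _ j

omit hE hne hB in
theorem continuous_bergmanSection : Continuous (bergmanSection M B) := by
  classical
  refine continuous_pi fun j => ?_
  by_cases h : (supportFinset M B j).Nonempty
  · simp only [bergmanSection, dif_pos h]
    exact Continuous.finset_inf'_apply h fun i _ => continuous_apply i
  · simp only [bergmanSection, dif_neg h]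
    exact continuous_const

omit hB in
/-- Every point of the Bergman fan is in the image of the section of a suitable basis. -/
theorem exists_bergmanSection_eq {x : Fin m → ℝ} (hx : x ∈ bergmanFan M) :
    ∃ B, M.IsBase B ∧ bergmanSection M B (coordProj B x) = x := by
  classical
  -- The basis is one of maximal `x`-weight, as found by the greedy algorithm.
  let wt : Set (Fin m) → ℝ := fun B => ∑ i, if i ∈ B then x i else 0
  obtain ⟨B, hB, hmax⟩ := (Set.toFinite {B | M.IsBase B}).exists_maximalFor wt _ M.exists_isBase
  have hB : M.IsBase B := hB
  have hmax' : ∀ B', M.IsBase B' → wt B' ≤ wt B := fun B' hB' =>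
    (le_total (wt B) (wt B')).elim (fun h => hmax hB' h) id
  refine ⟨B, hB, bergmanSection_eq_of_forall hE hne hB fun c j => ?_⟩
  have himg : Subtype.val '' {i : B | c ≤ coordProj B x i} = {i | i ∈ B ∧ c ≤ x i} := by
    ext i
    constructor
    · rintro ⟨i, hi, rfl⟩
      exact ⟨i.2, hi⟩
    · rintro ⟨hi, hc⟩
      exact ⟨⟨i, hi⟩, hc, rfl⟩
  rw [himg]
  constructor
  · intro hcj
    by_cases hjB : j ∈ B
    · exact M.mem_closure_of_mem ⟨hjB, hcj⟩ (by rw [hE]; exact Set.subset_univ _)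
    rw [← basisSupport_subset_iff hE hB (fun i hi => hi.1)]
    intro i hi
    have hiB := basisSupport_subset hE hB j hi
    refine ⟨hiB, hcj.trans ?_⟩
    -- As `i` supports `j`, it can be exchanged for `j`; maximality of the weight then gives `x j ≤
    -- x i`.
    have hnot : j ∉ M.closure (B \ {i}) := by
      intro hcl
      have := (basisSupport_subset_iff hE hB Set.sdiff_subset).2 hcl hi
      exact this.2 rfl
    have hB' := hB.exchange_base_of_notMem_closure hiB hnot (by rw [hE]; trivial)
    have hle := hmax' _ hB'
    have hij : i ≠ j := fun h => hjB (h ▸ hiB)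
    have h1 : wt (insert j (B \ {i})) + x i = wt B + x j := by
      have e1 : x i = ∑ k, if k = i then x k else 0 := by simp
      have e2 : x j = ∑ k, if k = j then x k else 0 := by simp
      rw [e1, e2, ← Finset.sum_add_distrib, ← Finset.sum_add_distrib]
      refine Finset.sum_congr rfl fun k _ => ?_
      by_cases hki : k = i
      · subst hki; simp [hiB, hij]
      · by_cases hkj : k = j
        · subst hkj; simp [hjB, hki]
        · simp [hki, hkj]
    linarith
  · intro hj
    refine mem_bergmanFan_iff.1 hx c j (M.closure_subset_closure (fun i hi => hi.2) hj)

/-- Sections of adjacent bases agree where the exchanged coordinate is minimal. -/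
theorem bergmanSection_exchange {b b' : Fin m}
    (hB' : M.IsBase (insert b' (B \ {b}))) (x : ↥(insert b' (B \ {b})) → ℝ)
    (hx : ∀ i, x ⟨b', Set.mem_insert _ _⟩ ≤ x i) :
    ∃ y : B → ℝ, bergmanSection M B y = bergmanSection M (insert b' (B \ {b})) x := by
  classical
  let B' := insert b' (B \ {b})
  -- The value at `b'` is moved to `b`. At levels up to this minimum both superlevel sets are entire
  -- bases; at higher levels they contain neither `b` nor `b'` and coincide. Either way they span
  -- the same flat.
  let y : B → ℝ := fun i => if h : (i : Fin m) = b then x ⟨b', Set.mem_insert _ _⟩ else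
    x ⟨i, Set.mem_insert_of_mem _ ⟨i.2, h⟩⟩
  refine ⟨y, bergmanSection_eq_of_forall hE hne hB fun c j => ?_⟩
  rw [le_bergmanSection_iff hE hne hB']
  by_cases hc : c ≤ x ⟨b', Set.mem_insert _ _⟩
  · have h1 : Subtype.val '' {i : B | c ≤ y i} = B := by
      refine Set.Subset.antisymm (by rintro _ ⟨i, -, rfl⟩; exact i.2) fun i hi => ?_
      refine ⟨⟨i, hi⟩, ?_, rfl⟩
      simp only [Set.mem_ofPred_eq, y]
      split_ifs
      · exact hc
      · exact hc.trans (hx _)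
    have h2 : Subtype.val '' {i : B' | c ≤ x i} = B' :=
      Set.Subset.antisymm (by rintro _ ⟨i, -, rfl⟩; exact i.2) fun i hi =>
        ⟨⟨i, hi⟩, hc.trans (hx _), rfl⟩
    rw [h1, h2, hB.closure_eq, hB'.closure_eq]
  · have h1 : Subtype.val '' {i : B | c ≤ y i} = Subtype.val '' {i : B' | c ≤ x i} := by
      ext i
      constructor
      · rintro ⟨i, hi, rfl⟩
        simp only [Set.mem_ofPred_eq, y] at hi
        split_ifs at hi with h
        · exact absurd hi hc
        · exact ⟨⟨i, _⟩, hi, rfl⟩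
      · rintro ⟨⟨i, hi'⟩, hi, rfl⟩
        rcases hi' with rfl | ⟨hiB, hib⟩
        · exact absurd hi hc
        · refine ⟨⟨i, hiB⟩, ?_, rfl⟩
          simp only [Set.mem_ofPred_eq, y]
          split_ifs with h
          · exact absurd h hib
          · exact hi
    rw [h1]

end Bergman

/-! ### Bergman fans with lineality space of codimension at most one -/

section Lineality

/-- The set `S` is a union of half-spaces with common boundary `V`, spanned modulo `V` by lattice
vectors `f i` which are primitive and whose only relation modulo `V` is that their sum is zero. -/
structure IsTropicalLine {n : ℕ} (V : Submodule ℝ (Fin n → ℝ)) (S : Set (Fin n → ℝ)) {ι : Type}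
    [Fintype ι] (f : ι → Fin n → ℝ) : Prop where
  nontrivial : Nontrivial ι
  mem_iff : ∀ x, x ∈ S ↔ ∃ i, ∃ a : ℝ, 0 ≤ a ∧ x - a • f i ∈ V
  relation : ∀ a : ι → ℝ, ∑ i, a i • f i ∈ V ↔ ∀ i j, a i = a j
  lattice : ∀ i, f i ∈ integerLattice n
  integral : ∀ i (a : ℝ), ∀ u ∈ integerLattice n, u - a • f i ∈ V → ∃ k : ℤ, a = k

variable {m : ℕ} {M : Matroid (Fin m)}

/-- Two coordinates are identified by `V` if they agree on all vectors of `V`. -/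
def coordSetoid (V : Submodule ℝ (Fin m → ℝ)) : Setoid (Fin m) where
  r i j := ∀ v ∈ V, v i = v j
  iseqv := ⟨fun _ _ _ => rfl, fun h v hv => (h v hv).symm,
    fun h h' v hv => (h v hv).trans (h' v hv)⟩

/-- The equivalence class of `k` under the identification of coordinates by `V`. -/
def coordClass (V : Submodule ℝ (Fin m → ℝ)) (k : Fin m) : Set (Fin m) :=
  {i | ∀ v ∈ V, v i = v k}

variable (hE : M.E = Set.univ) (hne : (bergmanFan M).Nonempty)
  {V : Submodule ℝ (Fin m → ℝ)} (hV : ∀ v ∈ V, ∀ x ∈ bergmanFan M, x + v ∈ bergmanFan M)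

include hE hne hV

/-- Vectors of the lineality space of a Bergman fan are constant on circuits. -/
theorem eq_on_circuit {C : Set (Fin m)} (hC : M.IsCircuit C) {i j : Fin m} (hi : i ∈ C)
    (hj : j ∈ C) {v : Fin m → ℝ} (hv : v ∈ V) : v i = v j := by
  classical
  by_contra hvij
  have hij : i ≠ j := fun h => hvij (h ▸ rfl)
  -- The indicator of `F` is `0` at `i` and `j` and `1` on the rest of `C`. Adding a small multiple
  -- of `v` keeps the minimum over `C` at `i` or `j`; it is attained twice, so `v i = v j`.
  set F := M.closure (C \ {i, j}) with hF
  have hnot : ∀ {a b : Fin m}, a ∈ C → b ∈ C → a ≠ b → a ∉ M.closure (C \ {a, b}) := by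
    intro a b ha hb hab h
    have hI := hC.sdiff_singleton_indep hb
    refine hI.notMem_closure_sdiff_of_mem (e := a) ⟨ha, hab⟩ ?_
    convert h using 2
    ext k
    simp only [Set.mem_sdiff, Set.mem_singleton_iff, Set.mem_insert_iff]
    tauto
  have hiF : i ∉ F := hnot hi hj hij
  have hjF : j ∉ F := by
    rw [hF, Set.pair_comm]
    exact hnot hj hi hij.symm
  have hkF : ∀ k ∈ C, k ≠ i → k ≠ j → k ∈ F := by
    intro k hk hki hkj
    exact M.mem_closure_of_mem ⟨hk, by simp [hki, hkj]⟩ (by rw [hE]; exact Set.subset_univ _)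
  obtain ⟨t, ht, -, hsmall⟩ :=
    RationalPolyhedralComplex.exists_norm_smul_lt v (δ := 1 / 2) (by norm_num)
  have hmem := hV _ (V.smul_mem t hv) _ (indicator_mem_bergmanFan hne (M.isFlat_closure _) :
    F.indicator (fun _ => (1 : ℝ)) ∈ bergmanFan M)
  obtain ⟨p, hp, q, hq, hpq, hmin⟩ := hmem C hC
  have hb : ∀ k, |t * v k| < 1 / 2 := by
    intro k
    have := norm_le_pi_norm (t • v) k
    rw [Pi.smul_apply, smul_eq_mul, Real.norm_eq_abs] at this
    linarith
  have hval : ∀ k, (F.indicator (fun _ => (1 : ℝ)) + t • v) k =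
      (if k ∈ F then 1 else 0) + t * v k := fun k => by
    simp [Set.indicator_apply]
  have hpos : ∀ k ∈ C, (∀ l ∈ C, (F.indicator (fun _ => (1 : ℝ)) + t • v) k ≤
      (F.indicator (fun _ => (1 : ℝ)) + t • v) l) → k = i ∨ k = j := by
    intro k hk h
    by_contra! hcon
    have h1 := h i hi
    rw [hval, hval, if_pos (hkF k hk hcon.1 hcon.2), if_neg hiF] at h1
    have := abs_lt.1 (hb k)
    have := abs_lt.1 (hb i)
    linarith
  have hp' := hpos p hp fun l hl => (hmin l hl).1
  have hq' := hpos q hq fun l hl => (hmin l hl).2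
  have hv1 := hmin q hq
  have hv2 := hmin p hp
  have heq : ∀ k, k = i ∨ k = j → (F.indicator (fun _ => (1 : ℝ)) + t • v) k = t * v k := by
    rintro k (rfl | rfl)
    · rw [hval, if_neg hiF, zero_add]
    · rw [hval, if_neg hjF, zero_add]
  have h1 := hv1.1
  have h2 := hv2.2
  rw [heq p hp', heq q hq'] at h1 h2
  have h3 : v p = v q := mul_left_cancel₀ ht.ne' (le_antisymm h1 h2)
  rcases hp' with rfl | rfl <;> rcases hq' with rfl | rfl
  · exact hpq rfl
  · exact hvij h3
  · exact hvij h3.symm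
  · exact hpq rfl

/-- Every circuit lies in one class, so the matroid is the direct sum of its restrictions to the
classes. -/
theorem indep_of_inter_coordClass {A : Set (Fin m)}
    (h : ∀ k, M.Indep (A ∩ coordClass V k)) : M.Indep A := by
  rw [Matroid.indep_iff_forall_subset_not_isCircuit (by rw [hE]; exact Set.subset_univ _)]
  intro C hCA hC
  obtain ⟨k, hk⟩ := hC.nonempty
  refine hC.not_indep ((h k).subset fun i hi => ⟨hCA hi, fun v hv => ?_⟩)
  exact eq_on_circuit hE hne hV hC hi hk hv

theorem mem_closure_inter_coordClass {A : Set (Fin m)} (hA : M.IsBase A) (k : Fin m) :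
    k ∈ M.closure (A ∩ coordClass V k) := by
  by_cases hk : k ∈ A
  · exact M.mem_closure_of_mem ⟨hk, fun _ _ => rfl⟩ (by rw [hE]; exact Set.subset_univ _)
  · have hcl : k ∈ M.closure A := by rw [hA.closure_eq, hE]; trivial
    obtain ⟨C, hCs, hC, hkC⟩ := Matroid.exists_isCircuit_of_mem_closure hcl hk
    refine M.closure_subset_closure ?_ (hC.mem_closure_sdiff_singleton_of_mem hkC)
    rintro i ⟨hi, hik⟩
    exact ⟨(hCs hi).resolve_left hik, fun v hv => eq_on_circuit hE hne hV hC hi hkC hv⟩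

omit hE hne hV in
theorem isBase_of_encard_le {A B : Set (Fin m)} (hA : M.Indep A) (hB : M.IsBase B)
    (h : B.encard ≤ A.encard) : M.IsBase A := by
  obtain ⟨B', hB', hAB'⟩ := hA.exists_isBase_superset
  have : A = B' := (Set.toFinite A).eq_of_subset_of_encard_le hAB'
    (by rwa [hB'.encard_eq_eRank, ← hB.encard_eq_eRank])
  rwa [this]

/-- In a basis, the part in one class may be replaced by any independent part of the same size. -/
theorem coordClass_subset_closure {B A : Set (Fin m)} (hB : M.IsBase B) {k : Fin m}
    (hA : M.Indep A) (hAk : A ⊆ coordClass V k)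
    (hcard : (B ∩ coordClass V k).encard ≤ A.encard) : coordClass V k ⊆ M.closure A := by
  classical
  have hclass : ∀ {i l : Fin m}, i ∈ coordClass V l → coordClass V l = coordClass V i := by
    intro i l h
    ext p
    exact ⟨fun hp v hv => (hp v hv).trans (h v hv).symm, fun hp v hv => (hp v hv).trans (h v hv)⟩
  have hind : M.Indep ((B \ coordClass V k) ∪ A) := by
    refine indep_of_inter_coordClass hE hne hV fun l => ?_
    by_cases hl : l ∈ coordClass V k
    · refine hA.subset ?_
      rintro i ⟨hi | hi, hil⟩
      · exact absurd (by rw [hclass hl]; exact hil) hi.2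
      · exact hi
    · refine hB.indep.subset ?_
      rintro i ⟨hi | hi, hil⟩
      · exact hi.1
      · exact absurd (fun v hv => ((hil v hv).symm.trans (hAk hi v hv))) hl
  have hdisj : Disjoint (B \ coordClass V k) A :=
    Set.disjoint_left.2 fun i hi hiA => hi.2 (hAk hiA)
  have hbase : M.IsBase ((B \ coordClass V k) ∪ A) := by
    refine isBase_of_encard_le hind hB ?_
    rw [Set.encard_union_eq hdisj, ← Set.encard_sdiff_add_encard_inter B (coordClass V k)]
    gcongr
  intro l hl
  refine M.closure_subset_closure ?_ (mem_closure_inter_coordClass hE hne hV hbase l)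
  rintro i ⟨hi | hi, hil⟩
  · exact absurd (by rw [hclass hl]; exact hil) hi.2
  · exact hi

omit hV in
theorem indep_singleton_of_bergmanFan (k : Fin m) : M.Indep {k} := by
  rw [← insert_empty_eq, M.empty_indep.insert_indep_iff]
  left
  rw [closure_empty_of_bergmanFan_nonempty hne, hE]
  exact ⟨trivial, fun h => h⟩

omit hE hV in
theorem closure_singleton_eq {i j : Fin m} (h : i ∈ M.closure {j}) :
    M.closure {i} = M.closure {j} := by
  have := Matroid.closure_insert_congr (M := M) (e := i) (f := j) (X := ∅)
    ⟨by simpa using h, by rw [closure_empty_of_bergmanFan_nonempty hne]; exact fun h => h⟩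
  simpa using this

-- Parallel elements lie in the same flats, in particular in the same superlevel sets of `x`.
omit hV in
theorem eq_of_mem_closure_singleton {i j : Fin m} (h : i ∈ M.closure {j}) {x : Fin m → ℝ}
    (hx : x ∈ bergmanFan M) : x i = x j := by
  have key : ∀ {i j : Fin m}, i ∈ M.closure {j} → x j ≤ x i := by
    intro i j h
    refine mem_bergmanFan_iff.1 hx (x j) i (M.closure_subset_closure ?_ h)
    rintro _ rfl
    exact le_rfl (a := x _)
  refine le_antisymm (key ?_) (key h)
  rw [closure_singleton_eq hne h]
  exact M.mem_closure_self j (by rw [hE]; trivial)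

omit hE in
theorem mem_bergmanFan_of_lineality {v : Fin m → ℝ} (hv : v ∈ V) : v ∈ bergmanFan M := by
  simpa using hV v hv 0 (zero_mem_bergmanFan hne)

/-- The shape of a Bergman fan whose lineality space has codimension at most one. -/
theorem bergmanFan_of_lineality {r : ℕ} (hr : M.eRank = r) (hdim : r ≤ finrank ℝ V + 1) :
    (∃ K : Submodule ℝ (Fin m → ℝ), finrank ℝ K = r ∧ (K : Set (Fin m → ℝ)) = bergmanFan M) ∨
    (finrank ℝ V + 1 = r ∧ ∃ (ι : Type) (_ : Fintype ι) (f : ι → Fin m → ℝ),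
      IsTropicalLine V (bergmanFan M) f) := by
  classical
  -- Let `c` be the number of classes. The space `K` of functions constant on classes contains `V`
  -- and has dimension `c`, and a transversal `T` is independent, so `r - 1 ≤ dim V ≤ c ≤ r`.
  let s := coordSetoid V
  let L : (Quotient s → ℝ) →ₗ[ℝ] (Fin m → ℝ) := LinearMap.funLeft ℝ ℝ (Quotient.mk s)
  have hLinj : Function.Injective L :=
    LinearMap.funLeft_injective_of_surjective ℝ ℝ _ Quotient.mk_surjective
  let K := LinearMap.range L
  have hKmem : ∀ x : Fin m → ℝ, x ∈ K ↔ ∀ i j, i ∈ coordClass V j → x i = x j := by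
    intro x
    constructor
    · rintro ⟨y, rfl⟩ i j hij
      change y _ = y _
      congr 1
      exact Quotient.sound hij
    · intro h
      exact ⟨Quotient.lift x h, rfl⟩
  have hKcard : finrank ℝ K = Fintype.card (Quotient s) := by
    rw [LinearMap.finrank_range_of_inj hLinj, finrank_fintype_fun_eq_card]
  have hVK : V ≤ K := fun v hv => (hKmem v).2 fun i j hij => hij v hv
  have hself : ∀ k, k ∈ coordClass V k := fun k v hv => rfl
  have hsymm : ∀ {i j}, i ∈ coordClass V j → j ∈ coordClass V i := fun h v hv => (h v hv).symm
  have htrans : ∀ {i j k}, i ∈ coordClass V j → j ∈ coordClass V k → i ∈ coordClass V k :=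
    fun h h' v hv => (h v hv).trans (h' v hv)
  -- representatives
  let out : Fin m → Fin m := fun k => Quotient.out (Quotient.mk s k)
  have hout : ∀ k, out k ∈ coordClass V k := fun k => Quotient.mk_out (s := s) k
  have hout' : ∀ {i j}, i ∈ coordClass V j → out i = out j := fun h => by
    simp only [out]; rw [Quotient.sound (s := s) h]
  let T : Set (Fin m) := Set.range (Quotient.out : Quotient s → Fin m)
  have hT : ∀ {i}, i ∈ T → i = out i := by
    rintro _ ⟨q, rfl⟩
    simp [out]
  have houtT : ∀ k, out k ∈ T := fun k => ⟨_, rfl⟩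
  have hTk : ∀ k, T ∩ coordClass V k ⊆ {out k} := by
    rintro k i ⟨hi, hik⟩
    rw [Set.mem_singleton_iff, hT hi, hout' hik]
  have hTcard : T.encard = Fintype.card (Quotient s) := by
    have : Function.Injective (Quotient.out : Quotient s → Fin m) := Quotient.out_injective
    change (Set.range (Quotient.out : Quotient s → Fin m)).encard = _
    rw [← Set.image_univ, this.encard_image, Set.encard_univ, ENat.card_eq_coe_fintype_card]
  have hTind : M.Indep T := indep_of_inter_coordClass hE hne hV fun k =>
    (indep_singleton_of_bergmanFan hE hne (out k)).subset (hTk k)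
  obtain ⟨B, hB, hTB⟩ := hTind.exists_isBase_superset
  have hBcard : B.encard = r := by rw [hB.encard_eq_eRank, hr]
  have hVle : finrank ℝ V ≤ Fintype.card (Quotient s) := hKcard ▸ Submodule.finrank_mono hVK
  have hTr : Fintype.card (Quotient s) ≤ r := by
    have := Set.encard_le_encard hTB
    rw [hTcard, hBcard] at this
    exact_mod_cast this
  have hsingle : ∀ {k j : Fin m}, B ∩ coordClass V k ⊆ {out k} → j ∈ coordClass V k →
      k ∈ M.closure {j} := by
    intro k j hBk hj
    refine coordClass_subset_closure hE hne hV hB (indep_singleton_of_bergmanFan hE hne j)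
      (by simpa using hj) ?_ (hself k)
    refine (Set.encard_le_encard hBk).trans ?_
    simp
  -- If `c = r`, every class has rank one, so its elements are parallel and the fan is `K`.
  by_cases hcr : Fintype.card (Quotient s) = r
  · left
    have hBT : T = B := (Set.toFinite T).eq_of_subset_of_encard_le hTB
      (by rw [hTcard, hBcard, hcr])
    refine ⟨K, by rw [hKcard, hcr], Set.Subset.antisymm ?_ ?_⟩
    · intro x hx C hC
      obtain ⟨i, hi, j, hj, hij, -⟩ := zero_mem_bergmanFan hne C hC
      have : ∀ k ∈ C, ∀ l ∈ C, x k = x l := fun k hk l hl =>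
        (hKmem x).1 hx k l fun v hv => eq_on_circuit hE hne hV hC hk hl hv
      exact ⟨i, hi, j, hj, hij, fun k hk => ⟨(this i hi k hk).le, (this j hj k hk).le⟩⟩
    · intro x hx
      refine (hKmem x).2 fun i j hij => ?_
      exact (eq_of_mem_closure_singleton hE hne
        (hsingle (by rw [← hBT]; exact hTk j) hij) hx).symm
  -- Here `c = r - 1`, which forces `V = K`. The basis `B` has a single element `b` outside `T`: the
  -- class of `b` has rank two, all others rank one.
  right
  have hVcard : finrank ℝ V + 1 = r := by omega
  have hcr1 : Fintype.card (Quotient s) + 1 = r := by omega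
  have hVK' : V = K := Submodule.eq_of_le_of_finrank_le hVK (by omega)
  have hVmem : ∀ x : Fin m → ℝ, x ∈ V ↔ ∀ i j, i ∈ coordClass V j → x i = x j := fun x =>
    ⟨fun h => (hKmem x).1 (hVK h), fun h => hVK'.ge ((hKmem x).2 h)⟩
  refine ⟨hVcard, ?_⟩
  obtain ⟨b, hb⟩ : ∃ b, B \ T = {b} := by
    rw [← Set.encard_eq_one]
    have := Set.encard_sdiff_add_encard_of_subset hTB
    rw [hTcard, hBcard, ← hcr1] at this
    have h2 : (B \ T).encard + (Fintype.card (Quotient s) : ℕ∞) =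
        1 + (Fintype.card (Quotient s) : ℕ∞) := by
      rw [this]; push_cast; ring
    exact ENat.add_left_injective_of_ne_top (by simp) h2
  have hbB : b ∈ B ∧ b ∉ T := by
    have : b ∈ B \ T := by rw [hb]; rfl
    exact this
  have hBsub : ∀ i ∈ B, i ∈ T ∨ i = b := by
    intro i hi
    by_cases hiT : i ∈ T
    · exact Or.inl hiT
    · right
      have : i ∈ B \ T := ⟨hi, hiT⟩
      rwa [hb] at this
  have hother : ∀ {k j : Fin m}, k ∉ coordClass V b → j ∈ coordClass V k →
      k ∈ M.closure {j} := by
    intro k j hk hj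
    refine hsingle ?_ hj
    rintro i ⟨hi, hik⟩
    rcases hBsub i hi with hiT | rfl
    · exact hTk k ⟨hiT, hik⟩
    · exact absurd (hsymm hik) hk
  have hpair : ∀ {i j k : Fin m}, i ∈ coordClass V b → j ∈ coordClass V b →
      i ∉ M.closure {j} → k ∈ coordClass V b → k ∈ M.closure {i, j} := by
    intro i j k hi hj hij hk
    have hne' : i ≠ j := by
      rintro rfl
      exact hij (M.mem_closure_self i (by rw [hE]; trivial))
    refine coordClass_subset_closure hE hne hV hB (k := b) ?_ ?_ ?_ hk
    · rw [(indep_singleton_of_bergmanFan hE hne j).insert_indep_iff]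
      exact Or.inl ⟨by rw [hE]; trivial, hij⟩
    · rintro l (rfl | rfl)
      · exact hi
      · exact hj
    · rw [Set.encard_pair hne']
      have : B ∩ coordClass V b ⊆ {out b, b} := by
        rintro l ⟨hl, hlb⟩
        rcases hBsub l hl with hlT | rfl
        · exact Or.inl (hTk b ⟨hlT, hlb⟩)
        · exact Or.inr rfl
      refine (Set.encard_le_encard this).trans ?_
      exact Set.encard_insert_le _ _ |>.trans (by rw [Set.encard_singleton]; norm_num)
  have hparclass : ∀ {i j : Fin m}, i ∈ M.closure {j} → i ∈ coordClass V j := fun h v hv =>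
    eq_of_mem_closure_singleton hE hne h (mem_bergmanFan_of_lineality hne hV hv)
  -- The rays are the indicators of the rank-one flats partitioning the class of `b`; their sum is
  -- the indicator of the class, which lies in `V`.
  let ι := {F : Set (Fin m) // ∃ j ∈ coordClass V b, F = M.closure {j}}
  let f : ι → Fin m → ℝ := fun F => F.1.indicator fun _ => 1
  have hselfcl : ∀ i, i ∈ M.closure {i} := fun i => M.mem_closure_self i (by rw [hE]; trivial)
  have hmemF : ∀ (F : ι) {i}, i ∈ F.1 → F.1 = M.closure {i} ∧ i ∈ coordClass V b := by
    rintro ⟨_, j, hj, rfl⟩ i hi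
    exact ⟨(closure_singleton_eq hne hi).symm, htrans (hparclass hi) hj⟩
  have hfin : Fintype ι := Fintype.ofFinite ι
  have hnt : Nontrivial ι := by
    refine ⟨⟨M.closure {b}, b, hself b, rfl⟩, ⟨M.closure {out b}, out b, hout b, rfl⟩, ?_⟩
    intro heq
    have hcl : out b ∈ M.closure {b} := by
      rw [show M.closure {b} = M.closure {out b} from congrArg Subtype.val heq]
      exact hselfcl _
    have hne' : out b ≠ b := fun h => hbB.2 (h ▸ houtT b)
    refine hB.indep.notMem_closure_sdiff_of_mem (hTB (houtT b))
      (M.closure_subset_closure ?_ hcl)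
    rintro _ rfl
    exact ⟨hbB.1, hne'.symm⟩
  refine ⟨ι, hfin, f, ?_⟩
  have hsum : ∀ (a : ι → ℝ) (p : Fin m) (hp : p ∈ coordClass V b),
      (∑ F, a F • f F) p = a ⟨M.closure {p}, p, hp, rfl⟩ := by
    intro a p hp
    rw [Finset.sum_apply, Finset.sum_eq_single ⟨M.closure {p}, p, hp, rfl⟩]
    · simp [f, hselfcl p]
    · intro F _ hF
      have : p ∉ F.1 := fun h => hF (Subtype.ext (hmemF F h).1)
      simp [f, this]
    · exact fun h => absurd (Finset.mem_univ _) h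
  have hsum' : ∀ (a : ι → ℝ) (p : Fin m), p ∉ coordClass V b → (∑ F, a F • f F) p = 0 := by
    intro a p hp
    rw [Finset.sum_apply]
    refine Finset.sum_eq_zero fun F _ => ?_
    have : p ∉ F.1 := fun h => hp (hmemF F h).2
    simp [f, this]
  refine ⟨hnt, fun x => ⟨fun hx => ?_, ?_⟩, fun a => ⟨fun h => ?_, fun h => ?_⟩, fun F => ?_, ?_⟩
  · obtain ⟨k, hk, hkmin⟩ := (Set.toFinite (coordClass V b)).exists_minimalFor x _ ⟨b, hself b⟩
    have hmin : ∀ l ∈ coordClass V b, x k ≤ x l := fun l hl =>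
      (le_total (x k) (x l)).elim id fun h => hkmin hl h
    have hout0 : ∀ p q, p ∈ coordClass V q → q ∉ coordClass V b → x p = x q := fun p q hpq hq =>
      (eq_of_mem_closure_singleton hE hne (hother hq hpq) hx).symm
    -- Only one rank-one flat of this class can lie above the minimum: two elements of different
    -- flats span the class, so a superlevel set containing both contains `k`.
    by_cases hex : ∃ i ∈ coordClass V b, x k < x i
    · obtain ⟨i, hi, hki⟩ := hex
      refine ⟨⟨M.closure {i}, i, hi, rfl⟩, x i - x k, by linarith, ?_⟩
      rw [hVmem]
      have hin : ∀ p ∈ coordClass V b, (x - (x i - x k) •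
          f ⟨M.closure {i}, i, hi, rfl⟩) p = x k := by
        intro p hp
        by_cases hpi : p ∈ M.closure {i}
        · simp [f, hpi, eq_of_mem_closure_singleton hE hne hpi hx]
        · have : x p = x k := by
            refine le_antisymm ?_ (hmin p hp)
            by_contra! hlt
            have hcl := hpair hp hi hpi hk
            have := mem_bergmanFan_iff.1 hx (min (x p) (x i)) k (M.closure_subset_closure ?_ hcl)
            · exact absurd this (not_le.2 (lt_min hlt hki))
            · rintro l (hl | hl)
              · exact (min_le_left _ _).trans (congrArg x hl).ge
              · exact (min_le_right _ _).trans (congrArg x hl).ge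
          simp [f, hpi, this]
      intro p q hpq
      by_cases hq : q ∈ coordClass V b
      · rw [hin p (htrans hpq hq), hin q hq]
      · have hp : p ∉ coordClass V b := fun h => hq (htrans (hsymm hpq) h)
        have h1 : p ∉ M.closure {i} := fun h => hp (htrans (hparclass h) hi)
        have h2 : q ∉ M.closure {i} := fun h => hq (htrans (hparclass h) hi)
        simp [f, h1, h2, hout0 p q hpq hq]
    · push Not at hex
      refine ⟨⟨M.closure {b}, b, hself b, rfl⟩, 0, le_rfl, ?_⟩
      rw [zero_smul, sub_zero, hVmem]
      intro p q hpq
      by_cases hq : q ∈ coordClass V b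
      · exact (le_antisymm (hex p (htrans hpq hq)) (hmin p (htrans hpq hq))).trans
          (le_antisymm (hmin q hq) (hex q hq))
      · exact hout0 p q hpq hq
  · rintro ⟨⟨_, j, hj, rfl⟩, a, ha, h⟩
    have h1 := smul_mem_bergmanFan (indicator_mem_bergmanFan hne
      (M.isFlat_closure {j})) ha
    simpa [f] using hV _ h _ h1
  · rintro ⟨_, i, hi, rfl⟩ ⟨_, j, hj, rfl⟩
    rw [hVmem] at h
    rw [← hsum a i hi, ← hsum a j hj]
    exact h i j (htrans hi (hsymm hj))
  · rw [hVmem]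
    intro p q hpq
    by_cases hq : q ∈ coordClass V b
    · rw [hsum a p (htrans hpq hq), hsum a q hq]
      exact h _ _
    · rw [hsum' a q hq, hsum' a p fun h => hq (htrans (hsymm hpq) h)]
  · rw [mem_integerLattice]
    intro i
    by_cases hi : i ∈ F.1
    · exact ⟨1, by simp [f, hi]⟩
    · exact ⟨0, by simp [f, hi]⟩
  · rintro F a u hu h
    -- The multiplicity `a` is the difference of the integer coordinates of `u` at a point of `F`
    -- and at a point of another flat in the same class.
    obtain ⟨F', hF'⟩ := exists_ne F
    obtain ⟨_, j, hj, rfl⟩ := F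
    obtain ⟨_, i, hi, rfl⟩ := F'
    have hij : i ∉ M.closure {j} := fun h =>
      hF' (Subtype.ext (closure_singleton_eq hne h))
    rw [hVmem] at h
    have h1 := h j i (htrans hj (hsymm hi))
    simp only [Pi.sub_apply, Pi.smul_apply, smul_eq_mul, f, Set.indicator_of_mem (hselfcl j),
      Set.indicator_of_notMem hij] at h1
    obtain ⟨p, hp⟩ := mem_integerLattice.1 hu j
    obtain ⟨q, hq⟩ := mem_integerLattice.1 hu i
    exact ⟨p - q, by push_cast; linarith⟩

end Lineality

/-! ### Linear pieces of Bergman fans and their dimension -/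

section Dimension

variable {m : ℕ} {M : Matroid (Fin m)}

/-- A finite form of Baire's theorem: remove the closed sets one at a time until the remainder
misses `H`; the last set removed contains a relatively open piece. -/
theorem exists_isOpen_subset_of_finite_cover {E ι : Type*} [TopologicalSpace E] (H : Set E)
    {C : ι → Set E} (hC : ∀ i, IsClosed (C i)) (s : Finset ι) {U : Set E} (hU : IsOpen U)
    (hne : (H ∩ U).Nonempty) (hcov : ∀ x ∈ H ∩ U, ∃ i ∈ s, x ∈ C i) :
    ∃ i ∈ s, ∃ U' : Set E, IsOpen U' ∧ U' ⊆ U ∧ (H ∩ U').Nonempty ∧ H ∩ U' ⊆ C i := by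
  classical
  induction s using Finset.induction_on generalizing U with
  | empty =>
    obtain ⟨x, hx⟩ := hne
    obtain ⟨i, hi, -⟩ := hcov x hx
    exact absurd hi (Finset.notMem_empty i)
  | insert j s hj ih =>
    by_cases h : (H ∩ (U \ C j)).Nonempty
    · obtain ⟨i, hi, U', h1, h2, h3⟩ := ih (hU.sdiff (hC j)) h fun x hx => by
        obtain ⟨i, hi, hxi⟩ := hcov x ⟨hx.1, hx.2.1⟩
        rcases Finset.mem_insert.1 hi with rfl | hi
        · exact absurd hxi hx.2.2
        · exact ⟨i, hi, hxi⟩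
      exact ⟨i, Finset.mem_insert_of_mem hi, U', h1, h2.trans Set.sdiff_subset, h3⟩
    · refine ⟨j, Finset.mem_insert_self _ _, U, hU, Set.Subset.rfl, hne, fun x hx => ?_⟩
      by_contra hxj
      exact h ⟨x, hx.1, hx.2, hxj⟩

/-- A relatively open piece of a subspace contained in a Bergman fan is, after shrinking, contained
in the image of one of the sections, and projects injectively to the corresponding coordinates. -/
theorem exists_isBase_of_isOpen (hE : M.E = Set.univ) (hne : (bergmanFan M).Nonempty)
    (H : Submodule ℝ (Fin m → ℝ)) {U : Set (Fin m → ℝ)} (hU : IsOpen U)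
    (hHU : ((H : Set (Fin m → ℝ)) ∩ U).Nonempty)
    (hsub : (H : Set (Fin m → ℝ)) ∩ U ⊆ bergmanFan M) :
    ∃ B, M.IsBase B ∧ (∃ U' : Set (Fin m → ℝ), IsOpen U' ∧ U' ⊆ U ∧
      ((H : Set (Fin m → ℝ)) ∩ U').Nonempty ∧
      ∀ x ∈ (H : Set (Fin m → ℝ)) ∩ U', bergmanSection M B (coordProj B x) = x) ∧
      ∀ x ∈ H, coordProj B x = 0 → x = 0 := by
  classical
  obtain ⟨B, hB, U', hU', hUU', hne', hsec⟩ := exists_isOpen_subset_of_finite_cover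
    (H : Set (Fin m → ℝ)) (C := fun B => {x | bergmanSection M B (coordProj B x) = x})
    (fun B => isClosed_eq (continuous_bergmanSection.comp
      (LinearMap.continuous_of_finiteDimensional _)) continuous_id)
    (Set.toFinite {B | M.IsBase B}).toFinset hU hHU (fun x hx => by
      obtain ⟨B, hB, h⟩ := exists_bergmanSection_eq hE hne (hsub hx)
      exact ⟨B, by simpa using hB, h⟩)
  refine ⟨B, by simpa using hB, ⟨U', hU', hUU', hne', fun x hx => hsec hx⟩, fun x hx hx0 => ?_⟩
  obtain ⟨x₀, hx₀, hx₀U⟩ := hne'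
  obtain ⟨δ, hδ, hball⟩ := Metric.isOpen_iff.1 hU' x₀ hx₀U
  obtain ⟨t, ht, -, hsm⟩ := RationalPolyhedralComplex.exists_norm_smul_lt x hδ
  -- A small vector of `H` with zero `B`-coordinates can be added without changing the argument of
  -- the section, hence without changing the point.
  have h1 : bergmanSection M B (coordProj B (x₀ + t • x)) = x₀ + t • x :=
    hsec ⟨H.add_mem hx₀ (H.smul_mem t hx), hball (by simpa using hsm)⟩
  have h2 : bergmanSection M B (coordProj B x₀) = x₀ := hsec ⟨hx₀, hx₀U⟩
  rw [map_add, map_smul, hx0, smul_zero, add_zero, h2] at h1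
  have : t • x = 0 := by simpa using h1.symm
  exact (smul_eq_zero.1 this).resolve_left ht.ne'

theorem finrank_coord {r : ℕ} (hr : M.eRank = r) {B : Set (Fin m)} (hB : M.IsBase B) :
    finrank ℝ (B → ℝ) = r := by
  classical
  rw [finrank_fintype_fun_eq_card]
  have := hB.encard_eq_eRank
  rw [hr, Set.encard, ENat.card_eq_coe_fintype_card] at this
  exact_mod_cast this

theorem finrank_le_of_inj {r : ℕ} (hr : M.eRank = r) {B : Set (Fin m)} (hB : M.IsBase B)
    {H : Submodule ℝ (Fin m → ℝ)} (h : ∀ x ∈ H, coordProj B x = 0 → x = 0) :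
    finrank ℝ H ≤ r := by
  classical
  rw [← finrank_coord hr hB]
  refine LinearMap.finrank_le_finrank_of_injective (f := (coordProj B).domRestrict H) ?_
  rw [← LinearMap.ker_eq_bot, LinearMap.ker_eq_bot']
  rintro ⟨x, hx⟩ hx0
  exact Subtype.ext (h x hx hx0)

/-- A linear subspace contained in a Bergman fan has dimension at most the rank. -/
theorem finrank_le_of_subset_bergmanFan (hE : M.E = Set.univ) {r : ℕ} (hr : M.eRank = r)
    {H : Submodule ℝ (Fin m → ℝ)} (hH : (H : Set (Fin m → ℝ)) ⊆ bergmanFan M) :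
    finrank ℝ H ≤ r := by
  obtain ⟨B, hB, -, h⟩ := exists_isBase_of_isOpen hE ⟨0, hH H.zero_mem⟩ H isOpen_univ
    ⟨0, H.zero_mem, trivial⟩ (by simpa using hH)
  exact finrank_le_of_inj hr hB h

end Dimension

/-! ### Presenting stars of a tropical manifold by Bergman fans -/

section Model

variable {n : ℕ}

/-- A presentation of `S` as the image of the `(d + e)`-dimensional Bergman fan of `M` under a
linear map with kernel of dimension `e` on the span of that fan, compatible with the lattices. -/
structure BergmanModel (S : Set (Fin n → ℝ)) (d : ℕ) {m : ℕ} (M : Matroid (Fin m))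
    (g : (Fin m → ℝ) →ₗ[ℝ] (Fin n → ℝ)) (e : ℕ) : Prop where
  ground : M.E = Set.univ
  nonempty : (bergmanFan M).Nonempty
  rank : M.eRank = ((d + e : ℕ) : ℕ∞)
  finrank_ker : finrank ℝ ↥(Submodule.span ℝ (bergmanFan M) ⊓ LinearMap.ker g) = e
  mem_iff : ∀ x ∈ Submodule.span ℝ (bergmanFan M), g x ∈ S ↔ x ∈ bergmanFan M
  surj : ∀ u ∈ S, ∃ x ∈ bergmanFan M, g x = u
  map_lattice : ∀ x ∈ integerLattice m, x ∈ Submodule.span ℝ (bergmanFan M) →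
    g x ∈ integerLattice n
  lift_lattice : ∀ u ∈ integerLattice n, u ∈ Submodule.span ℝ S →
    ∃ x ∈ integerLattice m, x ∈ Submodule.span ℝ (bergmanFan M) ∧ g x = u

/-- This treats the two forms of Bergman fan at once: `q` will be the identity or the quotient by
the all-ones line. As the kernel of `q` lies in the lineality space, membership in the fan is
decided after `q`. The map `g` extends the inverse isomorphism arbitrarily beyond the span of the
fan, hence the span conditions in the model. -/
theorem exists_bergmanModel_of_quotient {S : Set (Fin n → ℝ)} (hS : (0 : Fin n → ℝ) ∈ S)
    {d e m : ℕ} {M : Matroid (Fin m)} (hE : M.E = Set.univ)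
    {W : Type*} [AddCommGroup W] [Module ℝ W] (q : (Fin m → ℝ) →ₗ[ℝ] W)
    (hq : ∀ k ∈ LinearMap.ker q, ∀ x ∈ bergmanFan M, x + k ∈ bergmanFan M)
    (he : finrank ℝ (LinearMap.ker q) = e) (hrank : M.eRank = ((d + e : ℕ) : ℕ∞))
    (h : IntegrallyIsomorphic (integerLattice n) S
      ((integerLattice m).map q.toAddMonoidHom) (q '' bergmanFan M)) :
    ∃ g, BergmanModel S d M g e := by
  obtain ⟨i, hlat, hmem⟩ := h
  set H := Submodule.span ℝ (bergmanFan M) with hH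
  have hspan : Submodule.span ℝ (q '' bergmanFan M) = H.map q := by rw [Submodule.map_span]
  have hqH : ∀ x ∈ H, q x ∈ Submodule.span ℝ (q '' bergmanFan M) := fun x hx => by
    rw [hspan]; exact Submodule.mem_map_of_mem hx
  have hne : (bergmanFan M).Nonempty := by
    have := (hmem ⟨0, zero_mem _⟩).1 hS
    obtain ⟨x, hx, -⟩ := this
    exact ⟨x, hx⟩
  have hkerH : LinearMap.ker q ≤ H := fun k hk => by
    have := hq k hk 0 (zero_mem_bergmanFan hne)
    rw [zero_add] at this
    exact Submodule.subset_span this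
  let ψ : H →ₗ[ℝ] Submodule.span ℝ (q '' bergmanFan M) := q.restrict hqH
  obtain ⟨g, hg⟩ := LinearMap.exists_extend
    ((Submodule.subtype _).comp (i.symm.toLinearMap.comp ψ))
  have hg' : ∀ x (hx : x ∈ H), g x = (i.symm ⟨q x, hqH x hx⟩ : Fin n → ℝ) := fun x hx =>
    LinearMap.congr_fun hg ⟨x, hx⟩
  have himg : ∀ x, q x ∈ q '' bergmanFan M ↔ x ∈ bergmanFan M := by
    refine fun x => ⟨?_, fun hx => ⟨x, hx, rfl⟩⟩
    rintro ⟨b, hb, hbx⟩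
    have := hq (x - b) (by rw [LinearMap.mem_ker, map_sub, hbx, sub_self]) b hb
    simpa using this
  refine ⟨g, hE, hne, hrank, ?_, fun x hx => ?_, fun u hu => ?_, fun x hx hxH => ?_,
    fun u hu huS => ?_⟩
  · have : H ⊓ LinearMap.ker g = LinearMap.ker q := by
      ext x
      constructor
      · rintro ⟨hx, hx0⟩
        have h0 : g x = 0 := hx0
        rw [hg' x hx] at h0
        have h1 : i.symm ⟨q x, hqH x hx⟩ = 0 := Subtype.ext h0
        rw [LinearEquiv.map_eq_zero_iff] at h1
        exact congrArg Subtype.val h1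
      · intro hx
        refine ⟨hkerH hx, ?_⟩
        rw [SetLike.mem_coe, LinearMap.mem_ker, hg' x (hkerH hx)]
        have h1 : (⟨q x, hqH x (hkerH hx)⟩ : Submodule.span ℝ (q '' bergmanFan M)) = 0 :=
          Subtype.ext hx
        rw [h1, map_zero]
        rfl
    rw [this, he]
  · rw [hg' x hx, hmem, LinearEquiv.apply_symm_apply]
    exact himg x
  · obtain ⟨x, hx, hxu⟩ := (hmem ⟨u, Submodule.subset_span hu⟩).1 hu
    refine ⟨x, hx, ?_⟩
    rw [hg' x (Submodule.subset_span hx)]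
    have : (⟨q x, hqH x (Submodule.subset_span hx)⟩ : Submodule.span ℝ (q '' bergmanFan M)) =
      i ⟨u, Submodule.subset_span hu⟩ := Subtype.ext hxu
    rw [this, LinearEquiv.symm_apply_apply]
  · rw [hg' x hxH, hlat, LinearEquiv.apply_symm_apply]
    exact ⟨x, hx, rfl⟩
  · obtain ⟨z, hz, hzu⟩ := (hlat ⟨u, huS⟩).1 hu
    have hzu' : q z = i ⟨u, huS⟩ := hzu
    have hzH : z ∈ H := by
      obtain ⟨y, hy, hyu⟩ := hspan.le (i ⟨u, huS⟩).2
      have : z - y ∈ LinearMap.ker q := by rw [LinearMap.mem_ker, map_sub, hzu', hyu, sub_self]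
      simpa using H.add_mem (hkerH this) hy
    refine ⟨z, hz, hzH, ?_⟩
    rw [hg' z hzH]
    have : (⟨q z, hqH z hzH⟩ : Submodule.span ℝ (q '' bergmanFan M)) = i ⟨u, huS⟩ :=
      Subtype.ext hzu'
    rw [this, LinearEquiv.symm_apply_apply]

theorem exists_bergmanModel {X : RationalPolyhedralComplex n} {d : ℕ}
    (hX : X.IsTropicalManifold d) {w : Fin n → ℝ} (hw : w ∈ X.support) :
    ∃ (m : ℕ) (M : Matroid (Fin m)) (g : (Fin m → ℝ) →ₗ[ℝ] (Fin n → ℝ)) (e : ℕ),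
      BergmanModel (dirStar X.support w) d M g e := by
  have h0 := RationalPolyhedralComplex.zero_mem_dirStar hw
  obtain ⟨m, M, hE, ⟨hr, h⟩ | ⟨hr, h⟩⟩ := hX w hw
  · have h' : IntegrallyIsomorphic (integerLattice n) (dirStar X.support w)
        ((integerLattice m).map (LinearMap.id (R := ℝ) (M := Fin m → ℝ)).toAddMonoidHom)
        ((LinearMap.id (R := ℝ) (M := Fin m → ℝ)) '' bergmanFan M) := by
      have h1 : (LinearMap.id (R := ℝ) (M := Fin m → ℝ)) '' bergmanFan M = bergmanFan M := by simp
      have h2 : (integerLattice m).map (LinearMap.id (R := ℝ) (M := Fin m → ℝ)).toAddMonoidHom =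
          integerLattice m := by ext x; simp
      rw [h1, h2]
      exact h
    obtain ⟨g, hg⟩ := exists_bergmanModel_of_quotient h0 hE _ (fun k hk x hx => by
      have : k = 0 := hk
      simpa [this] using hx) (e := 0) (by rw [LinearMap.ker_id, finrank_bot]) hr h'
    exact ⟨m, M, g, 0, hg⟩
  -- The rank `d + 1` is positive, so the all-ones vector is non-zero and the kernel has dimension
  -- exactly one.
  · have hm : 0 < m := by
      rcases Nat.eq_zero_or_pos m with rfl | hm
      · have := M.eRank_le_encard_ground
        rw [hr, hE, Set.eq_empty_of_isEmpty Set.univ, Set.encard_empty] at this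
        simp at this
      · exact hm
    obtain ⟨g, hg⟩ := exists_bergmanModel_of_quotient h0 hE (onesLine m).mkQ (fun k hk x hx => by
      rw [Submodule.ker_mkQ, onesLine, Submodule.mem_span_singleton] at hk
      obtain ⟨c, rfl⟩ := hk
      have := add_const_mem_bergmanFan hx c
      convert this using 2
      funext i
      simp) (e := 1) (by
        rw [Submodule.ker_mkQ, onesLine]
        refine finrank_span_singleton fun h => ?_
        exact one_ne_zero (congrFun h ⟨0, hm⟩)) hr h
    exact ⟨m, M, g, 1, hg⟩

theorem finrank_sup_span_singleton_of_notMem {V : Submodule ℝ (Fin n → ℝ)} {f : Fin n → ℝ}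
    (hf : f ∉ V) : finrank ℝ ↥(V ⊔ Submodule.span ℝ {f}) = finrank ℝ V + 1 := by
  have h1 := Submodule.finrank_sup_add_finrank_inf_eq V (Submodule.span ℝ {f})
  have h2 : V ⊓ Submodule.span ℝ {f} = ⊥ := by
    rw [eq_bot_iff]
    rintro x ⟨hx, hxf⟩
    obtain ⟨c, rfl⟩ := Submodule.mem_span_singleton.1 hxf
    by_cases hc : c = 0
    · simp [hc]
    · exact absurd ((Submodule.smul_mem_iff _ hc).1 hx) hf
  rw [h2, finrank_bot, finrank_span_singleton (fun h => hf (by rw [h]; exact V.zero_mem))] at h1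
  omega

theorem IsTropicalLine.notMem {V : Submodule ℝ (Fin n → ℝ)} {S : Set (Fin n → ℝ)} {ι : Type}
    [Fintype ι] {f : ι → Fin n → ℝ} (h : IsTropicalLine V S f) (k : ι) : f k ∉ V := by
  classical
  intro hk
  have := h.nontrivial
  obtain ⟨l, hl⟩ := exists_ne k
  have : ∑ p, (Pi.single k 1 : ι → ℝ) p • f p ∈ V := by
    simpa [Pi.single_apply, ite_smul] using hk
  have := (h.relation _).1 this k l
  simp [hl] at this

/-- Either the tropical line has just two rays, and is linear, or its lineality space contains all
linear spaces in it. -/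
theorem IsTropicalLine.linear_or {V : Submodule ℝ (Fin n → ℝ)} {S : Set (Fin n → ℝ)} {ι : Type}
    [Fintype ι] {f : ι → Fin n → ℝ} (h : IsTropicalLine V S f) :
    (∃ K : Submodule ℝ (Fin n → ℝ), finrank ℝ K = finrank ℝ V + 1 ∧ (K : Set (Fin n → ℝ)) = S) ∨
    ∀ W : Submodule ℝ (Fin n → ℝ), (W : Set (Fin n → ℝ)) ⊆ S → W ≤ V := by
  classical
  by_cases hall : ∀ W : Submodule ℝ (Fin n → ℝ), (W : Set (Fin n → ℝ)) ⊆ S → W ≤ V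
  · exact Or.inr hall
  left
  push Not at hall
  obtain ⟨W, hWS, hWV⟩ := hall
  obtain ⟨w, hwW, hwV⟩ := Set.not_subset.1 hWV
  have := h.nontrivial
  -- Both `w` and `-w` lie on rays. Adding them gives a relation between at most two generators,
  -- while every relation has all its coefficients equal; so `i` and `j` are the only indices.
  obtain ⟨i, a, ha, hia⟩ := (h.mem_iff w).1 (hWS hwW)
  obtain ⟨j, b, hb, hjb⟩ := (h.mem_iff (-w)).1 (hWS (W.neg_mem hwW))
  have hsum : a • f i + b • f j ∈ V := by
    have := V.neg_mem (V.add_mem hia hjb)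
    convert this using 1
    module
  have ha0 : a ≠ 0 := by
    rintro rfl
    exact hwV (by simpa using hia)
  have hcoef : ∑ k, (Pi.single i a + Pi.single j b : ι → ℝ) k • f k ∈ V := by
    convert hsum using 1
    simp [add_smul, Finset.sum_add_distrib, Pi.single_apply, ite_smul]
  rw [h.relation] at hcoef
  have hij : i ≠ j := by
    rintro rfl
    obtain ⟨l, hl⟩ := exists_ne i
    have := hcoef i l
    simp [hl] at this
    exact ha0 (by linarith)
  have hab : a = b := by
    have := hcoef i j
    simpa [hij, hij.symm] using this
  have hk : ∀ k, k = i ∨ k = j := by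
    intro k
    by_contra! hk
    have := hcoef i k
    simp [hij, hk.1, hk.2] at this
    exact ha0 this
  have hfij : f i + f j ∈ V := by
    rw [← hab, ← smul_add] at hsum
    exact (Submodule.smul_mem_iff _ ha0).1 hsum
  refine ⟨V ⊔ Submodule.span ℝ {f i}, finrank_sup_span_singleton_of_notMem (h.notMem i), ?_⟩
  ext x
  rw [SetLike.mem_coe, h.mem_iff]
  constructor
  · intro hx
    obtain ⟨y, hy, z, hz, rfl⟩ := Submodule.mem_sup.1 hx
    obtain ⟨c, rfl⟩ := Submodule.mem_span_singleton.1 hz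
    rcases le_total 0 c with hc | hc
    · exact ⟨i, c, hc, by simpa using hy⟩
    · refine ⟨j, -c, by linarith, ?_⟩
      have := V.add_mem hy (V.smul_mem c hfij)
      convert this using 1
      module
  · rintro ⟨k, c, hc, hx⟩
    have hki : ∃ c' : ℝ, x - c' • f i ∈ V := by
      rcases hk k with rfl | rfl
      · exact ⟨c, hx⟩
      · refine ⟨-c, ?_⟩
        have := V.add_mem hx (V.smul_mem c hfij)
        convert this using 1
        module
    obtain ⟨c', hc'⟩ := hki
    exact Submodule.mem_sup.2 ⟨_, hc', c' • f i,
      Submodule.smul_mem _ _ (Submodule.mem_span_singleton_self _), by simp⟩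

namespace BergmanModel

variable {S : Set (Fin n → ℝ)} {d m e : ℕ} {M : Matroid (Fin m)}
  {g : (Fin m → ℝ) →ₗ[ℝ] (Fin n → ℝ)} (h : BergmanModel S d M g e)

include h

theorem finrank_comap (D : Submodule ℝ (Fin n → ℝ)) :
    finrank ℝ ↥(Submodule.span ℝ (bergmanFan M) ⊓ D.comap g) =
      finrank ℝ ↥((Submodule.span ℝ (bergmanFan M) ⊓ D.comap g).map g) + e := by
  set H := Submodule.span ℝ (bergmanFan M) with hH
  have h1 := LinearMap.finrank_range_add_finrank_ker (g.domRestrict (H ⊓ D.comap g))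
  have h2 : LinearMap.range (g.domRestrict (H ⊓ D.comap g)) = (H ⊓ D.comap g).map g := by
    rw [LinearMap.range_domRestrict]
  have h3 : (LinearMap.ker (g.domRestrict (H ⊓ D.comap g))).map (H ⊓ D.comap g).subtype =
      H ⊓ LinearMap.ker g := by
    ext x
    simp only [Submodule.mem_map, LinearMap.mem_ker, LinearMap.domRestrict_apply,
      Submodule.subtype_apply, Subtype.exists, Submodule.mem_inf, Submodule.mem_comap]
    constructor
    · rintro ⟨y, ⟨hy, hyD⟩, hy0, rfl⟩
      exact ⟨hy, hy0⟩
    · rintro ⟨hx, hx0⟩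
      exact ⟨x, ⟨hx, by rw [hx0]; exact D.zero_mem⟩, hx0, rfl⟩
  rw [h2, ← Submodule.finrank_map_subtype_eq, h3, h.finrank_ker] at h1
  exact h1.symm

theorem finrank_comap_le (D : Submodule ℝ (Fin n → ℝ)) :
    finrank ℝ ↥(Submodule.span ℝ (bergmanFan M) ⊓ D.comap g) ≤ finrank ℝ D + e := by
  rw [h.finrank_comap]
  gcongr
  refine Submodule.finrank_mono ?_
  rintro _ ⟨x, hx, rfl⟩
  exact hx.2

theorem map_span : (Submodule.span ℝ (bergmanFan M)).map g = Submodule.span ℝ S := by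
  rw [Submodule.map_span]
  congr 1
  ext u
  constructor
  · rintro ⟨x, hx, rfl⟩
    exact (h.mem_iff x (Submodule.subset_span hx)).2 hx
  · intro hu
    obtain ⟨x, hx, rfl⟩ := h.surj u hu
    exact ⟨x, hx, rfl⟩

theorem finrank_comap_eq {D : Submodule ℝ (Fin n → ℝ)} (hD : D ≤ Submodule.span ℝ S) :
    finrank ℝ ↥(Submodule.span ℝ (bergmanFan M) ⊓ D.comap g) = finrank ℝ D + e := by
  rw [h.finrank_comap]
  have : (Submodule.span ℝ (bergmanFan M) ⊓ D.comap g).map g = D := by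
    refine le_antisymm ?_ fun u hu => ?_
    · rintro _ ⟨x, hx, rfl⟩
      exact hx.2
    · obtain ⟨x, hx, rfl⟩ := h.map_span.ge (hD hu)
      exact ⟨x, ⟨hx, hu⟩, rfl⟩
  rw [this]

theorem finrank_le {D : Submodule ℝ (Fin n → ℝ)} (hD : (D : Set (Fin n → ℝ)) ⊆ S) :
    finrank ℝ D ≤ d := by
  have := finrank_le_of_subset_bergmanFan h.ground h.rank
    (H := Submodule.span ℝ (bergmanFan M) ⊓ D.comap g)
    fun x hx => (h.mem_iff x hx.1).1 (hD hx.2)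
  rw [h.finrank_comap_eq fun x hx => Submodule.subset_span (hD hx)] at this
  omega

/-- The preimage of `V` in the span of the fan has dimension `dim V + e` and preserves the fan, so
`bergmanFan_of_lineality` applies upstairs and is pushed down by `g`. A line with just two rays is
moved to the linear case; in the other case `V` is then the largest linear space in `S`. -/
theorem shape {V : Submodule ℝ (Fin n → ℝ)} (hV : ∀ v ∈ V, ∀ u ∈ S, u + v ∈ S)
    (h0 : (0 : Fin n → ℝ) ∈ S) (hdim : d ≤ finrank ℝ V + 1) :
    (∃ K : Submodule ℝ (Fin n → ℝ), finrank ℝ K = d ∧ (K : Set (Fin n → ℝ)) = S) ∨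
    (finrank ℝ V + 1 = d ∧ (∀ W : Submodule ℝ (Fin n → ℝ), (W : Set (Fin n → ℝ)) ⊆ S → W ≤ V) ∧
      ∃ (ι : Type) (_ : Fintype ι) (f : ι → Fin n → ℝ), IsTropicalLine V S f) := by
  set H := Submodule.span ℝ (bergmanFan M) with hH
  have hVS : (V : Set (Fin n → ℝ)) ⊆ S := fun v hv => by simpa using hV v hv 0 h0
  have hrank := h.finrank_comap_eq fun x hx => Submodule.subset_span (hVS hx)
  have hinv : ∀ v ∈ H ⊓ V.comap g, ∀ x ∈ bergmanFan M, x + v ∈ bergmanFan M := by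
    intro v hv x hx
    have hxH : x ∈ H := Submodule.subset_span hx
    rw [← h.mem_iff _ (H.add_mem hxH hv.1), map_add]
    exact hV _ hv.2 _ ((h.mem_iff x hxH).2 hx)
  rcases bergmanFan_of_lineality h.ground h.nonempty hinv h.rank (by rw [hrank]; omega) with
    ⟨K, hK, hKB⟩ | ⟨hfr, ι, hι, f, hf⟩
  · left
    have hHK : H = K := by rw [hH, ← hKB, Submodule.span_eq]
    have hmapS : ((K.map g : Submodule ℝ _) : Set (Fin n → ℝ)) = S := by
      ext u
      constructor
      · rintro ⟨x, hx, rfl⟩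
        rw [h.mem_iff x (hHK.ge hx), ← hKB]
        exact hx
      · intro hu
        obtain ⟨x, hx, rfl⟩ := h.surj u hu
        rw [← hKB] at hx
        exact ⟨x, hx, rfl⟩
    refine ⟨K.map g, ?_, hmapS⟩
    have h1 := h.finrank_comap_eq fun x hx => Submodule.subset_span (hmapS.subset hx)
    have h2 : H ⊓ (K.map g).comap g = K := by
      rw [hHK]
      exact inf_eq_left.2 (Submodule.le_comap_map g K)
    rw [← hH, h2, hK] at h1
    omega
  · have hdim' : finrank ℝ V + 1 = d := by
      rw [hrank] at hfr
      omega
    have hfH : ∀ i, f i ∈ H := fun i => by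
      refine Submodule.subset_span ((hf.mem_iff (f i)).2 ⟨i, 1, zero_le_one, ?_⟩)
      simp
    have hline : IsTropicalLine V S (fun i => g (f i)) := by
      refine ⟨hf.nontrivial, fun u => ⟨fun hu => ?_, ?_⟩, fun a => ?_, fun i =>
        h.map_lattice _ (hf.lattice i) (hfH i), fun i a u hu hua => ?_⟩
      · obtain ⟨x, hx, rfl⟩ := h.surj u hu
        obtain ⟨i, a, ha, hxa⟩ := (hf.mem_iff x).1 hx
        exact ⟨i, a, ha, by simpa using hxa.2⟩
      · rintro ⟨i, a, ha, hu⟩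
        have h1 : a • f i ∈ bergmanFan M := (hf.mem_iff _).2 ⟨i, a, ha, by simp⟩
        have h2 := hV _ hu _ ((h.mem_iff _ (Submodule.subset_span h1)).2 h1)
        simpa using h2
      · rw [← hf.relation, Submodule.mem_inf, Submodule.mem_comap, map_sum]
        simp only [map_smul]
        exact ⟨fun h' => ⟨Submodule.sum_mem _ fun i _ => Submodule.smul_mem _ _ (hfH i), h'⟩,
          fun h' => h'.2⟩
      · have huS : u ∈ Submodule.span ℝ S := by
          have h1 : a • g (f i) ∈ Submodule.span ℝ S := by
            rw [← h.map_span]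
            exact Submodule.smul_mem _ _ (Submodule.mem_map_of_mem (hfH i))
          have h2 : u - a • g (f i) ∈ Submodule.span ℝ S := Submodule.subset_span (hVS hua)
          simpa using Submodule.add_mem _ h2 h1
        obtain ⟨x, hx, hxH, rfl⟩ := h.lift_lattice u hu huS
        refine hf.integral i a x hx ⟨H.sub_mem hxH (H.smul_mem a (hfH i)), ?_⟩
        simpa using hua
    rcases hline.linear_or with ⟨K, hK, hKS⟩ | hW
    · exact Or.inl ⟨K, by omega, hKS⟩
    · exact Or.inr ⟨hdim', hW, ι, hι, _, hline⟩

end BergmanModel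

/-- A linear space is a tropical line relative to any rational hyperplane in it. -/
theorem isTropicalLine_of_linear {W K : Submodule ℝ (Fin n → ℝ)} (hW : RationalSubspace W)
    (hK : RationalSubspace K) (hle : W ≤ K) (hdim : finrank ℝ W + 1 = finrank ℝ K) :
    ∃ (ι : Type) (_ : Fintype ι) (f : ι → Fin n → ℝ), IsTropicalLine W (K : Set (Fin n → ℝ)) f := by
  obtain ⟨v, hv, hvK, hvW, hgen⟩ := exists_lattice_generator hW hK hle hdim
  have hsm : ∀ c : ℝ, c • v ∈ W → c = 0 := fun c hc => by
    by_contra h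
    exact hvW ((Submodule.smul_mem_iff _ h).1 hc)
  refine ⟨Bool, inferInstance, fun b => if b then v else -v, inferInstance, fun x => ⟨fun hx => ?_,
    ?_⟩, fun a => ?_, fun b => ?_, fun b a u hu hua => ?_⟩
  · obtain ⟨c, hc⟩ := RationalPolyhedralComplex.exists_sub_smul_mem hle hdim hvK hvW hx
    rcases le_total 0 c with h | h
    · exact ⟨true, c, h, by simpa using hc⟩
    · exact ⟨false, -c, by linarith, by simpa using hc⟩
  · rintro ⟨b, a, -, hx⟩
    have h1 : a • (if b then v else -v) ∈ K := by
      refine K.smul_mem _ ?_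
      split_ifs
      · exact hvK
      · exact K.neg_mem hvK
    simpa using K.add_mem (hle hx) h1
  · have : ∑ b : Bool, a b • (if b then v else -v) = (a true - a false) • v := by
      simp [sub_eq_add_neg, add_smul]
    rw [this]
    constructor
    · intro h i j
      have := hsm _ h
      cases i <;> cases j <;> first | rfl | linarith
    · intro h
      rw [h true false, sub_self, zero_smul]
      exact W.zero_mem
  · cases b
    · simpa using neg_mem hv
    · simpa using hv
  · have huK : u ∈ K := by
      have h1 : a • (if b then v else -v) ∈ K := by
        refine K.smul_mem _ ?_
        split_ifs
        · exact hvK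
        · exact K.neg_mem hvK
      simpa using K.add_mem (hle hua) h1
    obtain ⟨k, hk⟩ := hgen u hu huK
    have h2 := W.sub_mem hk hua
    cases b
    · refine ⟨-k, ?_⟩
      have : (-(k : ℝ) - a) • v ∈ W := by
        convert h2 using 1
        simp only [Bool.false_eq_true, if_false, ← Int.cast_smul_eq_zsmul ℝ k]
        module
      have := hsm _ this
      push_cast
      linarith
    · refine ⟨k, ?_⟩
      have : (a - k : ℝ) • v ∈ W := by
        convert h2 using 1
        simp only [if_true, ← Int.cast_smul_eq_zsmul ℝ k]
        module
      have := hsm _ this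
      linarith

namespace RationalPolyhedralComplex

variable {X : RationalPolyhedralComplex n} {d : ℕ}

/-- At a relative interior point the star contains the direction space of the cell, and linear
spaces in a Bergman fan have dimension at most the rank. -/
theorem polyDim_le (hX : X.IsTropicalManifold d) {P : Set (Fin n → ℝ)} (hP : P ∈ X.cells) :
    polyDim P ≤ d := by
  obtain ⟨⟨z, hz⟩, -⟩ := exists_relInt (X.rational P hP) (X.nonempty P hP)
  have hzX : z ∈ X.support := ⟨P, hP, hz.1⟩
  obtain ⟨m, M, g, e, h⟩ := exists_bergmanModel hX hzX
  exact h.finrank_le (X.vectorSpan_subset_dirStar Set.Subset.rfl hP hz hzX)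

theorem mem_vectorSpan_of_smul_mem {P : Set (Fin n → ℝ)} {z u : Fin n → ℝ} (hz : z ∈ P) {ε : ℝ}
    (hε : 0 < ε) (hu : z + ε • u ∈ P) : u ∈ vectorSpan ℝ P := by
  have := sub_mem_vectorSpan hu hz
  rw [add_sub_cancel_left] at this
  exact (Submodule.smul_mem_iff _ hε.ne').1 this

/-- A linear space in a finite union of cells is parallel to one of the cells. -/
theorem exists_le_vectorSpan {z : Fin n → ℝ} {K : Submodule ℝ (Fin n → ℝ)}
    (hK : (K : Set (Fin n → ℝ)) ⊆ dirStar X.support z) :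
    ∃ P ∈ X.cells, z ∈ P ∧ K ≤ vectorSpan ℝ P := by
  have hfin : Finite {P | P ∈ X.cells ∧ z ∈ P} := (X.finite_cells_at z).to_subtype
  obtain ⟨P, hP⟩ := Subspace.exists_eq_top_of_iUnion_eq_univ (k := ℝ) (E := K)
    -- A real vector space is not a finite union of proper subspaces.
    (p := fun P : {P | P ∈ X.cells ∧ z ∈ P} => (vectorSpan ℝ P.1).comap K.subtype) (by
      rw [Set.eq_univ_iff_forall]
      rintro ⟨u, hu⟩
      obtain ⟨P, hP, hzP, ε, hε, hu'⟩ := X.exists_cell_of_mem_dirStar Set.Subset.rfl (hK hu)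
      exact Set.mem_iUnion.2 ⟨⟨P, hP, hzP⟩, mem_vectorSpan_of_smul_mem hzP hε hu'⟩)
  refine ⟨P.1, P.2.1, P.2.2, fun u hu => ?_⟩
  have : (⟨u, hu⟩ : K) ∈ (vectorSpan ℝ P.1).comap K.subtype := by rw [hP]; trivial
  exact this

/-- The star of a tropical manifold at a point of codimension at most one. -/
theorem star_codim_one (hX : X.IsTropicalManifold d) {z : Fin n → ℝ} (hz : z ∈ X.support)
    (hdim : ∀ P ∈ X.cells, z ∈ P → d ≤ polyDim P + 1) {W : Submodule ℝ (Fin n → ℝ)}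
    (hWS : (W : Set (Fin n → ℝ)) ⊆ dirStar X.support z) :
    (finrank ℝ W = d → (W : Set (Fin n → ℝ)) = dirStar X.support z) ∧
    (finrank ℝ W + 1 = d → RationalSubspace W →
      ∃ (ι : Type) (_ : Fintype ι) (f : ι → Fin n → ℝ), IsTropicalLine W (dirStar X.support z) f) := by
  obtain ⟨P, hP, hzP⟩ := hz
  obtain ⟨τ, hτ, -, hzτ⟩ := X.exists_relInt_cell hP hzP
  have hz : z ∈ X.support := ⟨P, hP, hzP⟩
  obtain ⟨m, M, g, e, h⟩ := exists_bergmanModel hX hz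
  -- The lineality comes from the cell `τ` of `X`, whereas `W` may come from another complex. In the
  -- non-linear case `W` is contained in this lineality space, and dimensions force equality.
  rcases h.shape (V := vectorSpan ℝ τ)
    (fun v hv u hu => X.add_mem_dirStar Set.Subset.rfl hτ hzτ hu hv) (zero_mem_dirStar hz)
    (hdim τ hτ hzτ.1) with ⟨K, hK, hKS⟩ | ⟨hV, hall, ι, hι, f, hf⟩
  · have hWK : W ≤ K := by
      intro x hx
      have := hWS hx
      rwa [← hKS] at this
    refine ⟨fun hW => ?_, fun hW hrat => ?_⟩
    · rw [Submodule.eq_of_le_of_finrank_eq hWK (hW.trans hK.symm), hKS]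
    · obtain ⟨Q, hQ, hzQ, hKQ⟩ := exists_le_vectorSpan hKS.subset
      have hKeq : K = vectorSpan ℝ Q := Submodule.eq_of_le_of_finrank_le hKQ
        (by rw [hK]; exact polyDim_le hX hQ)
      rw [← hKS]
      refine isTropicalLine_of_linear hrat ?_ hWK (hW.trans hK.symm)
      rw [hKeq]
      exact (exists_relInt (X.rational Q hQ) (X.nonempty Q hQ)).2
  · have hWV := hall W hWS
    have hle := Submodule.finrank_mono hWV
    refine ⟨fun hW => by omega, fun hW _ => ?_⟩
    rw [Submodule.eq_of_le_of_finrank_le hWV (by omega)]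
    exact ⟨ι, hι, f, hf⟩

end RationalPolyhedralComplex

end Model

/-! ### Balancing in codimension one -/

namespace RationalPolyhedralComplex

section Balancing

variable {n : ℕ} {Y : RationalPolyhedralComplex n} {d : ℕ}

/-- The `d`-cells of non-zero weight. -/
def weightCells (m : Y.Cell d → ℚ) : Set (Set (Fin n → ℝ)) :=
  {P | ∃ σ : Y.Cell d, σ.1 = P ∧ m σ ≠ 0}

theorem weightCells_subset (m : Y.Cell d → ℚ) : weightCells m ⊆ Y.cells := by
  rintro _ ⟨σ, rfl, -⟩
  exact σ.2.1

/-- The functional exposing `τ` in `σ` is negative on `v` and non-positive on `x - z`, which is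
congruent to `c • v`. -/
theorem coeff_nonneg {τ σ : Set (Fin n → ℝ)} (hτ : τ ∈ Y.cells) (hσ : σ ∈ Y.cells) (hτσ : τ ⊆ σ)
    (hdim : polyDim τ < polyDim σ) {v z x : Fin n → ℝ} (hz : RelInt τ z)
    (hv : IsPrimitiveNormal τ σ v) (hx : x ∈ σ) {c : ℝ} (hc : x - z - c • v ∈ vectorSpan ℝ τ) :
    0 ≤ c := by
  obtain ⟨l, hl0, hl⟩ := exists_facet_functional hτ hσ hτσ
  obtain ⟨ε, hε, hseg⟩ := IsPrimitiveNormal.exists_mem hσ hτσ hz hv (Submodule.zero_mem _)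
    zero_le_one
  have h1 := hseg ε hε.le le_rfl
  rw [zero_add, one_smul] at h1
  have h2 := hl _ h1 z hz.1
  rw [map_add, map_smul, smul_eq_mul] at h2
  have h3 : l v < 0 := by
    rcases lt_or_ge (l v) 0 with h | h
    · exact h
    · have h4 : l v = 0 := by nlinarith [h2.1, mul_nonneg hε.le h]
      have h5 := h2.2 (by rw [h4, mul_zero, add_zero])
      exact absurd (mem_vectorSpan_of_smul_mem hz.1 hε h5) (IsPrimitiveNormal.notMem hσ hdim hv)
  have h4 := hl0 _ hc
  rw [map_sub, map_sub, map_smul, smul_eq_mul] at h4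
  have h5 := (hl x hx z hz.1).1
  by_contra! h
  nlinarith [mul_pos_of_neg_of_neg h h3]

/-- Cells are determined by the class of their primitive normal vector. -/
theorem eq_of_primitiveNormal_sub_mem {τ σ σ' : Set (Fin n → ℝ)} (hτ : τ ∈ Y.cells)
    (hσ : σ ∈ Y.cells) (hσ' : σ' ∈ Y.cells) (hτσ : τ ⊆ σ) (hτσ' : τ ⊆ σ')
    (hdim : polyDim τ + 1 = polyDim σ) (hdim' : polyDim σ' = polyDim σ) {v v' : Fin n → ℝ}
    (hv : IsPrimitiveNormal τ σ v) (hv' : IsPrimitiveNormal τ σ' v')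
    (hsub : v - v' ∈ vectorSpan ℝ τ) : σ = σ' := by
  obtain ⟨⟨z, hz⟩, -⟩ := exists_relInt (Y.rational τ hτ) (Y.nonempty τ hτ)
  obtain ⟨⟨y, hy⟩, -⟩ := exists_relInt (Y.rational σ hσ) (Y.nonempty σ hσ)
  have hvτ := IsPrimitiveNormal.notMem hσ (by omega) hv
  obtain ⟨c, hc⟩ := exists_sub_smul_mem (vectorSpan_mono ℝ hτσ) hdim hv.2.2.1 hvτ
    (sub_mem_vectorSpan hy.1 (hτσ hz.1))
  have hc0 := coeff_nonneg hτ hσ hτσ (by omega) hz hv hy.1 hc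
  -- Since `y - z` is also congruent to `c • v'` with `c ≥ 0`, the segment from `z` to `y` starts
  -- inside `σ'`, yet after `z` it runs through the relative interior of `σ`.
  have hl : y - z - c • v' ∈ vectorSpan ℝ τ := by
    have := Submodule.add_mem _ hc (Submodule.smul_mem _ c hsub)
    convert this using 1
    module
  obtain ⟨ε, hε, hseg⟩ := IsPrimitiveNormal.exists_mem hσ' hτσ' hz hv' hl hc0
  have ht : 0 < min ε 1 := by positivity
  have h1 := hseg (min ε 1) ht.le (min_le_left _ _)
  rw [sub_add_cancel] at h1
  have h2 := hy.lineMap (Y.rational σ hσ).convex (hτσ hz.1) ht (min_le_right _ _)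
  exact eq_of_subset_of_polyDim hσ hσ' (subset_of_relInt hσ hσ' h2 h1) hdim'.le

/-- A primitive normal vector pointing into a tropical line is congruent to one of its primitive
generators. -/
theorem exists_generator_of_primitiveNormal {τ σ : Set (Fin n → ℝ)} (hσ : σ ∈ Y.cells)
    (hτσ : τ ⊆ σ) (hdim : polyDim τ < polyDim σ) {v : Fin n → ℝ} (hv : IsPrimitiveNormal τ σ v)
    {S : Set (Fin n → ℝ)} {ι : Type} [Fintype ι] {f : ι → Fin n → ℝ}
    (hf : IsTropicalLine (vectorSpan ℝ τ) S f) (hvS : v ∈ S) :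
    ∃ i, v - f i ∈ vectorSpan ℝ τ := by
  have hvτ := IsPrimitiveNormal.notMem hσ hdim hv
  obtain ⟨i, a, ha, hva⟩ := (hf.mem_iff v).1 hvS
  obtain ⟨k, rfl⟩ := hf.integral i a v hv.1 hva
  have hk0 : (k : ℝ) ≠ 0 := by
    intro h
    rw [h, zero_smul, sub_zero] at hva
    exact hvτ hva
  have hfσ : f i ∈ vectorSpan ℝ σ := by
    have := Submodule.sub_mem _ hv.2.2.1 (vectorSpan_mono ℝ hτσ hva)
    rw [sub_sub_cancel] at this
    exact (Submodule.smul_mem_iff _ hk0).1 this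
  -- Modulo the direction space of `τ`, `v` is `k` times `f i` and `f i` is `l` times `v`; so `k * l
  -- = 1`, and `k ≥ 0` leaves `k = 1`.
  obtain ⟨l, hl⟩ := hv.2.2.2 (f i) (hf.lattice i) hfσ
  have h1 : (1 - l * k : ℝ) • f i ∈ vectorSpan ℝ τ := by
    have := Submodule.add_mem _ hl (Submodule.smul_mem _ (l : ℝ) hva)
    rw [← Int.cast_smul_eq_zsmul ℝ l v] at this
    convert this using 1
    module
  have h2 : (1 - l * k : ℝ) = 0 := by
    by_contra h
    exact hf.notMem i ((Submodule.smul_mem_iff _ h).1 h1)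
  have h3 : k * l = 1 := by
    have : (l * k : ℝ) = 1 := by linarith
    rw [mul_comm]
    exact_mod_cast this
  have h4 : 0 ≤ k := by exact_mod_cast ha
  have h5 : k = 1 := by
    rcases Int.eq_one_or_neg_one_of_mul_eq_one h3 with h | h
    · exact h
    · omega
  refine ⟨i, ?_⟩
  simpa [h5] using hva

theorem primitiveNormal_mem_dirStar {C : Set (Set (Fin n → ℝ))} {τ σ : Set (Fin n → ℝ)}
    (hC : C ⊆ Y.cells) (hσ : σ ∈ C) (hτσ : τ ⊆ σ) {v z l : Fin n → ℝ} (hz : RelInt τ z)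
    (hv : IsPrimitiveNormal τ σ v) (hl : l ∈ vectorSpan ℝ τ) {c : ℝ} (hc : 0 ≤ c) :
    l + c • v ∈ dirStar (⋃₀ C) z := by
  obtain ⟨ε, hε, hseg⟩ := IsPrimitiveNormal.exists_mem (hC hσ) hτσ hz hv hl hc
  exact ⟨ε, hε, fun t h0 h1 => ⟨σ, hσ, hseg t h0 h1⟩⟩

/-- Balancing at a cell of codimension one whose star lies in a tropical line. -/
theorem balance {j : ℕ} (hj : j + 1 = d) (m : Y.Cell d → ℚ) (τ : Y.Cell j) {z : Fin n → ℝ}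
    (hz : RelInt τ.1 z) {v : Y.Cell d → Fin n → ℝ}
    (hv : ∀ σ : Y.Cell d, τ.1 ⊆ σ.1 → IsPrimitiveNormal τ.1 σ.1 (v σ))
    {S : Set (Fin n → ℝ)} {ι : Type} [Fintype ι] {f : ι → Fin n → ℝ}
    (hf : IsTropicalLine (vectorSpan ℝ τ.1) S f) (hS : dirStar (⋃₀ weightCells m) z ⊆ S) :
    ∃ a : ι → ℝ,
      (∑ᶠ σ : {σ : Y.Cell d // τ.1 ⊆ σ.1}, (m σ.1 : ℝ) • v σ.1 ∈ vectorSpan ℝ τ.1 ↔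
        ∀ i j, a i = a j) ∧
      (∀ σ : Y.Cell d, τ.1 ⊆ σ.1 → m σ ≠ 0 →
        ∃ i, v σ - f i ∈ vectorSpan ℝ τ.1 ∧ a i = m σ) ∧
      ∀ i, a i ≠ 0 → ∃ σ : Y.Cell d, τ.1 ⊆ σ.1 ∧ m σ ≠ 0 ∧ v σ - f i ∈ vectorSpan ℝ τ.1 := by
  classical
  have hfin := finite_cells_above d τ
  have := Fintype.ofFinite {σ : Y.Cell d // τ.1 ⊆ σ.1}
  have := hf.nontrivial
  have hlt : ∀ σ : Y.Cell d, polyDim τ.1 + 1 = polyDim σ.1 := fun σ => by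
    rw [τ.2.2, σ.2.2, hj]
  -- Only cells of non-zero weight are known to point into `S`; the others receive an arbitrary
  -- index, which is harmless in the weighted sums.
  have hex : ∀ σ : {σ : Y.Cell d // τ.1 ⊆ σ.1}, ∃ i, m σ.1 ≠ 0 →
      v σ.1 - f i ∈ vectorSpan ℝ τ.1 := by
    rintro ⟨σ, hσ⟩
    by_cases hm : m σ = 0
    · exact ⟨Classical.arbitrary ι, fun h => absurd hm h⟩
    · have hvS : v σ ∈ S := hS (by
        simpa using primitiveNormal_mem_dirStar (weightCells_subset m) ⟨σ, rfl, hm⟩ hσ hz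
          (hv σ hσ) (Submodule.zero_mem _) zero_le_one)
      obtain ⟨i, hi⟩ := exists_generator_of_primitiveNormal σ.2.1 hσ
        (by have := hlt σ; omega) (hv σ hσ) hf hvS
      exact ⟨i, fun _ => hi⟩
  choose idx hidx using hex
  -- `a i` is the total weight on the ray `f i`. At most one cell contributes, since a cell is
  -- determined by its normal class.
  let a : ι → ℝ := fun i => ∑ σ with idx σ = i, (m σ.1 : ℝ)
  have ha : ∀ σ : {σ : Y.Cell d // τ.1 ⊆ σ.1}, m σ.1 ≠ 0 → a (idx σ) = m σ.1 := by
    intro σ hσ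
    refine Finset.sum_eq_single σ (fun ρ hρ hne => ?_) (fun h => absurd (by simp) h)
    by_contra hm
    have hmρ : m ρ.1 ≠ 0 := by exact_mod_cast hm
    refine hne (Subtype.ext (Subtype.ext ?_))
    have hidxρ := (Finset.mem_filter.1 hρ).2
    refine eq_of_primitiveNormal_sub_mem τ.2.1 ρ.1.2.1 σ.1.2.1 ρ.2 σ.2 (hlt ρ.1)
      (by rw [ρ.1.2.2, σ.1.2.2]) (hv ρ.1 ρ.2) (hv σ.1 σ.2) ?_
    have := Submodule.sub_mem _ (hidx ρ hmρ) (hidx σ hσ)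
    rw [hidxρ] at this
    simpa using this
  refine ⟨a, ?_, fun σ hσ hm => ⟨idx ⟨σ, hσ⟩, hidx ⟨σ, hσ⟩ hm, ha ⟨σ, hσ⟩ hm⟩, fun i hi => ?_⟩
  -- The balancing sum is congruent to `∑ a i • f i`, so it vanishes exactly when all `a i` are
  -- equal.
  · rw [finsum_eq_sum_of_fintype, ← hf.relation]
    have h1 : ∑ i, a i • f i = ∑ σ : {σ : Y.Cell d // τ.1 ⊆ σ.1}, (m σ.1 : ℝ) • f (idx σ) := by
      rw [← Finset.sum_fiberwise (s := Finset.univ) (g := idx)]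
      refine Finset.sum_congr rfl fun i _ => ?_
      rw [Finset.sum_smul]
      refine Finset.sum_congr rfl fun σ hσ => ?_
      rw [(Finset.mem_filter.1 hσ).2]
    have h2 : ∑ σ : {σ : Y.Cell d // τ.1 ⊆ σ.1}, (m σ.1 : ℝ) • v σ.1 - ∑ i, a i • f i ∈
        vectorSpan ℝ τ.1 := by
      rw [h1, ← Finset.sum_sub_distrib]
      refine Submodule.sum_mem _ fun σ _ => ?_
      rw [← smul_sub]
      by_cases hm : m σ.1 = 0
      · simp [hm]
      · exact Submodule.smul_mem _ _ (hidx σ hm)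
    exact ⟨fun h => by simpa using Submodule.sub_mem _ h h2,
      fun h => by simpa using Submodule.add_mem _ h2 h⟩
  · obtain ⟨σ, hσ, hm⟩ := Finset.exists_ne_zero_of_sum_ne_zero hi
    have hm' : m σ.1 ≠ 0 := by exact_mod_cast hm
    refine ⟨σ.1, σ.2, hm', ?_⟩
    have := hidx σ hm'
    rwa [(Finset.mem_filter.1 hσ).2] at this

variable {X : RationalPolyhedralComplex n}

/-- The constant weight one on a tropical manifold is balanced. -/
theorem one_mem_minkowskiWeights (hX : X.IsTropicalManifold d) :
    (fun _ => 1) ∈ X.minkowskiWeights d := by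
  classical
  intro j hj τ v hv
  obtain ⟨⟨z, hz⟩, hrat⟩ := exists_relInt (X.rational τ.1 τ.2.1) (X.nonempty τ.1 τ.2.1)
  have hzX : z ∈ X.support := ⟨τ.1, τ.2.1, hz.1⟩
  have hdimτ : finrank ℝ (vectorSpan ℝ τ.1) = j := τ.2.2
  obtain ⟨ι, hι, f, hf⟩ := (star_codim_one hX hzX (fun P hP hzP => by
      have := Submodule.finrank_mono
        (vectorSpan_mono ℝ (subset_of_relInt τ.2.1 hP hz hzP))
      unfold polyDim
      omega) (X.vectorSpan_subset_dirStar Set.Subset.rfl τ.2.1 hz hzX)).2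
    (by omega) hrat
  obtain ⟨a, ha, ha1, -⟩ := balance hj (fun _ => 1) τ hz hv hf
    (dirStar_mono (Set.sUnion_subset_sUnion (weightCells_subset _)) z)
  rw [ha]
  suffices ∀ i, a i = 1 from fun i j => (this i).trans (this j).symm
  intro i
  have hfi : f i ∈ dirStar X.support z := (hf.mem_iff _).2 ⟨i, 1, zero_le_one, by simp⟩
  -- Every ray points into a cell of `X`, necessarily a `d`-cell, and that cell contributes weight
  -- one to this ray.
  obtain ⟨P, hP, hzP, ε, hε, hP'⟩ := X.exists_cell_of_mem_dirStar Set.Subset.rfl hfi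
  have hτP := subset_of_relInt τ.2.1 hP hz hzP
  have hfP := mem_vectorSpan_of_smul_mem hzP hε hP'
  have hlt : finrank ℝ (vectorSpan ℝ τ.1) < finrank ℝ (vectorSpan ℝ P) := by
    refine Submodule.finrank_lt_finrank_of_lt
      (lt_of_le_of_ne (vectorSpan_mono ℝ hτP) fun h => hf.notMem i ?_)
    rw [h]
    exact hfP
  have hPd : polyDim P = d := le_antisymm (polyDim_le hX hP) (by unfold polyDim; omega)
  let σ : X.Cell d := ⟨P, hP, hPd⟩
  have hv' := hv σ hτP
  have hdim : finrank ℝ (vectorSpan ℝ τ.1) + 1 = finrank ℝ (vectorSpan ℝ P) := by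
    rw [hdimτ, hj]; exact hPd.symm
  obtain ⟨i', hi', hai'⟩ := ha1 σ hτP one_ne_zero
  obtain ⟨c, hc⟩ := exists_sub_smul_mem (vectorSpan_mono ℝ hτP) hdim hv'.2.2.1
    (IsPrimitiveNormal.notMem hP hlt hv') hfP
  have hc0 : 0 ≤ ε * c := coeff_nonneg τ.2.1 hP hτP hlt hz hv' hP' (by
    have := Submodule.smul_mem _ ε hc
    convert this using 1
    module)
  have hc0' : 0 ≤ c := nonneg_of_mul_nonneg_right hc0 hε
  have hrel : ∑ k, (Pi.single i 1 - Pi.single i' c : ι → ℝ) k • f k ∈ vectorSpan ℝ τ.1 := by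
    have := Submodule.add_mem _ hc (Submodule.smul_mem _ c hi')
    convert this using 1
    have : ∑ k, (Pi.single i 1 - Pi.single i' c : ι → ℝ) k • f k = f i - c • f i' := by
      simp [sub_smul, Finset.sum_sub_distrib, Pi.single_apply, ite_smul]
    rw [this]
    module
  -- For `i ≠ i'` the relation has coefficients `1` and `-c ≤ 0`, which cannot be equal.
  have hii' : i = i' := by
    by_contra hne
    have := (hf.relation _).1 hrel i i'
    simp [hne, Ne.symm hne] at this
    linarith
  rw [hii', hai']
  norm_num

/-- At a point of codimension at most one, a balanced subset of a tropical manifold fills its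
star. -/
theorem star_subset_of_codim_one (hX : X.IsTropicalManifold d) {m : Y.Cell d → ℚ}
    (hm : m ∈ Y.minkowskiWeights d) (hsub : ⋃₀ weightCells m ⊆ X.support) {z : Fin n → ℝ}
    (hz : z ∈ ⋃₀ weightCells m) (hXz : ∀ P ∈ X.cells, z ∈ P → d ≤ polyDim P + 1)
    (hYz : ∀ P ∈ Y.cells, z ∈ P → d ≤ polyDim P + 1) :
    dirStar X.support z ⊆ dirStar (⋃₀ weightCells m) z := by
  classical
  have hzX := hsub hz
  have hz' := hz
  obtain ⟨_, ⟨σ₀, rfl, hσ₀⟩, hzσ₀⟩ := hz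
  obtain ⟨τ, hτ, hτσ₀, hzτ⟩ := Y.exists_relInt_cell σ₀.2.1 hzσ₀
  have hWC := Y.vectorSpan_subset_dirStar (weightCells_subset m) hτ hzτ hz'
  have hWS := hWC.trans (dirStar_mono hsub z)
  have hle : polyDim τ ≤ d := by
    rw [← σ₀.2.2]
    exact Submodule.finrank_mono (vectorSpan_mono ℝ hτσ₀)
  have hge := hYz τ hτ hzτ.1
  -- If the cell of `Y` at `z` has dimension `d`, its direction space is already the whole star of
  -- `X`.
  rcases hle.eq_or_lt with hd | hd
  · rw [← (star_codim_one hX hzX hXz hWS).1 hd]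
    exact hWC
  · have hd' : polyDim τ + 1 = d := by omega
    obtain ⟨ι, hι, f, hf⟩ := (star_codim_one hX hzX hXz hWS).2 hd'
      (exists_relInt (Y.rational τ hτ) (Y.nonempty τ hτ)).2
    let τ' : Y.Cell (polyDim τ) := ⟨τ, hτ, rfl⟩
    have hex : ∀ σ : Y.Cell d, ∃ v, τ ⊆ σ.1 → IsPrimitiveNormal τ σ.1 v := by
      intro σ
      by_cases h : τ ⊆ σ.1
      · obtain ⟨v, hv⟩ := exists_isPrimitiveNormal hτ σ.2.1 h (by rw [hd', σ.2.2])
        exact ⟨v, fun _ => hv⟩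
      · exact ⟨0, fun h' => absurd h' h⟩
    choose v hv using hex
    obtain ⟨a, ha, ha1, ha2⟩ := balance hd' m τ' hzτ hv hf (dirStar_mono hsub z)
    have hconst := ha.1 (hm _ hd' τ' v hv)
    -- All ray weights agree and the one of `σ₀` is non-zero, so every ray is covered by a cell of
    -- non-zero weight.
    obtain ⟨i₀, -, hi₀⟩ := ha1 σ₀ hτσ₀ hσ₀
    intro u hu
    obtain ⟨i, c, hc, huc⟩ := (hf.mem_iff u).1 hu
    obtain ⟨σ, hτσ, hmσ, hσ⟩ := ha2 i (by
      rw [hconst i i₀, hi₀]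
      exact_mod_cast hσ₀)
    have hl : u - c • v σ ∈ vectorSpan ℝ τ := by
      have := Submodule.sub_mem _ huc (Submodule.smul_mem _ c hσ)
      convert this using 1
      module
    have := primitiveNormal_mem_dirStar (weightCells_subset m) ⟨σ, rfl, hmσ⟩ hτσ hzτ (hv σ hτσ)
      hl hc
    simpa using this

end Balancing

end RationalPolyhedralComplex

/-! ### Sets of codimension two do not separate a convex open set -/

section CodimTwo

variable {E : Type*} [NormedAddCommGroup E] [NormedSpace ℝ E] [FiniteDimensional ℝ E]

/-- Finitely many proper affine subspaces do not cover a non-empty open set. -/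
theorem exists_mem_forall_sub_notMem {κ : Type*} [Finite κ] (a : κ → E) (L : κ → Submodule ℝ E)
    (hL : ∀ k, finrank ℝ (L k) < finrank ℝ E) {O : Set E} (hO : IsOpen O) (hne : O.Nonempty) :
    ∃ x ∈ O, ∀ k, x - a k ∉ L k := by
  classical
  have := Fintype.ofFinite κ
  by_contra! hcon
  obtain ⟨k, -, U, hU, -, ⟨x, -, hx⟩, hsub⟩ := exists_isOpen_subset_of_finite_cover Set.univ
    (C := fun k => {x | x - a k ∈ L k})
    (fun k => (L k).closed_of_finiteDimensional.preimage (continuous_id.sub continuous_const))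
    Finset.univ hO (by simpa using hne) (fun x hx => by
      obtain ⟨k, hk⟩ := hcon x hx.2
      exact ⟨k, Finset.mem_univ k, hk⟩)
  have htop : L k = ⊤ := by
    rw [eq_top_iff]
    intro y _
    have hc : ContinuousAt (fun t : ℝ => x + t • y) 0 := by fun_prop
    have h1 : ∀ᶠ t : ℝ in 𝓝 0, x + t • y ∈ U :=
      hc.eventually_mem (by simpa using hU.mem_nhds hx)
    obtain ⟨t, ht, ht0⟩ := ((h1.filter_mono nhdsWithin_le_nhds).and
      (self_mem_nhdsWithin : Set.Ioi (0 : ℝ) ∈ 𝓝[>] 0)).exists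
    have h2 := hsub ⟨trivial, ht⟩
    have h3 := hsub ⟨trivial, hx⟩
    have h4 := (L k).sub_mem h2 h3
    rw [sub_sub_sub_cancel_right, add_sub_cancel_left] at h4
    exact (Submodule.smul_mem_iff _ (ne_of_gt ht0)).1 h4
  have := hL k
  rw [htop, finrank_top] at this
  exact lt_irrefl _ this

/-- A closed subset of a convex open set which has interior points, and which is open away from
finitely many sets of codimension two, is everything. -/
theorem subset_of_codim_two {D U : Set E} (hD : Convex ℝ D) (hDo : IsOpen D) (hU : IsClosed U)
    {κ : Type*} [Finite κ] (Z : κ → Set E)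
    (hZ : ∀ k, ∃ L : Submodule ℝ E, finrank ℝ L + 2 ≤ finrank ℝ E ∧
      ∀ x ∈ Z k, ∀ y ∈ Z k, x - y ∈ L)
    (hopen : ∀ x ∈ D ∩ U, (∀ k, x ∉ Z k) → U ∈ 𝓝 x) (hint : (interior U ∩ D).Nonempty) :
    D ⊆ U := by
  classical
  choose L hL hZL using hZ
  have ha : ∀ k, ∃ a, ∀ x ∈ Z k, x - a ∈ L k := by
    intro k
    rcases (Z k).eq_empty_or_nonempty with h | ⟨a, ha⟩
    · exact ⟨0, by simp [h]⟩
    · exact ⟨a, fun x hx => hZL k x hx a ha⟩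
  choose a ha using ha
  obtain ⟨p, ⟨hpU, hpD⟩, hp⟩ := exists_mem_forall_sub_notMem a L
    (fun k => by have := hL k; omega) (isOpen_interior.inter hDo) hint
  by_contra hnot
  obtain ⟨q₀, hq₀D, hq₀U⟩ := Set.not_subset.1 hnot
  -- `q` avoids the span of `p` and each exceptional subspace, a proper subspace as the codimension
  -- is two. Hence the whole segment from `p` to `q` misses the sets `Z k`.
  obtain ⟨q, ⟨hqD, hqU⟩, hq⟩ := exists_mem_forall_sub_notMem a
    (fun k => L k ⊔ Submodule.span ℝ {p - a k}) (fun k => by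
      have h1 := Submodule.finrank_add_le_finrank_add_finrank (L k)
        (Submodule.span ℝ {p - a k})
      have h2 := finrank_span_le_card (R := ℝ) ({p - a k} : Set E)
      simp only [Set.toFinset_card, Set.card_singleton] at h2
      have := hL k
      omega) (hDo.inter hU.isOpen_compl) ⟨q₀, hq₀D, hq₀U⟩
  have hsegZ : ∀ x ∈ segment ℝ p q, ∀ k, x ∉ Z k := by
    rintro x ⟨s, t, hs, ht, hst, rfl⟩ k hx
    have h1 := ha k _ hx
    have h2 : s • (p - a k) + t • (q - a k) ∈ L k := by
      convert h1 using 1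
      have : a k = (s + t) • a k := by rw [hst, one_smul]
      conv_rhs => rw [this]
      module
    rcases eq_or_ne t 0 with rfl | ht0
    · rw [add_zero] at hst
      rw [hst, zero_smul, one_smul, add_zero] at h2
      exact hp k h2
    · refine hq k ((Submodule.smul_mem_iff _ ht0).1 ?_)
      have h3 : t • (q - a k) = (s • (p - a k) + t • (q - a k)) + (-s) • (p - a k) := by module
      rw [h3]
      exact Submodule.add_mem_sup h2 (Submodule.smul_mem _ _ (Submodule.mem_span_singleton_self _))
  -- Along the segment `U` is both open and closed, yet it contains `p` and not `q`.
  have hseg := (convex_segment (𝕜 := ℝ) p q).isPreconnected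
  obtain ⟨x, -, hx, hx'⟩ := hseg (interior U) Uᶜ isOpen_interior hU.isOpen_compl (fun x hx => by
    by_cases hxU : x ∈ U
    · exact Or.inl (mem_interior_iff_mem_nhds.2
        (hopen x ⟨hD.segment_subset hpD hqD hx, hxU⟩ (hsegZ x hx)))
    · exact Or.inr hxU) ⟨p, left_mem_segment ℝ p q, hpU⟩ ⟨q, right_mem_segment ℝ p q, hqU⟩
  exact hx' (interior_subset hx)

end CodimTwo

/-! ### Rigidity: balanced subsets of full dimension fill a connected tropical manifold -/

namespace RationalPolyhedralComplex

section Rigidity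

variable {n : ℕ} {X Y : RationalPolyhedralComplex n} {d : ℕ}

/-- If two unions of cells have nested stars at `z`, they are nested near `z`. -/
theorem eventually_mem_of_star_subset {C : Set (Set (Fin n → ℝ))} (hC : C ⊆ Y.cells)
    {z : Fin n → ℝ} (h : dirStar X.support z ⊆ dirStar (⋃₀ C) z) :
    ∀ᶠ x in 𝓝 z, x ∈ X.support → x ∈ ⋃₀ C := by
  obtain ⟨δ, hδ, h1⟩ := X.exists_mem_dirStar_iff (C := X.cells) Set.Subset.rfl z
  obtain ⟨δ', hδ', h2⟩ := Y.exists_mem_dirStar_iff hC z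
  filter_upwards [Metric.ball_mem_nhds z hδ, Metric.ball_mem_nhds z hδ'] with x hx hx' hxX
  rw [mem_ball_iff_norm] at hx hx'
  have h3 := (h1 (x - z) hx).1 (by rw [add_sub_cancel]; exact hxX)
  have := (h2 (x - z) hx').2 (h h3)
  rwa [add_sub_cancel] at this

/-- The section makes `ℝ^B` a chart of the star, in which the weighted cells form a closed set. At
points on no cell of codimension two or more this set is open, by the codimension-one case, so one
open piece propagates through the chart. -/
theorem star_subset_of_isOpen (hX : X.IsTropicalManifold d) {m : Y.Cell d → ℚ}
    (hm : m ∈ Y.minkowskiWeights d) (hsub : ⋃₀ weightCells m ⊆ X.support) {w : Fin n → ℝ}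
    {k e : ℕ} {M : Matroid (Fin k)} {g : (Fin k → ℝ) →ₗ[ℝ] (Fin n → ℝ)}
    (h : BergmanModel (dirStar X.support w) d M g e) {B : Set (Fin k)} (hB : M.IsBase B)
    {O : Set (B → ℝ)} (hO : IsOpen O) (hne : O.Nonempty)
    (hOs : ∀ x ∈ O, g (bergmanSection M B x) ∈ dirStar (⋃₀ weightCells m) w) (x : B → ℝ) :
    g (bergmanSection M B x) ∈ dirStar (⋃₀ weightCells m) w := by
  classical
  have hCsub := weightCells_subset m
  obtain ⟨δ₁, hδ₁, hcX⟩ := X.exists_local_cone w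
  obtain ⟨δ₂, hδ₂, hcY⟩ := Y.exists_local_cone w
  have hgc : Continuous g := LinearMap.continuous_of_finiteDimensional g
  have hsc : Continuous (bergmanSection M B) := continuous_bergmanSection
  have hc : Continuous fun x => g (bergmanSection M B x) := hgc.comp hsc
  have hzero : g (bergmanSection M B 0) = 0 := by
    rw [bergmanSection_zero h.ground h.nonempty hB, map_zero]
  obtain ⟨ρ, hρ, hball⟩ : ∃ ρ > 0, ∀ x : B → ℝ, ‖x‖ < ρ →
      ‖g (bergmanSection M B x)‖ < δ₁ ∧ ‖g (bergmanSection M B x)‖ < δ₂ := by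
    have h1 : ∀ᶠ x in 𝓝 (0 : B → ℝ), ‖g (bergmanSection M B x)‖ < min δ₁ δ₂ :=
      hc.norm.continuousAt.eventually_lt_const (by simp only [hzero, norm_zero]; positivity)
    obtain ⟨ρ, hρ, h2⟩ := Metric.eventually_nhds_iff.1 h1
    exact ⟨ρ, hρ, fun x hx => lt_min_iff.1 (h2 (by simpa using hx))⟩
  have hstarX : ∀ x : B → ℝ, g (bergmanSection M B x) ∈ dirStar X.support w := fun x => by
    have := bergmanSection_mem h.ground h.nonempty hB x
    exact (h.mem_iff _ (Submodule.subset_span this)).2 this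
  have hinX : ∀ x : B → ℝ, ‖x‖ < ρ → w + g (bergmanSection M B x) ∈ X.support := fun x hx =>
    (mem_dirStar_iff_of_local_cone (C := X.cells) Set.Subset.rfl hcX (hball x hx).1).2 (hstarX x)
  have hUiff : ∀ x : B → ℝ, ‖x‖ < ρ → (w + g (bergmanSection M B x) ∈ ⋃₀ weightCells m ↔
      g (bergmanSection M B x) ∈ dirStar (⋃₀ weightCells m) w) := fun x hx =>
    mem_dirStar_iff_of_local_cone hCsub hcY (hball x hx).2
  -- Positive homogeneity reduces the claim to a small ball, where stars and unions of cells agree.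
  have hscale : ∀ (x : B → ℝ) {t : ℝ}, 0 < t →
      (g (bergmanSection M B (t • x)) ∈ dirStar (⋃₀ weightCells m) w ↔
        g (bergmanSection M B x) ∈ dirStar (⋃₀ weightCells m) w) := by
    intro x t ht
    rw [bergmanSection_smul h.ground h.nonempty hB x ht, map_smul]
    refine ⟨fun h' => ?_, fun h' => smul_mem_dirStar h' ht.le⟩
    have := smul_mem_dirStar h' (inv_nonneg.2 ht.le)
    rwa [inv_smul_smul₀ ht.ne'] at this
  have hsmall : ∀ x : B → ℝ, ∃ t : ℝ, 0 < t ∧ ‖t • x‖ < ρ := by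
    intro x
    refine ⟨ρ / (‖x‖ + 1), by positivity, ?_⟩
    rw [norm_smul, Real.norm_of_nonneg (by positivity), div_mul_eq_mul_div,
      div_lt_iff₀ (by positivity)]
    nlinarith [norm_nonneg x]
  let U : Set (B → ℝ) := {x | w + g (bergmanSection M B x) ∈ ⋃₀ weightCells m}
  have hUc : IsClosed U := (Y.isClosed_sUnion hCsub).preimage (continuous_const.add hc)
  let κ := {P : Set (Fin n → ℝ) // ((P ∈ X.cells ∧ w ∈ P) ∨ (P ∈ Y.cells ∧ w ∈ P)) ∧
    polyDim P + 2 ≤ d}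
  have hκ : Finite κ := by
    refine Set.Finite.to_subtype (s := {P : Set (Fin n → ℝ) |
      ((P ∈ X.cells ∧ w ∈ P) ∨ (P ∈ Y.cells ∧ w ∈ P)) ∧ polyDim P + 2 ≤ d})
      (((X.finite_cells_at w).union (Y.finite_cells_at w)).subset ?_)
    exact fun P hP => hP.1
  have hmain : Metric.ball (0 : B → ℝ) ρ ⊆ U := by
    refine subset_of_codim_two (convex_ball _ _) Metric.isOpen_ball hUc
      (fun P : κ => {x | w + g (bergmanSection M B x) ∈ P.1}) ?_ ?_ ?_
    -- The preimage of `P` in the chart has directions in the projection of the `g`-preimage of the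
    -- direction space of `P`. Its dimension is at most `polyDim P + e`, while the chart has
    -- dimension `d + e`.
    · rintro ⟨P, -, hPd⟩
      refine ⟨(Submodule.span ℝ (bergmanFan M) ⊓ (vectorSpan ℝ P).comap g).map (coordProj B),
        ?_, fun x hx y hy => ?_⟩
      · rw [finrank_coord h.rank hB]
        have h1 := Submodule.finrank_map_le (coordProj B)
          (Submodule.span ℝ (bergmanFan M) ⊓ (vectorSpan ℝ P).comap g)
        have h2 := h.finrank_comap_le (vectorSpan ℝ P)
        unfold polyDim at hPd
        omega
      · refine ⟨bergmanSection M B x - bergmanSection M B y, ⟨Submodule.sub_mem _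
          (Submodule.subset_span (bergmanSection_mem h.ground h.nonempty hB x))
          (Submodule.subset_span (bergmanSection_mem h.ground h.nonempty hB y)), ?_⟩, ?_⟩
        · have := sub_mem_vectorSpan hx hy
          rw [add_sub_add_left_eq_sub, ← map_sub] at this
          exact this
        · rw [map_sub, coordProj_bergmanSection h.ground h.nonempty hB,
            coordProj_bergmanSection h.ground h.nonempty hB]
    · rintro x ⟨hxD, hxU⟩ hxZ
      have hxρ : ‖x‖ < ρ := by simpa using hxD
      have hdimX : ∀ P ∈ X.cells, w + g (bergmanSection M B x) ∈ P → d ≤ polyDim P + 1 := by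
        intro P hP hxP
        by_contra hlt
        exact hxZ ⟨P, Or.inl ⟨hP, (hcX P hP _ (hball x hxρ).1 hxP).1⟩, by omega⟩ hxP
      have hdimY : ∀ P ∈ Y.cells, w + g (bergmanSection M B x) ∈ P → d ≤ polyDim P + 1 := by
        intro P hP hxP
        by_contra hlt
        exact hxZ ⟨P, Or.inr ⟨hP, (hcY P hP _ (hball x hxρ).2 hxP).1⟩, by omega⟩ hxP
      have hev := eventually_mem_of_star_subset hCsub
        (star_subset_of_codim_one hX hm hsub hxU hdimX hdimY)
      have hev' := (continuous_const.add hc).continuousAt (x := x) |>.eventually hev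
      filter_upwards [hev', Metric.isOpen_ball.mem_nhds hxD] with y hy hyD
      exact hy (hinX y (by simpa using hyD))
    · obtain ⟨x₀, hx₀⟩ := hne
      obtain ⟨t, ht, htρ⟩ := hsmall x₀
      refine ⟨t • x₀, mem_interior.2 ⟨(fun y => t⁻¹ • y) ⁻¹' O ∩ Metric.ball 0 ρ, ?_,
        (hO.preimage (continuous_const_smul _)).inter Metric.isOpen_ball, ?_, ?_⟩, ?_⟩
      · rintro y ⟨hyO, hyρ⟩
        refine (hUiff y (by simpa using hyρ)).2 ?_
        rw [← hscale y (inv_pos.2 ht)]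
        exact hOs _ hyO
      · simpa [inv_smul_smul₀ ht.ne'] using hx₀
      · simpa using htρ
      · simpa using htρ
  obtain ⟨t, ht, htρ⟩ := hsmall x
  rw [← hscale x ht, ← hUiff _ htρ]
  exact hmain (by simpa using htρ)

/-- A balanced subset of full dimension of a tropical manifold fills the star at each of its
points. -/
theorem star_subset (hX : X.IsTropicalManifold d) {m : Y.Cell d → ℚ}
    (hm : m ∈ Y.minkowskiWeights d) (hsub : ⋃₀ weightCells m ⊆ X.support) {w : Fin n → ℝ}
    (hw : w ∈ ⋃₀ weightCells m) :
    dirStar X.support w ⊆ dirStar (⋃₀ weightCells m) w := by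
  classical
  obtain ⟨k, M, g, e, h⟩ := exists_bergmanModel hX (hsub hw)
  have hCsub := weightCells_subset m
  have hstar := dirStar_mono hsub w
  let Full : Set (Fin k) → Prop := fun B =>
    ∀ x : B → ℝ, g (bergmanSection M B x) ∈ dirStar (⋃₀ weightCells m) w
  -- On the non-empty open cone where the new coordinate `b'` is strictly smallest, the new section
  -- takes values in the image of the old one.
  have hexch : ∀ {B : Set (Fin k)} {b b' : Fin k}, M.IsBase B →
      M.IsBase (insert b' (B \ {b})) → Full B → Full (insert b' (B \ {b})) := by
    intro B b b' hB hB' hfull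
    have hO : IsOpen {x : ↥(insert b' (B \ {b})) → ℝ |
        ∀ i : ↥(insert b' (B \ {b})), (i : Fin k) ≠ b' → x ⟨b', Set.mem_insert _ _⟩ < x i} := by
      simp only [Set.ofPred_forall]
      exact isOpen_iInter_of_finite fun i => isOpen_iInter_of_finite fun _ =>
        isOpen_lt (continuous_apply _) (continuous_apply _)
    refine fun x => star_subset_of_isOpen hX hm hsub h hB' hO
      ⟨fun i => if (i : Fin k) = b' then 0 else 1, fun i hi => by simp [hi]⟩ (fun x hx => ?_) x
    obtain ⟨y, hy⟩ := bergmanSection_exchange h.ground h.nonempty hB hB' x (fun i => by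
      by_cases hi : (i : Fin k) = b'
      · exact (congrArg x (Subtype.ext hi.symm)).le
      · exact (hx i hi).le)
    rw [← hy]
    exact hfull y
  have hall : ∀ (N : ℕ) {B B'' : Set (Fin k)}, M.IsBase B → M.IsBase B'' →
      (B \ B'').ncard = N → Full B → Full B'' := by
    intro N
    induction N with
    | zero =>
      intro B B'' hB hB'' hN hfull
      rw [Set.ncard_eq_zero, Set.sdiff_eq_empty] at hN
      rwa [← hB.eq_of_subset_isBase hB'' hN]
    | succ N ih =>
      intro B B'' hB hB'' hN hfull
      obtain ⟨b, hb⟩ : (B \ B'').Nonempty := by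
        rw [← Set.ncard_pos]
        omega
      obtain ⟨b', hb', hB'⟩ := hB.exchange hB'' hb
      refine ih hB' hB'' ?_ (hexch hB hB' hfull)
      have : insert b' (B \ {b}) \ B'' = (B \ B'') \ {b} := by
        ext i
        simp only [Set.mem_sdiff, Set.mem_insert_iff, Set.mem_singleton_iff]
        constructor
        · rintro ⟨rfl | ⟨h1, h2⟩, h3⟩
          · exact absurd hb'.1 h3
          · exact ⟨⟨h1, h3⟩, h2⟩
        · rintro ⟨⟨h1, h3⟩, h2⟩
          exact ⟨Or.inr ⟨h1, h2⟩, h3⟩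
      rw [this, Set.ncard_sdiff_singleton_of_mem hb]
      omega
  -- The first chart comes from a weighted cell `σ` through `w`. The preimage `K` of its direction
  -- space has dimension `d + e`, so the projection of `K` to the coordinates of a suitable basis is
  -- injective, hence bijective and open.
  obtain ⟨B₀, hB₀, hfull₀⟩ : ∃ B₀, M.IsBase B₀ ∧ Full B₀ := by
    obtain ⟨σ, hσ, hwσ⟩ := hw
    have hσY := hCsub hσ
    have hσd : polyDim σ = d := by
      obtain ⟨σ', rfl, -⟩ := hσ
      exact σ'.2.2
    obtain ⟨⟨y, hy⟩, -⟩ := exists_relInt (Y.rational σ hσY) (Y.nonempty σ hσY)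
    obtain ⟨hyσ, δ, hδ, hyδ⟩ := hy
    have hcone : ∀ u, w + u ∈ σ → u ∈ dirStar (⋃₀ weightCells m) w := fun u hu =>
      Y.mem_dirStar_of_mem_cell hCsub hσ hwσ one_pos (by rwa [one_smul])
    have hDspan : vectorSpan ℝ σ ≤ Submodule.span ℝ (dirStar X.support w) := by
      have h1 : ∀ x ∈ σ, x - w ∈ Submodule.span ℝ (dirStar X.support w) := fun x hx =>
        Submodule.subset_span (hstar (hcone _ (by rwa [add_sub_cancel])))
      refine vectorSpan_le_of_forall fun x hx y hy => ?_
      simpa using Submodule.sub_mem _ (h1 x hx) (h1 y hy)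
    set K := Submodule.span ℝ (bergmanFan M) ⊓ (vectorSpan ℝ σ).comap g with hK
    have hKdim : finrank ℝ K = d + e := by
      rw [hK, h.finrank_comap_eq hDspan, ← hσd]
      rfl
    have hgc : Continuous g := LinearMap.continuous_of_finiteDimensional g
    have hUo : IsOpen {x | ‖g x - (y - w)‖ < δ} :=
      isOpen_lt (hgc.sub continuous_const).norm continuous_const
    have hKU : ∀ x ∈ (K : Set (Fin k → ℝ)) ∩ {x | ‖g x - (y - w)‖ < δ}, w + g x ∈ σ := by
      rintro x ⟨hxK, hx⟩
      have := hyδ _ (Submodule.sub_mem _ hxK.2 (sub_mem_vectorSpan hyσ hwσ)) hx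
      convert this using 1
      abel
    obtain ⟨x₀, hx₀, hx₀y⟩ := h.surj (y - w) (hstar (hcone _ (by rwa [add_sub_cancel])))
    obtain ⟨B, hB, ⟨U', hU', hUU', ⟨x₁, hx₁⟩, hsec⟩, hinj⟩ := exists_isBase_of_isOpen h.ground
      h.nonempty K hUo ⟨x₀, ⟨Submodule.subset_span hx₀, by
        rw [SetLike.mem_coe, Submodule.mem_comap, hx₀y]
        exact sub_mem_vectorSpan hyσ hwσ⟩, by simp [hx₀y, hδ]⟩
      (fun x hx => (h.mem_iff x hx.1.1).1 (hstar (hcone _ (hKU x hx))))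
    refine ⟨B, hB, ?_⟩
    have hfinj : Function.Injective ((coordProj B).domRestrict K) := by
      rw [← LinearMap.ker_eq_bot, LinearMap.ker_eq_bot']
      rintro ⟨x, hx⟩ hx0
      exact Subtype.ext (hinj x hx hx0)
    have hfsurj : Function.Surjective ((coordProj B).domRestrict K) :=
      (LinearMap.injective_iff_surjective_of_finrank_eq_finrank
        (by rw [hKdim, finrank_coord h.rank hB])).1 hfinj
    have hopen := LinearMap.isOpenMap_of_finiteDimensional _ hfsurj
    refine star_subset_of_isOpen hX hm hsub h hB
      (hopen _ (hU'.preimage (continuous_subtype_val (p := fun x => x ∈ K))))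
      ⟨_, ⟨x₁, hx₁.1⟩, hx₁.2, rfl⟩ ?_
    rintro _ ⟨⟨x, hxK⟩, hxU, rfl⟩
    have : bergmanSection M B ((coordProj B).domRestrict K ⟨x, hxK⟩) = x := hsec x ⟨hxK, hxU⟩
    rw [this]
    exact hcone _ (hKU x ⟨hxK, hUU' hxU⟩)
  intro u hu
  obtain ⟨x, hx, rfl⟩ := h.surj u hu
  obtain ⟨B, hB, hBx⟩ := exists_bergmanSection_eq h.ground h.nonempty hx
  rw [← hBx]
  exact hall _ hB₀ hB rfl hfull₀ _

/-- A non-empty balanced subset of full dimension of a connected tropical manifold is everything. -/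
theorem sUnion_weightCells_eq (hX : X.IsTropicalManifold d) (hconn : IsConnected X.support)
    {m : Y.Cell d → ℚ} (hm : m ∈ Y.minkowskiWeights d) (hsub : ⋃₀ weightCells m ⊆ X.support)
    (hne : (⋃₀ weightCells m).Nonempty) : ⋃₀ weightCells m = X.support := by
  refine hsub.antisymm fun x hx => ?_
  by_contra hxC
  obtain ⟨w, hw⟩ := hne
  have hCsub := weightCells_subset m
  -- Equality of stars makes the closed set of weighted cells relatively open in `|X|`.
  have hint : ⋃₀ weightCells m ⊆ interior {x | x ∈ X.support → x ∈ ⋃₀ weightCells m} :=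
    fun w hw => mem_interior_iff_mem_nhds.2
      (eventually_mem_of_star_subset hCsub (star_subset hX hm hsub hw))
  obtain ⟨z, hzX, hz, hzC⟩ := hconn.isPreconnected _ _ isOpen_interior
    (Y.isClosed_sUnion hCsub).isOpen_compl (fun z hz => by
      by_cases hzC : z ∈ ⋃₀ weightCells m
      · exact Or.inl (hint hzC)
      · exact Or.inr hzC) ⟨w, hsub hw, hint hw⟩ ⟨x, hx, hxC⟩
  exact hzC (interior_subset hz hzX)

/-- The cells at `w` cover a chart `ℝ^B` by finitely many subspaces, so one of these is everything;
comparing dimensions, its cell has dimension at least `d`. -/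
theorem exists_cell_of_dim (hX : X.IsTropicalManifold d) (hne : X.support.Nonempty) :
    Nonempty (X.Cell d) := by
  classical
  obtain ⟨w, hw⟩ := hne
  obtain ⟨k, M, g, e, h⟩ := exists_bergmanModel hX hw
  obtain ⟨B, hB⟩ := M.exists_isBase
  have hfin : Finite {P | P ∈ X.cells ∧ w ∈ P} := (X.finite_cells_at w).to_subtype
  obtain ⟨P, hP⟩ := Subspace.exists_eq_top_of_iUnion_eq_univ (k := ℝ) (E := B → ℝ)
    (p := fun P : {P | P ∈ X.cells ∧ w ∈ P} =>
      (Submodule.span ℝ (bergmanFan M) ⊓ (vectorSpan ℝ P.1).comap g).map (coordProj B)) (by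
      rw [Set.eq_univ_iff_forall]
      intro x
      have hx := bergmanSection_mem h.ground h.nonempty hB x
      have hxH := Submodule.subset_span (R := ℝ) hx
      obtain ⟨P, hP, hwP, ε, hε, hu⟩ := X.exists_cell_of_mem_dirStar (C := X.cells) Set.Subset.rfl
        ((h.mem_iff _ hxH).2 hx)
      exact Set.mem_iUnion.2 ⟨⟨P, hP, hwP⟩, bergmanSection M B x,
        ⟨hxH, mem_vectorSpan_of_smul_mem hwP hε hu⟩,
        coordProj_bergmanSection h.ground h.nonempty hB x⟩)
  have h1 := Submodule.finrank_map_le (coordProj B)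
    (Submodule.span ℝ (bergmanFan M) ⊓ (vectorSpan ℝ P.1).comap g)
  have h2 := h.finrank_comap_le (vectorSpan ℝ P.1)
  rw [hP, finrank_top, finrank_coord h.rank hB] at h1
  refine ⟨⟨P.1, P.2.1, le_antisymm (polyDim_le hX P.2.1) ?_⟩⟩
  unfold polyDim
  omega

/-- Subtracting `m σ₀` times the constant weight makes the weight of `σ₀` zero. Were the difference
non-zero, its cells would fill `|X|`; one would then contain a relative interior point of `σ₀` and
hence equal `σ₀`. -/
theorem minkowskiWeights_eq_span (hX : X.IsTropicalManifold d) (hconn : IsConnected X.support) :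
    X.minkowskiWeights d = Submodule.span ℚ {fun _ => 1} := by
  have hone := one_mem_minkowskiWeights hX
  refine le_antisymm (fun m hm => ?_) (Submodule.span_le.2 (by simpa using hone))
  obtain ⟨σ₀⟩ := exists_cell_of_dim hX hconn.nonempty
  have hm' : m - m σ₀ • (fun _ => 1) ∈ X.minkowskiWeights d :=
    Submodule.sub_mem _ hm (Submodule.smul_mem _ _ hone)
  have hzero : m - m σ₀ • (fun _ => 1) = 0 := by
    by_contra hne
    obtain ⟨σ, hσ⟩ := Function.ne_iff.1 hne
    obtain ⟨x, hx⟩ := X.nonempty σ.1 σ.2.1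
    have heq := sUnion_weightCells_eq hX hconn hm'
      (Set.sUnion_subset_sUnion (weightCells_subset _)) ⟨x, σ.1, ⟨σ, rfl, hσ⟩, hx⟩
    obtain ⟨⟨z, hz⟩, -⟩ := exists_relInt (X.rational σ₀.1 σ₀.2.1) (X.nonempty σ₀.1 σ₀.2.1)
    have hzX : z ∈ X.support := ⟨σ₀.1, σ₀.2.1, hz.1⟩
    rw [← heq] at hzX
    obtain ⟨_, ⟨ρ, rfl, hρ⟩, hzρ⟩ := hzX
    have h1 := eq_of_subset_of_polyDim σ₀.2.1 ρ.2.1 (subset_of_relInt σ₀.2.1 ρ.2.1 hz hzρ)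
      (by rw [σ₀.2.2, ρ.2.2])
    have h2 : ρ = σ₀ := Subtype.ext h1.symm
    exact hρ (by simp [h2])
  rw [sub_eq_zero.1 hzero]
  exact Submodule.smul_mem _ _ (Submodule.mem_span_singleton_self _)

theorem finrank_minkowskiWeights (hX : X.IsTropicalManifold d) (hconn : IsConnected X.support) :
    finrank ℚ (X.minkowskiWeights d) = 1 := by
  obtain ⟨σ⟩ := exists_cell_of_dim hX hconn.nonempty
  rw [minkowskiWeights_eq_span hX hconn]
  exact finrank_span_singleton fun h => one_ne_zero (congrFun h σ)

theorem support_eq_of_isTropicalVariety (hX : X.IsTropicalManifold d)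
    (hconn : IsConnected X.support) (hY : Y.IsTropicalVariety d) (hYX : Y.support ⊆ X.support) :
    Y.support = X.support := by
  obtain ⟨⟨P, hP⟩, hpure, m, hm, hm0⟩ := hY
  have heq : ⋃₀ weightCells m = Y.support := by
    refine (Set.sUnion_subset_sUnion (weightCells_subset m)).antisymm ?_
    rintro x ⟨Q, hQ, hx⟩
    obtain ⟨-, R, hR, hQR, hRd⟩ := hpure Q hQ
    exact ⟨R, ⟨⟨R, hR, hRd⟩, rfl, hm0 _⟩, hQR hx⟩
  rw [← heq] at hYX ⊢
  refine sUnion_weightCells_eq hX hconn hm hYX ?_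
  rw [heq]
  obtain ⟨x, hx⟩ := Y.nonempty P hP
  exact ⟨x, P, hP, hx⟩

end Rigidity

end RationalPolyhedralComplex

/-! ### Bergman fans through bases of maximal weight -/

section WeightMaximalBases

variable {m : ℕ} {M : Matroid (Fin m)}

theorem sum_insert_erase {B : Finset (Fin m)} {i j : Fin m} (hi : i ∈ B) (hj : j ∉ B)
    (v : Fin m → ℝ) : ∑ k ∈ insert j (B.erase i), v k = ∑ k ∈ B, v k - v i + v j := by
  rw [Finset.sum_insert (fun h => hj (Finset.mem_of_mem_erase h)), ← Finset.add_sum_erase B v hi]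
  ring

/-- A point lies in the Bergman fan if and only if every element of the ground set is in a basis of
maximal weight. -/
theorem mem_bergmanFan_iff_forall_exists_isBase (hE : M.E = Set.univ) {v : Fin m → ℝ} :
    v ∈ bergmanFan M ↔ ∀ i, ∃ B : Finset (Fin m), M.IsBase B ∧
      (∀ B' : Finset (Fin m), M.IsBase B' → ∑ k ∈ B', v k ≤ ∑ k ∈ B, v k) ∧ i ∈ B := by
  constructor
  · intro hv j
    obtain ⟨B₀, hB₀⟩ := M.exists_isBase
    obtain ⟨B, hB, hmax⟩ := (Set.toFinite {B : Finset (Fin m) | M.IsBase B}).exists_maximalFor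
      (fun B => ∑ k ∈ B, v k) _ ⟨(Set.toFinite B₀).toFinset, by simpa using hB₀⟩
    have hB : M.IsBase (B : Set (Fin m)) := hB
    have hmax' : ∀ B' : Finset (Fin m), M.IsBase B' → ∑ k ∈ B', v k ≤ ∑ k ∈ B, v k :=
      fun B' hB' => (le_total (∑ k ∈ B, v k) (∑ k ∈ B', v k)).elim (fun h => hmax hB' h) id
    by_cases hj : j ∈ B
    · exact ⟨B, hB, hmax', hj⟩
    have hjB : j ∉ (B : Set (Fin m)) := hj
    have hC := hB.fundCircuit_isCircuit (hE ▸ Set.mem_univ j) hjB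
    obtain ⟨a, ha, b, hb, hab, h⟩ := hv _ hC
    -- The minimum over the fundamental circuit is attained away from `j`, so exchanging that
    -- element for `j` does not lower the weight.
    obtain ⟨k, hk, hkj, hle⟩ : ∃ k ∈ M.fundCircuit j B, k ≠ j ∧ v k ≤ v j := by
      have hjC := M.mem_fundCircuit j B
      by_cases haj : a = j
      · exact ⟨b, hb, fun h' => hab (haj.trans h'.symm), (h j hjC).2⟩
      · exact ⟨a, ha, haj, (h j hjC).1⟩
    have hkB : k ∈ B := (M.fundCircuit_subset_insert j B hk).resolve_left hkj
    have hB' : M.IsBase (insert j (B.erase k) : Finset (Fin m)) := by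
      have := hB.exchange_isBase_of_indep' (e := k) (f := j) hkB hjB
        ((hB.indep.mem_fundCircuit_iff (by rw [hB.closure_eq, hE]; trivial) hjB).1 hk)
      rwa [← Set.insert_sdiff_singleton_comm hkj.symm, ← Finset.coe_erase,
        ← Finset.coe_insert] at this
    refine ⟨_, hB', fun B'' hB'' => (hmax' B'' hB'').trans ?_, Finset.mem_insert_self _ _⟩
    rw [sum_insert_erase hkB hj]
    linarith
  · intro h
    rw [mem_bergmanFan_iff]
    intro c j hj
    by_contra! hlt
    obtain ⟨B, hB, hmax, hjB⟩ := h j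
    -- Otherwise `j` would lie in the closure of the rest of `B`. So some `k` with `v k ≥ c > v j`
    -- can replace `j`, contradicting maximality.
    have hnot : ¬ {i | c ≤ v i} ⊆ M.closure ((B : Set (Fin m)) \ {j}) := fun hsub =>
      hB.indep.notMem_closure_sdiff_of_mem hjB
        (M.closure_subset_closure_of_subset_closure hsub hj)
    obtain ⟨k, hk, hkcl⟩ := Set.not_subset.1 hnot
    have hk : c ≤ v k := hk
    have hkB : k ∉ B := fun hkB => hkcl (M.mem_closure_of_mem
      ⟨hkB, fun hkj : k = j => by rw [hkj] at hk; linarith⟩ (by rw [hE]; exact Set.subset_univ _))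
    have hB' := hB.exchange_base_of_notMem_closure hjB hkcl (by rw [hE]; trivial)
    rw [← Finset.coe_erase, ← Finset.coe_insert] at hB'
    have := hmax _ hB'
    rw [sum_insert_erase hjB hkB] at this
    linarith

end WeightMaximalBases

/-! ### Tropical linear spaces, their stars and their connectedness -/

namespace ValuatedMatroid

variable {n r : ℕ} (p : ValuatedMatroid n r)

/-- The valuation tilted by the linear form given by `x`. -/
noncomputable def tilt (x : Fin n → ℝ) (B : Finset (Fin n)) : WithTop ℝ :=
  p.val B + ((-∑ i ∈ B, x i : ℝ) : WithTop ℝ)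

/-- The bases at which the valuation tilted by `x` is minimal. -/
def IsMinBase (x : Fin n → ℝ) (B : Finset (Fin n)) : Prop := ∀ B', p.tilt x B ≤ p.tilt x B'

variable {p}

theorem tilt_eq_top_iff {x : Fin n → ℝ} {B : Finset (Fin n)} :
    p.tilt x B = ⊤ ↔ p.val B = ⊤ := by
  simp [tilt]

theorem exists_isMinBase (p : ValuatedMatroid n r) (x : Fin n → ℝ) : ∃ B, p.IsMinBase x B := by
  obtain ⟨B, -, h⟩ := Finset.exists_min_image Finset.univ (p.tilt x) ⟨∅, Finset.mem_univ _⟩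
  exact ⟨B, fun B' => h B' (Finset.mem_univ _)⟩

theorem IsMinBase.tilt_ne_top {x : Fin n → ℝ} {B : Finset (Fin n)} (h : p.IsMinBase x B) :
    p.tilt x B ≠ ⊤ := by
  obtain ⟨B', hB'⟩ := p.exists_basis
  exact ne_top_of_le_ne_top (fun h' => hB' (tilt_eq_top_iff.1 h')) (h B')

theorem IsMinBase.card_eq {x : Fin n → ℝ} {B : Finset (Fin n)} (h : p.IsMinBase x B) :
    B.card = r := by
  by_contra hc
  exact h.tilt_ne_top (tilt_eq_top_iff.2 (p.eq_top B hc))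

/-- An exchange preserves the multiset union of the two bases, so the linear terms cancel and the
tilted valuation inherits the axiom. -/
theorem tilt_exchange (x : Fin n → ℝ) {B₁ B₂ : Finset (Fin n)} (h₁ : B₁.card = r)
    (h₂ : B₂.card = r) {b₁ : Fin n} (hb₁ : b₁ ∈ B₁ \ B₂) :
    ∃ b₂ ∈ B₂ \ B₁, p.tilt x (insert b₂ (B₁.erase b₁)) + p.tilt x (insert b₁ (B₂.erase b₂)) ≤
      p.tilt x B₁ + p.tilt x B₂ := by
  obtain ⟨b₂, hb₂, h⟩ := p.exchange B₁ B₂ h₁ h₂ b₁ hb₁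
  refine ⟨b₂, hb₂, ?_⟩
  rw [Finset.mem_sdiff] at hb₁ hb₂
  have hs : ((-∑ i ∈ insert b₂ (B₁.erase b₁), x i : ℝ) : WithTop ℝ) +
      ((-∑ i ∈ insert b₁ (B₂.erase b₂), x i : ℝ) : WithTop ℝ) =
      ((-∑ i ∈ B₁, x i : ℝ) : WithTop ℝ) + ((-∑ i ∈ B₂, x i : ℝ) : WithTop ℝ) := by
    rw [sum_insert_erase hb₁.1 hb₂.2, sum_insert_erase hb₂.1 hb₁.2]
    norm_cast
    ring
  unfold tilt
  rw [add_add_add_comm, hs, add_add_add_comm (p.val B₁)]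
  gcongr

/-- Both values on the smaller side are at least the minimum, and their sum is at most twice the
minimum, so both are minimal. -/
theorem IsMinBase.exchange {x : Fin n → ℝ} {B₁ B₂ : Finset (Fin n)} (h₁ : p.IsMinBase x B₁)
    (h₂ : p.IsMinBase x B₂) {b₁ : Fin n} (hb₁ : b₁ ∈ B₁ \ B₂) :
    ∃ b₂ ∈ B₂ \ B₁, p.IsMinBase x (insert b₂ (B₁.erase b₁)) := by
  obtain ⟨b₂, hb₂, h⟩ := tilt_exchange x h₁.card_eq h₂.card_eq hb₁
  refine ⟨b₂, hb₂, fun B' => le_trans ?_ (h₁ B')⟩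
  refine WithTop.le_of_add_le_add_right h₂.tilt_ne_top (le_trans ?_ h)
  gcongr
  exact h₂ _

/-- Up to the finite constant `∑ k ∈ T, x k` the terms of the tropical equation are tilted values,
so the position of the minimum can be read off from the tilt. -/
theorem val_erase_add {x : Fin n → ℝ} {T : Finset (Fin n)} {i : Fin n} (hi : i ∈ T) :
    p.val (T.erase i) + (x i : WithTop ℝ) =
      p.tilt x (T.erase i) + ((∑ k ∈ T, x k : ℝ) : WithTop ℝ) := by
  rw [tilt, add_assoc, ← WithTop.coe_add, ← Finset.add_sum_erase T x hi]
  congr 2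
  ring

theorem val_erase_add_le_iff {x : Fin n → ℝ} {T : Finset (Fin n)} {i j : Fin n} (hi : i ∈ T)
    (hj : j ∈ T) : p.val (T.erase i) + (x i : WithTop ℝ) ≤ p.val (T.erase j) + (x j : WithTop ℝ) ↔
      p.tilt x (T.erase i) ≤ p.tilt x (T.erase j) := by
  rw [val_erase_add hi, val_erase_add hj]
  exact WithTop.add_le_add_iff_right WithTop.coe_ne_top

/-- A point lies in the tropical linear space if and only if its initial matroid has no loops. -/
theorem mem_tropicalLinearSpace_iff {x : Fin n → ℝ} :
    x ∈ p.tropicalLinearSpace ↔ ∀ i, ∃ B, p.IsMinBase x B ∧ i ∈ B := by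
  constructor
  · intro hx i
    obtain ⟨A, hA⟩ := p.exists_isMinBase x
    by_cases hi : i ∈ A
    · exact ⟨A, hA, hi⟩
    obtain ⟨a, ha, b, hb, hab, h⟩ := hx (insert i A) (by
      rw [Finset.card_insert_of_notMem hi, hA.card_eq])
    have hiT := Finset.mem_insert_self i A
    obtain ⟨j, hj, hji, hle⟩ : ∃ j ∈ insert i A, j ≠ i ∧
        p.tilt x ((insert i A).erase j) ≤ p.tilt x ((insert i A).erase i) := by
      by_cases hai : a = i
      · exact ⟨b, hb, fun h' => hab (hai.trans h'.symm),
          (val_erase_add_le_iff hb hiT).1 (h i hiT).2⟩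
      · exact ⟨a, ha, hai, (val_erase_add_le_iff ha hiT).1 (h i hiT).1⟩
    rw [Finset.erase_insert hi] at hle
    exact ⟨_, fun B' => hle.trans (hA B'), Finset.mem_erase.2 ⟨hji.symm, hiT⟩⟩
  · intro h T hT
    obtain ⟨i, hi, hmin⟩ := Finset.exists_min_image T (fun i => p.tilt x (T.erase i))
      (Finset.card_pos.1 (by omega))
    obtain ⟨B, hB, hiB⟩ := h i
    have hA : (T.erase i).card = r := by rw [Finset.card_erase_of_mem hi, hT]; rfl
    -- Exchanging `i` out of `B` brings in some `j ∈ T`. As the value on `B` is minimal, the value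
    -- on `T` without `j` does not exceed that on `T` without `i`, giving a second minimum.
    obtain ⟨j, hj, hle⟩ := tilt_exchange (p := p) x hB.card_eq hA (b₁ := i)
      (by simp [hiB])
    rw [Finset.mem_sdiff, Finset.mem_erase] at hj
    have hT' : insert i ((T.erase i).erase j) = T.erase j := by
      rw [Finset.erase_right_comm, Finset.insert_erase (Finset.mem_erase.2 ⟨hj.1.1.symm, hi⟩)]
    rw [hT'] at hle
    have hle' : p.tilt x (T.erase j) ≤ p.tilt x (T.erase i) := by
      refine WithTop.le_of_add_le_add_left hB.tilt_ne_top (le_trans ?_ hle)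
      gcongr
      exact hB _
    exact ⟨i, hi, j, hj.1.2, hj.1.1.symm, fun k hk =>
      ⟨(val_erase_add_le_iff hi hk).2 (hmin k hk),
        (val_erase_add_le_iff hj.1.2 hk).2 (hle'.trans (hmin k hk))⟩⟩

/-- The initial matroid at `x`, whose bases are the minimizers of the tilted valuation. -/
def initialMatroid (p : ValuatedMatroid n r) (x : Fin n → ℝ) : Matroid (Fin n) :=
  Matroid.ofIsBaseOfFinite (E := Set.univ) Set.finite_univ
    (fun S => ∃ B : Finset (Fin n), p.IsMinBase x B ∧ (B : Set (Fin n)) = S)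
    (let ⟨B, hB⟩ := p.exists_isMinBase x; ⟨B, B, hB, rfl⟩)
    (by
      rintro _ _ ⟨B₁, h₁, rfl⟩ ⟨B₂, h₂, rfl⟩ b₁ hb₁
      obtain ⟨b₂, hb₂, h⟩ := h₁.exchange h₂ (b₁ := b₁) (by simpa using hb₁)
      exact ⟨b₂, by simpa using hb₂, _, h, by simp⟩)
    (fun _ _ => Set.subset_univ _)

theorem initialMatroid_isBase_coe {x : Fin n → ℝ} {B : Finset (Fin n)} :
    (p.initialMatroid x).IsBase B ↔ p.IsMinBase x B := by
  constructor
  · rintro ⟨B', h, hB'⟩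
    rwa [Finset.coe_injective hB'] at h
  · exact fun h => ⟨B, h, rfl⟩

theorem eRank_initialMatroid (x : Fin n → ℝ) : (p.initialMatroid x).eRank = r := by
  obtain ⟨B, hB⟩ := p.exists_isMinBase x
  rw [← (initialMatroid_isBase_coe.2 hB).encard_eq_eRank, Set.encard_coe_eq_coe_finsetCard,
    hB.card_eq]

theorem tilt_add_smul (w v : Fin n → ℝ) (t : ℝ) (B : Finset (Fin n)) :
    p.tilt (w + t • v) B = p.tilt w B + ((-(t * ∑ i ∈ B, v i) : ℝ) : WithTop ℝ) := by
  rw [tilt, tilt, add_assoc, ← WithTop.coe_add]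
  congr 2
  simp only [Pi.add_apply, Pi.smul_apply, smul_eq_mul, Finset.sum_add_distrib, Finset.mul_sum]
  ring

theorem eventually_tilt_lt (p : ValuatedMatroid n r) (w v : Fin n → ℝ) :
    ∀ᶠ t in 𝓝[>] (0 : ℝ), ∀ B B', p.tilt w B < p.tilt w B' →
      p.tilt (w + t • v) B < p.tilt (w + t • v) B' := by
  rw [eventually_all]
  intro B
  rw [eventually_all]
  intro B'
  by_cases h : p.tilt w B < p.tilt w B'
  swap
  · exact Eventually.of_forall fun t h' => absurd h' h
  obtain ⟨a, ha⟩ := WithTop.ne_top_iff_exists.1 (ne_top_of_lt h)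
  by_cases htop : p.tilt w B' = ⊤
  · refine Eventually.of_forall fun t _ => ?_
    rw [tilt_add_smul, tilt_add_smul, htop, WithTop.top_add, ← ha, ← WithTop.coe_add]
    exact WithTop.coe_lt_top _
  obtain ⟨b, hb⟩ := WithTop.ne_top_iff_exists.1 htop
  rw [← ha, ← hb, WithTop.coe_lt_coe] at h
  have hc : ContinuousAt (fun t : ℝ => b + -(t * ∑ i ∈ B', v i) - (a + -(t * ∑ i ∈ B, v i))) 0 := by
    fun_prop
  have hpos := hc.eventually (lt_mem_nhds (a := 0) (by simpa using h))
  filter_upwards [nhdsWithin_le_nhds hpos] with t ht _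
  rw [tilt_add_smul, tilt_add_smul, ← ha, ← hb, ← WithTop.coe_add, ← WithTop.coe_add,
    WithTop.coe_lt_coe]
  linarith

/-- Close to `w`, the minimal bases are the minimal bases at `w` of maximal weight. -/
theorem eventually_isMinBase_iff (p : ValuatedMatroid n r) (w v : Fin n → ℝ) :
    ∀ᶠ t in 𝓝[>] (0 : ℝ), ∀ B, p.IsMinBase (w + t • v) B ↔ p.IsMinBase w B ∧
      ∀ B', p.IsMinBase w B' → ∑ i ∈ B', v i ≤ ∑ i ∈ B, v i := by
  filter_upwards [p.eventually_tilt_lt w v, self_mem_nhdsWithin] with t ht ht0 B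
  have ht0 : 0 < t := ht0
  have heq : ∀ {B B'}, p.IsMinBase w B → p.IsMinBase w B' →
      (p.tilt (w + t • v) B ≤ p.tilt (w + t • v) B' ↔ ∑ i ∈ B', v i ≤ ∑ i ∈ B, v i) := by
    intro B B' hB hB'
    rw [tilt_add_smul, tilt_add_smul, le_antisymm (hB B') (hB' B),
      WithTop.add_le_add_iff_left hB'.tilt_ne_top, WithTop.coe_le_coe, neg_le_neg_iff,
      mul_le_mul_iff_right₀ ht0]
  constructor
  · intro hB
    have hBw : p.IsMinBase w B := fun B' => by
      by_contra! hlt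
      exact (ht _ _ hlt).not_ge (hB B')
    exact ⟨hBw, fun B' hB' => (heq hBw hB').1 (hB B')⟩
  · rintro ⟨hB, hmax⟩ B'
    rcases (hB B').lt_or_eq with hlt | he
    · exact (ht _ _ hlt).le
    · have hB' : p.IsMinBase w B' := fun B'' => he ▸ hB B''
      exact (heq hB hB').2 (hmax B' hB')

/-- The star of a tropical linear space at `w` is the Bergman fan of the initial matroid at `w`. -/
theorem dirStar_tropicalLinearSpace {w : Fin n → ℝ} (hw : w ∈ p.tropicalLinearSpace) :
    dirStar p.tropicalLinearSpace w = bergmanFan (p.initialMatroid w) := by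
  ext v
  rw [mem_bergmanFan_iff_forall_exists_isBase rfl]
  simp only [initialMatroid_isBase_coe]
  -- For small `t > 0` the minimal bases at `w + t • v` no longer depend on `t`, so membership there
  -- is a condition on `v` alone.
  have hev : ∀ᶠ t in 𝓝[>] (0 : ℝ), (w + t • v ∈ p.tropicalLinearSpace ↔
      ∀ i, ∃ B : Finset (Fin n), p.IsMinBase w B ∧
        (∀ B' : Finset (Fin n), p.IsMinBase w B' → ∑ k ∈ B', v k ≤ ∑ k ∈ B, v k) ∧ i ∈ B) := by
    filter_upwards [p.eventually_isMinBase_iff w v] with t ht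
    rw [mem_tropicalLinearSpace_iff]
    simp only [ht, and_assoc]
  constructor
  · rintro ⟨ε, hε, h⟩
    obtain ⟨t, ht, ht0, htε⟩ := (hev.and (Ioc_mem_nhdsGT hε)).exists
    exact ht.1 (h t ht0.le htε)
  · intro h
    obtain ⟨ε, hε, hsub⟩ := mem_nhdsGT_iff_exists_Ioc_subset.1 hev
    refine ⟨ε, hε, fun t ht0 htε => ?_⟩
    rcases ht0.eq_or_lt with rfl | ht0
    · simpa using hw
    · exact (hsub ⟨ht0, htε⟩).2 h

/-- For each `T`, whichever of `x` and `y` has the smaller minimum provides two indices that still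
attain the minimum for `x ⊓ y`. -/
theorem inf_mem_tropicalLinearSpace {x y : Fin n → ℝ} (hx : x ∈ p.tropicalLinearSpace)
    (hy : y ∈ p.tropicalLinearSpace) : x ⊓ y ∈ p.tropicalLinearSpace := by
  have key : ∀ {x y : Fin n → ℝ} {T : Finset (Fin n)} {i j i' : Fin n}, i' ∈ T → i ∈ T →
      (∀ k ∈ T, p.val (T.erase i) + (x i : WithTop ℝ) ≤ p.val (T.erase k) + (x k : WithTop ℝ) ∧
        p.val (T.erase j) + (x j : WithTop ℝ) ≤ p.val (T.erase k) + (x k : WithTop ℝ)) →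
      (∀ k ∈ T, p.val (T.erase i') + (y i' : WithTop ℝ) ≤ p.val (T.erase k) + (y k : WithTop ℝ)) →
      p.val (T.erase i) + (x i : WithTop ℝ) ≤ p.val (T.erase i') + (y i' : WithTop ℝ) →
      ∀ k ∈ T, p.val (T.erase i) + ((x ⊓ y) i : WithTop ℝ) ≤
          p.val (T.erase k) + ((x ⊓ y) k : WithTop ℝ) ∧
        p.val (T.erase j) + ((x ⊓ y) j : WithTop ℝ) ≤
          p.val (T.erase k) + ((x ⊓ y) k : WithTop ℝ) := by
    intro x y T i j i' hi' hi hx hy hle k hk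
    have hinf : ∀ l, p.val (T.erase l) + ((x ⊓ y) l : WithTop ℝ) ≤
        p.val (T.erase l) + (x l : WithTop ℝ) := fun l =>
      add_le_add le_rfl (WithTop.coe_le_coe.2 (min_le_left (x l) (y l)))
    have hk' : p.val (T.erase i) + (x i : WithTop ℝ) ≤
        p.val (T.erase k) + ((x ⊓ y) k : WithTop ℝ) := by
      rw [Pi.inf_apply]
      rcases min_choice (x k) (y k) with h | h <;> rw [h]
      · exact (hx k hk).1
      · exact hle.trans (hy k hk)
    exact ⟨(hinf i).trans hk', (hinf j).trans ((hx i hi).2.trans hk')⟩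
  intro T hT
  obtain ⟨i, hi, j, hj, hij, h⟩ := hx T hT
  obtain ⟨i', hi', j', hj', hij', h'⟩ := hy T hT
  rcases le_total (p.val (T.erase i) + (x i : WithTop ℝ))
    (p.val (T.erase i') + (y i' : WithTop ℝ)) with hle | hle
  · exact ⟨i, hi, j, hj, hij, key hi' hi h (fun k hk => (h' k hk).1) hle⟩
  · rw [inf_comm]
    exact ⟨i', hi', j', hj', hij', key hi hi' h' (fun k hk => (h k hk).1) hle⟩

theorem add_const_mem_tropicalLinearSpace {x : Fin n → ℝ} (hx : x ∈ p.tropicalLinearSpace)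
    (c : ℝ) : (x + fun _ => c) ∈ p.tropicalLinearSpace := by
  intro T hT
  obtain ⟨i, hi, j, hj, hij, h⟩ := hx T hT
  refine ⟨i, hi, j, hj, hij, fun k hk => ?_⟩
  simp only [Pi.add_apply, WithTop.coe_add, ← add_assoc]
  exact ⟨add_le_add_left (h k hk).1 _, add_le_add_left (h k hk).2 _⟩

/-- The tropical combinations `(x + s) ⊓ (y + t)` form a continuous image of the plane inside the
space, and for `t` or `s` large compared with the other they give back `x` and `y`. -/
theorem isConnected_tropicalLinearSpace (hne : p.tropicalLinearSpace.Nonempty) :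
    IsConnected p.tropicalLinearSpace := by
  refine ⟨hne, isPreconnected_of_forall_pair fun x hx y hy => ?_⟩
  let f : ℝ × ℝ → Fin n → ℝ := fun s => (x + fun _ => s.1) ⊓ (y + fun _ => s.2)
  have hf : Continuous f := by
    refine continuous_pi fun i => ?_
    change Continuous fun s : ℝ × ℝ => min (x i + s.1) (y i + s.2)
    fun_prop
  obtain ⟨c, hc⟩ : ∃ c : ℝ, ∀ i, |x i - y i| ≤ c := by
    obtain ⟨c, hc⟩ := (Set.finite_range fun i => |x i - y i|).bddAbove
    exact ⟨c, fun i => hc ⟨i, rfl⟩⟩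
  refine ⟨Set.range f, ?_, ⟨(0, c), ?_⟩, ⟨(c, 0), ?_⟩, isPreconnected_range hf⟩
  · rintro _ ⟨s, rfl⟩
    exact inf_mem_tropicalLinearSpace (add_const_mem_tropicalLinearSpace hx _)
      (add_const_mem_tropicalLinearSpace hy _)
  · funext i
    have := abs_le.1 (hc i)
    change min (x i + 0) (y i + c) = x i
    rw [add_zero, min_eq_left (by linarith)]
  · funext i
    have := abs_le.1 (hc i)
    change min (x i + c) (y i + 0) = y i
    rw [add_zero, min_eq_right (by linarith)]

end ValuatedMatroid

/-! ### Conclusion -/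

theorem IntegrallyIsomorphic.of_eq {n : ℕ} {S T : Set (Fin n → ℝ)} (h : S = T) :
    IntegrallyIsomorphic (integerLattice n) S (integerLattice n) T := by
  subst h
  exact ⟨LinearEquiv.refl _ _, fun _ => Iff.rfl, fun _ => Iff.rfl⟩

/-- The star depends only on the support, so every complex supported on the tropical linear space
has the Bergman fans of the initial matroids as its stars, with the identity as isomorphism. -/
theorem RationalPolyhedralComplex.isTropicalManifold_of_support_eq {n d : ℕ}
    {X : RationalPolyhedralComplex n} {p : ValuatedMatroid n d}
    (h : X.support = p.tropicalLinearSpace) : X.IsTropicalManifold d := by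
  intro w hw
  refine ⟨n, p.initialMatroid w, rfl, Or.inl ⟨p.eRank_initialMatroid w, .of_eq ?_⟩⟩
  change dirStar X.support w = _
  rw [h] at hw ⊢
  exact ValuatedMatroid.dirStar_tropicalLinearSpace hw

theorem mainTheorem5 (n d : ℕ) :
    (∀ X : RationalPolyhedralComplex n, X.IsTropicalManifold d → IsConnected X.support →
      Module.finrank ℚ (X.minkowskiWeights d) = 1 ∧
      X.minkowskiWeights d = Submodule.span ℚ {fun _ => 1} ∧
      ∀ Y : RationalPolyhedralComplex n, Y.IsTropicalVariety d → Y.support ⊆ X.support →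
        Y.support = X.support) ∧
    (∀ (p : ValuatedMatroid n d) (X : RationalPolyhedralComplex n),
      p.tropicalLinearSpace.Nonempty → X.support = p.tropicalLinearSpace →
      X.IsTropicalManifold d ∧ IsConnected X.support) := by
  refine ⟨fun X hX hc => ⟨X.finrank_minkowskiWeights hX hc, X.minkowskiWeights_eq_span hX hc,
    fun Y hY hYX => RationalPolyhedralComplex.support_eq_of_isTropicalVariety hX hc hY hYX⟩,
    fun p X hne hX => ⟨RationalPolyhedralComplex.isTropicalManifold_of_support_eq hX, ?_⟩⟩
  rw [hX]
  exact ValuatedMatroid.isConnected_tropicalLinearSpace hne
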